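/- Let $(R,\mathfrak m)$ be a Noetherian local ring of prime characteristic $p>0$ and Krull dimension $d>0$, and let $\mathfrak a$ and $I$ be $\mathfrak m$-primary ideals of $R$. Let $\lambda$ denote length, let $I^{[q]}$ be the ideal generated by all $x^q$ with $x\in I$, and let $e(\mathfrak a)=\lim_{k\to\infty} d!\,\lambda(R/\mathfrak a^k)/k^d$ be the Hilbert–Samuel multiplicity of $\mathfrak a$. For a real number $t>0$, the joint Hilbert–Kunz multiplicity $e_{HK}(\mathfrak a^t,I)$ is the real number $c$ such that $$\lambda\bigl(R/\mathfrak a^{\lceil tq\rceil}I^{[q]}\bigr)=c\,q^d+O(q^{d-1})\qquad (q=p^e,\ e\to\infty).$$ Then $e_{HK}(\mathfrak a^t,I)$ is well defined for every $t>0$, and $t\mapsto e_{HK}(\mathfrak a^t,I)$ is a continuous function on $(0,\infty)$. More precisely, if $I$ can be generated by $n$ elements, then for all real numbers $0<t\le t'$ $$0\le e_{HK}(\mathfrak a^{t'},I)-e_{HK}(\mathfrak a^{t},I)\le \frac{n\,e(\mathfrak a)\,(t'^{\,d}-t^{\,d})}{d!}.$$ -/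

import Mathlib

open Filter Topology Asymptotics

namespace JointHK

/-- The Krull dimension of `R` as a natural number (equal to `ringKrullDim R` whenever the
latter is finite, in particular for Noetherian local rings). -/
noncomputable def dim (R : Type*) [CommRing R] : ℕ :=
  ((ringKrullDim R).unbotD 0).toNat

theorem dim_eq {R : Type*} [CommRing R] {d : ℕ} (hd : ringKrullDim R = d) : dim R = d := by
  rw [dim, hd]; rfl

/-- An `𝔪`-primary ideal of a local ring `(R, 𝔪)`. -/
def IsMPrimary {R : Type*} [CommRing R] [IsLocalRing R] (I : Ideal R) : Prop :=
  I.IsPrimary ∧ I.radical = IsLocalRing.maximalIdeal R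

/-- The ideal `I^{[q]}` generated by all `x ^ q` with `x ∈ I` (the Frobenius power of `I` when
`q` is a power of the characteristic). -/
def frobeniusPower {R : Type*} [CommRing R] (I : Ideal R) (q : ℕ) : Ideal R :=
  Ideal.span ((fun x : R => x ^ q) '' (I : Set R))

/-- The length `λ(R/J)` as a natural number (it is finite for `𝔪`-primary `J` in a Noetherian
local ring). -/
noncomputable def colength {R : Type*} [CommRing R] (J : Ideal R) : ℕ :=
  (Module.length R (R ⧸ J)).toNat

/-- The function `ℓ(q) = λ(R / 𝔞^⌈t q⌉ I^{[q]})`. -/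
noncomputable def jointLength {R : Type*} [CommRing R] (𝔞 I : Ideal R) (t : ℝ) (q : ℕ) : ℕ :=
  colength (𝔞 ^ ⌈t * (q : ℝ)⌉₊ * frobeniusPower I q)

/-- `c` satisfies `ℓ(q) = c q ^ d + O(q ^ (d - 1))` for `q = p ^ e`, `e → ∞`, where
`d = dim R`. -/
def IsJointHKMultiplicity {R : Type*} [CommRing R] (p : ℕ) (𝔞 I : Ideal R) (t c : ℝ) : Prop :=
  (fun e : ℕ => (jointLength 𝔞 I t (p ^ e) : ℝ) - c * ((p : ℝ) ^ e) ^ dim R)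
    =O[atTop] (fun e : ℕ => ((p : ℝ) ^ e) ^ (dim R - 1))

/-- The joint Hilbert–Kunz multiplicity `e_HK(𝔞^t, I)`: the number `c` with
`ℓ(q) = c q ^ d + O(q ^ (d - 1))`. -/
noncomputable def eHK {R : Type*} [CommRing R] (p : ℕ) (𝔞 I : Ideal R) (t : ℝ) : ℝ :=
  Classical.epsilon (IsJointHKMultiplicity p 𝔞 I t)

/-- The Hilbert–Samuel multiplicity `e(𝔞) = lim_{k → ∞} d! λ(R/𝔞^k) / k^d`, `d = dim R`. -/
noncomputable def hilbertSamuelMultiplicity {R : Type*} [CommRing R] (𝔞 : Ideal R) : ℝ :=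
  limUnder atTop
    (fun k : ℕ => ((dim R).factorial : ℝ) * (colength (𝔞 ^ k) : ℝ) / (k : ℝ) ^ dim R)

theorem IsJointHKMultiplicity.tendsto {R : Type*} [CommRing R] {p : ℕ} (hp : 1 < p)
    (hd : 0 < dim R) {𝔞 I : Ideal R} {t c : ℝ} (h : IsJointHKMultiplicity p 𝔞 I t c) :
    Tendsto (fun e : ℕ => (jointLength 𝔞 I t (p ^ e) : ℝ) / ((p : ℝ) ^ e) ^ dim R)
      atTop (𝓝 c) := by
  have hp0 : (0 : ℝ) < p := by exact_mod_cast (by omega : 0 < p)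
  have hp1 : (1 : ℝ) < p := by exact_mod_cast hp
  obtain ⟨k, hk⟩ : ∃ k, dim R = k + 1 := ⟨dim R - 1, by omega⟩
  unfold IsJointHKMultiplicity at h
  simp only [hk, Nat.add_sub_cancel] at h ⊢
  have h2 := h.mul (isBigO_refl (fun e : ℕ => (((p : ℝ) ^ e) ^ (k + 1))⁻¹) atTop)
  have h3 : Tendsto (fun e : ℕ => ((p : ℝ) ^ e)⁻¹) atTop (𝓝 0) :=
    (tendsto_pow_atTop_atTop_of_one_lt hp1).inv_tendsto_atTop
  have h4 := h2.trans_tendsto (h3.congr fun e => by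
    have : ((p : ℝ) ^ e) ≠ 0 := by positivity
    field_simp
    ring)
  have h5 := h4.add_const c
  rw [zero_add] at h5
  refine h5.congr fun e => ?_
  have : ((p : ℝ) ^ e) ≠ 0 := by positivity
  field_simp
  ring

/-- The number in the definition of `e_HK(𝔞^t, I)` is unique. -/
theorem IsJointHKMultiplicity.eHK_eq {R : Type*} [CommRing R] {p : ℕ} (hp : 1 < p)
    (hd : 0 < dim R) {𝔞 I : Ideal R} {t c : ℝ} (h : IsJointHKMultiplicity p 𝔞 I t c) :
    eHK p 𝔞 I t = c :=
  tendsto_nhds_unique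
    (IsJointHKMultiplicity.tendsto hp hd (Classical.epsilon_spec ⟨c, h⟩)) (h.tendsto hp hd)

end JointHK

/-!
Write `d = dim R`, `q = p ^ e`, `J_q = 𝔞 ^ ⌈t q⌉ I^[q]`, and `ℓ(q)` for the length of `R / J_q`. The
existence of `c` with `ℓ(q) = c q ^ d + O(q ^ (d - 1))` follows from a recursion
`ℓ(p q) = p ^ d ℓ(q) + O(q ^ (d - 1))` (`exists_isBigO_of_recursion`), which is Monsky's argument
made uniform in the ideal.

*Reduction to F-finite rings.* The completion of `R` contains a coefficient field `k`, since fields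
of characteristic `p` are formally smooth over the prime field (`exists_mk_comp_eq_of_sq_eq_bot`), so
it is of the form `k⟦X⟧ / 𝔠`. With `K` an algebraic closure of `k`, put `R' = K⟦X⟧ / 𝔠 K⟦X⟧`. A
`k`-linear retraction `K → k`, applied to coefficients, shows that ideals of `k⟦X⟧` are contracted
from `K⟦X⟧`; this is enough for lengths to agree over `R` and `R'` (`quotLength_map_eq`), and no
flatness is needed. The ring `R'` is F-finite, because monomials with exponents less than `p` generate
`K⟦X⟧` over its `p`-th powers, and its dimension is bounded by the growth of `λ(R' / 𝔞 ^ m R')`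
(`exists_fFinite_extension`, `ringKrullDim_le_of_quotLength_pow_le`).

*The recursion over an F-finite ring with perfect residue field.* A finite module over a domain
agrees with a free module up to torsion. Hence a finite module killed by the nilradical has, up to an
error `O(m ^ (d - 1))` uniform over all ideals `J ⊇ 𝔞 ^ m`, the same lengths modulo `J` as a direct
sum of copies of the domains `R / P`, `P` a minimal prime (`exists_dominated_pi_minimalPrimes`). The
Frobenius pushforward of `R / P` is such a module over `R / P`; its rank is `p ^ d` if
`dim R / P = d`, as one sees by evaluating at `J = 𝔞 ^ m` and comparing with the leading coefficient of
the Hilbert–Samuel function, while the case `dim R / P < d` is negligible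
(`exists_quotLength_sup_map_frobenius`). Applying this to a pushforward `F^e_* R` with `e` so large
that it is killed by the nilradical gives
`λ(R / J^[p ^ (e + 1)]) = p ^ d λ(R / J^[p ^ e]) + O(m ^ (d - 1))`
(`exists_quotLength_map_iterateFrobenius_succ`). Finally `J_q` contains `𝔞 ^ m` with `m` linear in `q`,
and `J_q^[Q]` differs from `J_{qQ}` only by a bounded shift of the exponent of `𝔞`, which changes the
colength by `O(q ^ (d - 1))` (`exists_quotLength_map_iterateFrobenius_jointIdeal`).

*The inequality and continuity.* If `I` is generated by `n` elements then so is `I^[q]`, and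
`𝔞 ^ N I^[q] / 𝔞 ^ N' I^[q]` is a quotient of `n` copies of `𝔞 ^ N / 𝔞 ^ N'`
(`quotLength_mul_add_le`). Dividing by `q ^ d` and letting `q → ∞` gives the bound in terms of
`e(𝔞)`, where the limit defining `e(𝔞)` exists because Hilbert–Samuel functions are eventually
polynomial (`exists_tendsto_colength_pow_div`). Continuity follows from the bound.
-/

open Filter Topology Asymptotics

namespace JointHK

/-! ### Lengths of quotients -/

section QuotLength

variable {R : Type*} [CommRing R]

/-- The length of `R ⧸ J` in `ℕ∞`; keeping the value `⊤` makes the additivity statements below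
free of finiteness hypotheses. -/
noncomputable def quotLength (J : Ideal R) : ℕ∞ := Module.length R (R ⧸ J)

theorem colength_eq_toNat (J : Ideal R) : colength J = (quotLength J).toNat := rfl

theorem length_quotient_eq_add {M : Type*} [AddCommGroup M] [Module R M] {N N' : Submodule R M}
    (h : N ≤ N') :
    Module.length R (M ⧸ N) = Module.length R (Submodule.map N.mkQ N') + Module.length R (M ⧸ N') := by
  rw [Module.length_eq_add_of_exact (Submodule.map N.mkQ N').subtype (Submodule.map N.mkQ N').mkQ
    (Submodule.subtype_injective _) (Submodule.mkQ_surjective _)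
    (LinearMap.exact_subtype_mkQ _),
    (Submodule.quotientQuotientEquivQuotient N N' h).length_eq]

theorem quotLength_anti {J J' : Ideal R} (h : J ≤ J') : quotLength J' ≤ quotLength J := by
  unfold quotLength
  rw [length_quotient_eq_add h]
  exact le_add_self

theorem quotLength_top : quotLength (⊤ : Ideal R) = 0 := by
  have : Subsingleton (R ⧸ (⊤ : Ideal R)) := Ideal.Quotient.subsingleton_iff.mpr rfl
  exact Module.length_eq_zero

/-- The colon ideal `(J : x)`. -/
def colonElem (J : Ideal R) (x : R) : Ideal R := Submodule.comap (LinearMap.lsmul R R x) J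

theorem mem_colonElem {J : Ideal R} {x y : R} : y ∈ colonElem J x ↔ x * y ∈ J := Iff.rfl

/-- Multiplication by `x` identifies `V / (V ∩ (U : x))` with `(U + x V) / U`. -/
theorem quotLength_inf_colonElem_add (V U : Ideal R) (x : R) :
    quotLength (V ⊓ colonElem U x) + quotLength (U ⊔ Submodule.map (LinearMap.lsmul R R x) V) =
      quotLength V + quotLength U := by
  unfold quotLength
  rw [length_quotient_eq_add (inf_le_left : V ⊓ colonElem U x ≤ V),
    length_quotient_eq_add (le_sup_left : U ≤ U ⊔ Submodule.map (LinearMap.lsmul R R x) V)]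
  have key : Module.length R (Submodule.map (V ⊓ colonElem U x).mkQ V) =
      Module.length R (Submodule.map U.mkQ (U ⊔ Submodule.map (LinearMap.lsmul R R x) V)) := by
    let f : V →ₗ[R] R ⧸ U := U.mkQ ∘ₗ LinearMap.lsmul R R x ∘ₗ V.subtype
    let g : V →ₗ[R] R ⧸ (V ⊓ colonElem U x) := (V ⊓ colonElem U x).mkQ ∘ₗ V.subtype
    have hf : LinearMap.range f = Submodule.map U.mkQ (U ⊔ Submodule.map (LinearMap.lsmul R R x) V) := by
      simp only [f, LinearMap.range_comp, Submodule.range_subtype, Submodule.map_sup,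
        Submodule.mkQ_map_self, bot_sup_eq]
    have hg : LinearMap.range g = Submodule.map (V ⊓ colonElem U x).mkQ V := by
      simp only [g, LinearMap.range_comp, Submodule.range_subtype]
    have hk : LinearMap.ker f = LinearMap.ker g := by
      ext v
      simp only [f, g, LinearMap.mem_ker, LinearMap.comp_apply, Submodule.mkQ_apply,
        Submodule.Quotient.mk_eq_zero, Submodule.mem_inf]
      exact ⟨fun h => ⟨v.2, h⟩, fun h => h.2⟩
    rw [← hf, ← hg, ← f.quotKerEquivRange.length_eq, ← g.quotKerEquivRange.length_eq, hk]
  rw [key]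
  ring

theorem quotLength_eq_colonElem_add (J : Ideal R) (x : R) :
    quotLength J = quotLength (colonElem J x) + quotLength (J ⊔ Ideal.span {x}) := by
  have h := quotLength_inf_colonElem_add ⊤ J x
  rw [quotLength_top, zero_add, top_inf_eq] at h
  rw [← h]
  congr 3
  rw [Submodule.map_top]
  ext y
  simp [Ideal.mem_span_singleton', mul_comm]

theorem quotLength_sup_span_mul_le (J : Ideal R) (x y : R) :
    quotLength (J ⊔ Ideal.span {x * y}) ≤
      quotLength (J ⊔ Ideal.span {x}) + quotLength (J ⊔ Ideal.span {y}) := by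
  rw [quotLength_eq_colonElem_add _ x, add_comm]
  refine add_le_add (quotLength_anti ?_) (quotLength_anti ?_)
  · exact sup_le_sup_right le_sup_left _
  · refine sup_le (fun z hz => ?_) ?_
    · exact mem_colonElem.mpr (Ideal.mul_mem_left _ _ (Ideal.mem_sup_left hz))
    · rw [Ideal.span_singleton_le_iff_mem, mem_colonElem]
      exact Ideal.mem_sup_right (Ideal.mem_span_singleton_self _)

theorem quotLength_sup_span_pow_le (J : Ideal R) (x : R) (m : ℕ) :
    quotLength (J ⊔ Ideal.span {x ^ m}) ≤ m * quotLength (J ⊔ Ideal.span {x}) := by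
  induction m with
  | zero => simp [quotLength_top]
  | succ m ih =>
    rw [pow_succ]
    refine (quotLength_sup_span_mul_le _ _ _).trans ?_
    push_cast
    rw [add_mul, one_mul]
    gcongr

theorem quotLength_sup_span_image_pow_le (s : Finset R) (m : ℕ) (J : Ideal R) :
    quotLength (J ⊔ Ideal.span ((fun x => x ^ m) '' (s : Set R))) ≤
      m ^ s.card * quotLength (J ⊔ Ideal.span (s : Set R)) := by
  classical
  induction s using Finset.induction_on generalizing J with
  | empty => simp
  | insert x s hx ih =>
    rw [Finset.coe_insert, Set.image_insert_eq, Ideal.span_insert, Ideal.span_insert x,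
      ← sup_assoc, ← sup_assoc, Finset.card_insert_of_notMem hx]
    refine (ih _).trans ?_
    rw [pow_succ, mul_assoc]
    gcongr
    rw [sup_right_comm, sup_right_comm _ (Ideal.span {x})]
    exact quotLength_sup_span_pow_le _ _ _

/-- If `K` is generated by `n` elements and `b ≤ a`, then `a K / b K` is a quotient of
`(a / b) ^ n`. -/
theorem quotLength_mul_add_le {a b : Ideal R} (hab : b ≤ a) {n : ℕ} (f : Fin n → R) :
    quotLength (b * Ideal.span (Set.range f)) + n * quotLength a ≤
      quotLength (a * Ideal.span (Set.range f)) + n * quotLength b := by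
  set K := Ideal.span (Set.range f)
  unfold quotLength
  rw [length_quotient_eq_add (Ideal.mul_mono_left hab : b * K ≤ a * K),
    length_quotient_eq_add hab]
  have key : Module.length R (Submodule.map (b * K).mkQ (a * K)) ≤ n * Module.length R (Submodule.map b.mkQ a) := by
    let g : (Fin n → a) →ₗ[R] R ⧸ (b * K) :=
      ∑ i, ((b * K).mkQ ∘ₗ (LinearMap.lsmul R R (f i)) ∘ₗ a.subtype) ∘ₗ LinearMap.proj i
    let h : (Fin n → a) →ₗ[R] (Fin n → Submodule.map b.mkQ a) :=
      LinearMap.pi fun i => ((b.mkQ.domRestrict a).codRestrict (Submodule.map b.mkQ a)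
        fun x => ⟨x, x.2, rfl⟩) ∘ₗ LinearMap.proj i
    have hg : ∀ u, g u = (b * K).mkQ (∑ i, f i * u i) := by
      intro u
      simp [g, LinearMap.sum_apply, map_sum]
    have hker : LinearMap.ker h ≤ LinearMap.ker g := by
      intro u hu
      rw [LinearMap.mem_ker, hg, Submodule.mkQ_apply, Submodule.Quotient.mk_eq_zero]
      refine Ideal.sum_mem _ fun i _ => ?_
      have h1 : b.mkQ (u i : R) = 0 := congrArg Subtype.val (congrFun (LinearMap.mem_ker.mp hu) i)
      rw [Submodule.mkQ_apply, Submodule.Quotient.mk_eq_zero] at h1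
      rw [mul_comm (f i)]
      exact Ideal.mul_mem_mul h1 (Ideal.subset_span ⟨i, rfl⟩)
    have hsurj : Function.Surjective h := by
      intro v
      choose w hw1 hw2 using fun i => (v i).2
      exact ⟨fun i => ⟨w i, hw1 i⟩, funext fun i => Subtype.ext (hw2 i)⟩
    have hrange : Submodule.map (b * K).mkQ (a * K) ≤ LinearMap.range g := by
      rw [Submodule.map_le_iff_le_comap, Ideal.mul_le]
      intro r hr s hs
      obtain ⟨c, rfl⟩ := (Submodule.mem_span_range_iff_exists_fun R).mp hs
      refine ⟨fun i => ⟨c i * r, Ideal.mul_mem_left _ _ hr⟩, ?_⟩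
      rw [hg, Finset.mul_sum]
      congr 1
      refine Finset.sum_congr rfl fun i _ => ?_
      simp only [smul_eq_mul]
      ring
    calc Module.length R (Submodule.map (b * K).mkQ (a * K))
        ≤ Module.length R (LinearMap.range g) :=
          Module.length_le_of_injective (Submodule.inclusion hrange)
            (Submodule.inclusion_injective _)
      _ = Module.length R ((Fin n → a) ⧸ LinearMap.ker g) := g.quotKerEquivRange.length_eq.symm
      _ ≤ Module.length R ((Fin n → a) ⧸ LinearMap.ker h) := by
          rw [length_quotient_eq_add hker]; exact le_add_self
      _ = Module.length R (Fin n → Submodule.map b.mkQ a) := by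
          rw [(h.quotKerEquivOfSurjective hsurj).length_eq]
      _ = n * Module.length R (Submodule.map b.mkQ a) := by
          rw [Module.length_pi]; simp
  calc _ ≤ n * Module.length R (Submodule.map b.mkQ a) + Module.length R (R ⧸ a * K)
        + n * Module.length R (R ⧸ a) := by gcongr
    _ = _ := by ring

theorem quotLength_ne_top_of_maximalIdeal_le_radical [IsNoetherianRing R] [IsLocalRing R]
    {J : Ideal R} (h : IsLocalRing.maximalIdeal R ≤ J.radical) : quotLength J ≠ ⊤ := by
  have : IsArtinianRing (R ⧸ J) := by
    rw [isArtinianRing_iff_isNoetherianRing_krullDimLE_zero]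
    refine ⟨inferInstance, Ring.krullDimLE_zero_iff.mpr fun P hP => ?_⟩
    have : (P.comap (Ideal.Quotient.mk J)).IsPrime := Ideal.comap_isPrime _ _
    have h1 : J.radical ≤ P.comap (Ideal.Quotient.mk J) := by
      rw [Ideal.IsPrime.radical_le_iff this]
      intro x hx
      rw [Ideal.mem_comap, Ideal.Quotient.eq_zero_iff_mem.mpr hx]
      exact P.zero_mem
    have h2 : P.comap (Ideal.Quotient.mk J) = IsLocalRing.maximalIdeal R :=
      ((IsLocalRing.maximalIdeal.isMaximal R).eq_of_le this.ne_top (h.trans h1)).symm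
    have : (P.comap (Ideal.Quotient.mk J)).IsMaximal := h2 ▸ inferInstance
    exact Ideal.isMaximal_of_isIntegral_of_isMaximal_comap' (Ideal.Quotient.mk J)
      (RingHom.isIntegral_of_surjective _ Ideal.Quotient.mk_surjective) _ ‹_›
  unfold quotLength
  rw [Module.length_eq_of_surjective (R := R ⧸ J) (by exact Ideal.Quotient.mk_surjective)]
  exact Module.length_ne_top

end QuotLength

/-! ### Growth of `λ(R/𝔞ᵐ)` and the Krull dimension -/

section Growth

variable {R : Type*} [CommRing R]

theorem quotLength_comap_of_surjective {S : Type*} [CommRing S] (φ : R →+* S)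
    (hφ : Function.Surjective φ) (J : Ideal S) : quotLength (J.comap φ) = quotLength J := by
  let := φ.toAlgebra
  unfold quotLength
  rw [← Module.length_eq_of_surjective (S := R) (R := S) (M := S ⧸ J) hφ]
  let f : R →ₗ[R] S ⧸ J := (J.mkQ.restrictScalars R) ∘ₗ Algebra.linearMap R S
  have hf : Function.Surjective f := (Submodule.mkQ_surjective J).comp hφ
  have hk : LinearMap.ker f = J.comap φ := by
    ext x
    exact (Submodule.Quotient.mk_eq_zero J)
  rw [← hk]
  exact (f.quotKerEquivOfSurjective hf).length_eq

theorem quotLength_map_mk (b J : Ideal R) :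
    quotLength (J.map (Ideal.Quotient.mk b)) = quotLength (b ⊔ J) := by
  rw [← quotLength_comap_of_surjective _ Ideal.Quotient.mk_surjective,
    Ideal.comap_map_of_surjective _ Ideal.Quotient.mk_surjective, ← RingHom.ker_eq_comap_bot,
    Ideal.mk_ker, sup_comm]

theorem exists_pow_le_of_le_radical [IsNoetherianRing R] {m a : Ideal R} (ha : m ≤ a.radical) :
    ∃ k, 0 < k ∧ m ^ k ≤ a := by
  obtain ⟨k, hk⟩ := Ideal.exists_radical_pow_le_of_fg a (IsNoetherian.noetherian _)
  exact ⟨k + 1, k.succ_pos, (Ideal.pow_le_pow_right k.le_succ).trans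
    ((Ideal.pow_right_mono ha k).trans hk)⟩

theorem le_radical_pow {m a : Ideal R} (ha : m ≤ a.radical) (k : ℕ) : m ≤ (a ^ k).radical := by
  rcases Nat.eq_zero_or_pos k with rfl | hk
  · simp [Ideal.radical_top]
  · rwa [Ideal.radical_pow _ hk.ne']

/-- A consequence of Artin–Rees: if `x ∉ P`, multiplication by `x` on `R ⧸ P` moves the
`a`-adic filtration by a bounded amount. -/
theorem exists_colonElem_sup_pow_le [IsNoetherianRing R] {P : Ideal R} [P.IsPrime] (a : Ideal R)
    {x : R} (hx : x ∉ P) :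
    ∃ c : ℕ, ∀ m, colonElem (P ⊔ a ^ m) x ≤ P ⊔ a ^ (m - c) := by
  set x' := Ideal.Quotient.mk P x
  have hx' : x' ≠ 0 := fun h => hx (Ideal.Quotient.eq_zero_iff_mem.mp h)
  set I := a.map (Ideal.Quotient.mk P)
  obtain ⟨c, hc⟩ := Ideal.exists_pow_inf_eq_pow_smul I (Ideal.span {x'})
  refine ⟨c, fun m y hy => ?_⟩
  rcases lt_or_ge m c with hm | hm
  · rw [Nat.sub_eq_zero_of_le hm.le]
    simp
  have hmem : ∀ k (z : R), Ideal.Quotient.mk P z ∈ I ^ k ↔ z ∈ P ⊔ a ^ k := by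
    intro k z
    rw [← Ideal.map_pow, ← Ideal.mem_comap,
      Ideal.comap_map_of_surjective _ Ideal.Quotient.mk_surjective, ← RingHom.ker_eq_comap_bot,
      Ideal.mk_ker, sup_comm]
  rw [mem_colonElem, ← hmem, map_mul] at hy
  rw [← hmem]
  have h1 : x' * Ideal.Quotient.mk P y ∈ (I ^ m • ⊤ ⊓ Ideal.span {x'} : Ideal (R ⧸ P)) :=
    ⟨by simpa using hy, Ideal.mul_mem_right _ _ (Ideal.mem_span_singleton_self _)⟩
  rw [hc m hm] at h1
  have h2 : x' * Ideal.Quotient.mk P y ∈ I ^ (m - c) * Ideal.span {x'} :=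
    Ideal.mul_mono_right inf_le_right h1
  obtain ⟨z, hz, hzx⟩ := Ideal.mem_mul_span_singleton.mp h2
  rw [mul_comm] at hzx
  rwa [mul_left_cancel₀ hx' hzx] at hz

theorem pow_succ_le_of_le_add {m c δ : ℕ} :
    (m : ℝ) ^ (δ + 1) ≤ ((m - c : ℕ) : ℝ) ^ (δ + 1) + (δ + 1) * c * (m : ℝ) ^ δ := by
  have hx : ((m - c : ℕ) : ℝ) ≤ m := by exact_mod_cast Nat.sub_le _ _
  have hc : (m : ℝ) - ((m - c : ℕ) : ℝ) ≤ c := by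
    have : m ≤ (m - c) + c := le_tsub_add
    have : (m : ℝ) ≤ ((m - c : ℕ) : ℝ) + c := by exact_mod_cast this
    linarith
  set x : ℝ := ((m - c : ℕ) : ℝ)
  have hx0 : 0 ≤ x := Nat.cast_nonneg _
  have key : (m : ℝ) ^ (δ + 1) - x ^ (δ + 1) ≤ (δ + 1) * ((m : ℝ) - x) * (m : ℝ) ^ δ := by
    rw [← geom_sum₂_mul, mul_assoc, mul_comm ((m : ℝ) - x), ← mul_assoc]
    refine mul_le_mul_of_nonneg_right ?_ (by linarith)
    calc _ ≤ ∑ i ∈ Finset.range (δ + 1), (m : ℝ) ^ δ := by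
          refine Finset.sum_le_sum fun i hi => ?_
          have : i + (δ + 1 - 1 - i) = δ := by
            have := Finset.mem_range.mp hi
            omega
          calc (m : ℝ) ^ i * x ^ (δ + 1 - 1 - i) ≤ (m : ℝ) ^ i * (m : ℝ) ^ (δ + 1 - 1 - i) := by
                gcongr
            _ = (m : ℝ) ^ δ := by rw [← pow_add, this]
      _ = _ := by simp
  have : (δ + 1) * ((m : ℝ) - x) * (m : ℝ) ^ δ ≤ (δ + 1) * c * (m : ℝ) ^ δ := by gcongr
  linarith

variable [IsNoetherianRing R] [IsLocalRing R]

open IsLocalRing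

/-- Comparison with powers of a system of parameters. -/
theorem exists_quotLength_pow_le {a : Ideal R} (ha : maximalIdeal R ≤ a.radical) {d : ℕ}
    (hd : ringKrullDim R ≤ d) : ∃ C : ℕ, ∀ m : ℕ, quotLength (a ^ m) ≤ C * m ^ d := by
  obtain ⟨s, hs, hcard⟩ :=
    (maximalIdeal R).exists_finset_card_eq_height_of_isNoetherianRing
  have hsd : s.card ≤ d := by
    rw [← maximalIdeal_height_eq_ringKrullDim, ← hcard] at hd
    exact_mod_cast hd
  obtain ⟨k, hk0, hk⟩ := exists_pow_le_of_le_radical ha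
  have hrad : maximalIdeal R ≤ (Ideal.span (s : Set R)).radical := by
    rw [Ideal.radical_eq_sInf]
    refine le_sInf fun P ⟨hP1, hP2⟩ => ?_
    exact hs.2 ⟨hP2, hP1⟩ (le_maximalIdeal hP2.ne_top)
  obtain ⟨L, hL⟩ := ENat.ne_top_iff_exists.mp (quotLength_ne_top_of_maximalIdeal_le_radical hrad)
  refine ⟨k ^ d * L, fun m => ?_⟩
  rcases Nat.eq_zero_or_pos m with rfl | hm
  · simp [quotLength_top]
  have h1 : Ideal.span ((fun x => x ^ (k * m)) '' (s : Set R)) ≤ a ^ m := by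
    rw [Ideal.span_le]
    rintro _ ⟨x, hx, rfl⟩
    have : x ∈ maximalIdeal R := hs.1.2 (Ideal.subset_span hx)
    have := Ideal.pow_mem_pow this (k * m)
    rw [pow_mul] at this
    exact Ideal.pow_right_mono hk m this
  have h2 := quotLength_sup_span_image_pow_le s (k * m) ⊥
  rw [bot_sup_eq, bot_sup_eq, ← hL] at h2
  calc quotLength (a ^ m) ≤ _ := quotLength_anti h1
    _ ≤ _ := h2
    _ ≤ ((k * m : ℕ) : ℕ∞) ^ d * L := by
        gcongr
        exact_mod_cast Nat.mul_pos hk0 hm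
    _ = _ := by push_cast; ring

theorem exists_quotLength_sup_pow_le {a : Ideal R} (ha : maximalIdeal R ≤ a.radical) {d : ℕ}
    (b : Ideal R) (hd : ringKrullDim (R ⧸ b) ≤ d) :
    ∃ C : ℕ, ∀ m : ℕ, quotLength (b ⊔ a ^ m) ≤ C * m ^ d := by
  by_cases hb : b = ⊤
  · exact ⟨0, fun m => by simp [hb, quotLength_top]⟩
  have : Nontrivial (R ⧸ b) := Ideal.Quotient.nontrivial_iff.mpr hb
  have : IsLocalRing (R ⧸ b) := IsLocalRing.of_surjective' _ Ideal.Quotient.mk_surjective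
  have hmax : maximalIdeal (R ⧸ b) ≤ (a.map (Ideal.Quotient.mk b)).radical := by
    intro x hx
    obtain ⟨y, rfl⟩ := Ideal.Quotient.mk_surjective x
    have hy : y ∈ maximalIdeal R := fun h => hx (h.map (Ideal.Quotient.mk b))
    exact Ideal.map_radical_le _ (Ideal.mem_map_of_mem _ (ha hy))
  obtain ⟨C, hC⟩ := exists_quotLength_pow_le hmax hd
  refine ⟨C, fun m => ?_⟩
  rw [← quotLength_map_mk, Ideal.map_pow]
  exact hC m

/-- The length of `R / (P + aᵐ)` grows at least like `m ^ δ` if there is a chain of `δ + 1`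
primes starting at `P`. -/
theorem exists_le_colength_sup_pow {a : Ideal R} (ha : maximalIdeal R ≤ a.radical) (ha' : a ≠ ⊤)
    (δ : ℕ) (P : PrimeSpectrum R) (hP : (δ : ℕ∞) ≤ Order.coheight P) :
    ∃ ε : ℝ, 0 < ε ∧ ∀ m : ℕ, 0 < m → ε * (m : ℝ) ^ δ ≤ colength (P.asIdeal ⊔ a ^ m) := by
  have hfin : ∀ (J : Ideal R) (m : ℕ), quotLength (J ⊔ a ^ m) ≠ ⊤ := fun J m =>
    quotLength_ne_top_of_maximalIdeal_le_radical
      ((le_radical_pow ha m).trans (Ideal.radical_mono le_sup_right))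
  induction δ generalizing P with
  | zero =>
    refine ⟨1, one_pos, fun m hm => ?_⟩
    have h1 : P.asIdeal ⊔ a ^ m ≠ ⊤ := by
      intro h
      refine (maximalIdeal.isMaximal R).ne_top (top_le_iff.mp (h ▸ sup_le ?_ ?_))
      · exact le_maximalIdeal P.2.ne_top
      · exact (Ideal.pow_le_self hm.ne').trans (le_maximalIdeal ha')
    have h2 : 0 < quotLength (P.asIdeal ⊔ a ^ m) := by
      have : Nontrivial (R ⧸ (P.asIdeal ⊔ a ^ m)) := Ideal.Quotient.nontrivial_iff.mpr h1
      exact Module.length_pos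
    have h3 : 0 < colength (P.asIdeal ⊔ a ^ m) := by
      rw [colength_eq_toNat]
      exact Nat.pos_of_ne_zero fun h => (ENat.toNat_eq_zero.mp h).elim h2.ne' (hfin _ _)
    simpa using (by exact_mod_cast h3 : (1 : ℝ) ≤ (colength (P.asIdeal ⊔ a ^ m) : ℝ))
  | succ δ ih =>
    obtain ⟨Q, hQ, hQδ⟩ : ∃ Q, P < Q ∧ (δ : ℕ∞) ≤ Order.coheight Q := by
      by_contra! h
      have := Order.coheight_le_coe_iff.mpr h
      exact absurd (hP.trans this) (by norm_cast; omega)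
    obtain ⟨γ, hγ, hγm⟩ := ih Q hQδ
    obtain ⟨x, hxQ, hxP⟩ := Set.exists_of_ssubset
      (show (P.asIdeal : Set R) ⊂ Q.asIdeal from hQ)
    obtain ⟨c, hc⟩ := exists_colonElem_sup_pow_le a hxP
    -- With `h m = λ(R / (P + aᵐ))` and `x ∈ Q \ P`, splitting off multiplication by `x` gives
    -- `h (m - c) + γ m ^ δ ≤ h m`.
    have hrec : ∀ m, 0 < m → (colength (P.asIdeal ⊔ a ^ (m - c)) : ℝ) + γ * (m : ℝ) ^ δ ≤
        colength (P.asIdeal ⊔ a ^ m) := by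
      intro m hm
      have h1 : quotLength (P.asIdeal ⊔ a ^ (m - c)) + quotLength (Q.asIdeal ⊔ a ^ m) ≤
          quotLength (P.asIdeal ⊔ a ^ m) := by
        rw [quotLength_eq_colonElem_add (P.asIdeal ⊔ a ^ m) x]
        refine add_le_add (quotLength_anti (hc m)) (quotLength_anti ?_)
        refine sup_le (sup_le_sup_right hQ.le _) ?_
        rw [Ideal.span_singleton_le_iff_mem]
        exact Ideal.mem_sup_left hxQ
      have h2 := ENat.toNat_le_toNat h1 (hfin _ _)
      rw [ENat.toNat_add (hfin _ _) (hfin _ _)] at h2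
      have h3 : (colength (P.asIdeal ⊔ a ^ (m - c)) : ℝ) + colength (Q.asIdeal ⊔ a ^ m) ≤
        colength (P.asIdeal ⊔ a ^ m) := by exact_mod_cast h2
      linarith [hγm m hm]
    refine ⟨γ / ((δ + 1) * (c + 1)), by positivity, fun m => ?_⟩
    induction m using Nat.strong_induction_on with
    | _ m ihm =>
    intro hm
    have h1 : γ / ((δ + 1) * (c + 1)) * ((m - (c + 1) : ℕ) : ℝ) ^ (δ + 1) ≤
        colength (P.asIdeal ⊔ a ^ (m - (c + 1))) := by
      rcases Nat.eq_zero_or_pos (m - (c + 1)) with h0 | h0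
      · rw [h0]
        simp
      · exact ihm _ (by omega) h0
    have h2 : (colength (P.asIdeal ⊔ a ^ (m - (c + 1))) : ℝ) ≤
        colength (P.asIdeal ⊔ a ^ (m - c)) := by
      have := ENat.toNat_le_toNat (quotLength_anti (sup_le_sup_left
        (Ideal.pow_le_pow_right (I := a) (by omega : m - (c + 1) ≤ m - c)) P.asIdeal)) (hfin _ _)
      exact_mod_cast this
    have h3 := mul_le_mul_of_nonneg_left (pow_succ_le_of_le_add (m := m) (c := c + 1) (δ := δ))
      (by positivity : 0 ≤ γ / ((δ + 1) * (c + 1)))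
    have h4 : γ / ((δ + 1) * (c + 1)) * ((δ + 1) * ((c + 1 : ℕ) : ℝ) * (m : ℝ) ^ δ) =
        γ * (m : ℝ) ^ δ := by
      push_cast
      field_simp
    rw [mul_add (γ / ((δ + 1) * (c + 1))), h4] at h3
    linarith [hrec m hm]

end Growth

/-! ### Hilbert–Samuel functions are eventually polynomial -/

section HilbertSamuel

/-- The sequence `f` is eventually annihilated by the `j`-th iterate of the difference operator;
equivalently, `f` eventually agrees with a polynomial of degree less than `j`. -/
def IsEventuallyPoly : ℕ → (ℕ → ℝ) → Prop
  | 0, f => ∀ᶠ m in atTop, f m = 0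
  | j + 1, f => IsEventuallyPoly j fun m => f (m + 1) - f m

theorem IsEventuallyPoly.shift {j : ℕ} {f : ℕ → ℝ} (h : IsEventuallyPoly j f) :
    IsEventuallyPoly j fun m => f (m + 1) := by
  induction j generalizing f with
  | zero => exact (tendsto_add_atTop_nat 1).eventually h
  | succ j ih => exact ih h

theorem IsEventuallyPoly.sub {j : ℕ} {f g : ℕ → ℝ} (hf : IsEventuallyPoly j f)
    (hg : IsEventuallyPoly j g) : IsEventuallyPoly j fun m => f m - g m := by
  induction j generalizing f g with
  | zero => filter_upwards [hf, hg] with m h1 h2; rw [h1, h2, sub_zero]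
  | succ j ih =>
    have := ih hf hg
    unfold IsEventuallyPoly
    convert this using 2
    ring

theorem IsEventuallyPoly.exists_sum_choose {j : ℕ} {f : ℕ → ℝ} (h : IsEventuallyPoly j f) :
    ∃ c : ℕ → ℝ, ∀ᶠ m in atTop, f m = ∑ i ∈ Finset.range j, c i * (m.choose i : ℝ) := by
  induction j generalizing f with
  | zero => exact ⟨0, by
      filter_upwards [show ∀ᶠ m in atTop, f m = 0 from h] with m hm
      simpa using hm⟩
  | succ j ih =>
    obtain ⟨c, hc⟩ := ih h
    obtain ⟨m₀, hm₀⟩ := eventually_atTop.mp hc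
    set g : ℕ → ℝ := fun m => ∑ i ∈ Finset.range j, c i * (m.choose (i + 1) : ℝ)
    refine ⟨fun i => Nat.casesOn i (f m₀ - g m₀) c, eventually_atTop.mpr ⟨m₀, fun m hm => ?_⟩⟩
    have key : f m - g m = f m₀ - g m₀ := by
      induction m, hm using Nat.le_induction with
      | base => rfl
      | succ m hm ihm =>
        rw [← ihm]
        have h1 := hm₀ m hm
        have h2 : g (m + 1) - g m = ∑ i ∈ Finset.range j, c i * (m.choose i : ℝ) := by
          rw [← Finset.sum_sub_distrib]
          refine Finset.sum_congr rfl fun i _ => ?_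
          rw [Nat.choose_succ_succ]
          push_cast
          ring
        linarith
    rw [Finset.sum_range_succ']
    simp only [Nat.choose_zero_right, Nat.cast_one, mul_one]
    change f m = g m + (f m₀ - g m₀)
    linarith

theorem IsEventuallyPoly.exists_polynomial {j : ℕ} {f : ℕ → ℝ} (h : IsEventuallyPoly j f) :
    ∃ P : Polynomial ℝ, ∀ᶠ m : ℕ in atTop, f m = P.eval (m : ℝ) := by
  obtain ⟨c, hc⟩ := h.exists_sum_choose
  refine ⟨∑ i ∈ Finset.range j,
    Polynomial.C (c i / (i.factorial : ℝ)) * descPochhammer ℝ i, ?_⟩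
  filter_upwards [hc] with m hm
  rw [hm, Polynomial.eval_finsetSum]
  refine Finset.sum_congr rfl fun i _ => ?_
  rw [Polynomial.eval_mul, Polynomial.eval_C, descPochhammer_eval_eq_descFactorial,
    Nat.descFactorial_eq_factorial_mul_choose]
  push_cast
  have : (i.factorial : ℝ) ≠ 0 := by positivity
  field_simp

theorem degree_le_of_eval_le {P : Polynomial ℝ} {d : ℕ} {C : ℝ}
    (h : ∀ᶠ m : ℕ in atTop, |P.eval (m : ℝ)| ≤ C * (m : ℝ) ^ d) : P.degree ≤ d := by
  by_contra! hd
  have h1 := Polynomial.abs_div_tendsto_atTop_atTop_of_degree_gt P (Polynomial.X ^ d)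
    (by rwa [Polynomial.degree_X_pow]) (pow_ne_zero _ Polynomial.X_ne_zero)
  have h2 := h1.comp (tendsto_natCast_atTop_atTop (R := ℝ))
  obtain ⟨m, hm1, hm2, hm3⟩ :=
    ((h2.eventually_gt_atTop C).and (h.and (eventually_gt_atTop 0))).exists
  have : (0 : ℝ) < (m : ℝ) ^ d := by positivity
  simp only [Function.comp_apply, Polynomial.eval_pow, Polynomial.eval_X, abs_div,
    abs_of_pos this] at hm1
  rw [lt_div_iff₀ this] at hm1
  linarith

theorem exists_tendsto_div_pow_of_degree_le {P : Polynomial ℝ} {d : ℕ} (h : P.degree ≤ d) :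
    ∃ L, Tendsto (fun m : ℕ => P.eval (m : ℝ) / (m : ℝ) ^ d) atTop (𝓝 L) := by
  rcases h.lt_or_eq with h | h
  · refine ⟨0, ?_⟩
    have := (Polynomial.div_tendsto_atTop_zero_of_degree_lt P (Polynomial.X ^ d)
      (by rwa [Polynomial.degree_X_pow])).comp (tendsto_natCast_atTop_atTop (R := ℝ))
    simpa [Function.comp_def] using this
  · refine ⟨P.leadingCoeff, ?_⟩
    have := (Polynomial.div_tendsto_atTop_leadingCoeff_div_of_degree_eq P (Polynomial.X ^ d)
      (by rwa [Polynomial.degree_X_pow])).comp (tendsto_natCast_atTop_atTop (R := ℝ))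
    simpa [Function.comp_def] using this

theorem exists_eval_add_one_sub_le {P : Polynomial ℝ} {d : ℕ} (h : P.degree ≤ (d + 1 : ℕ)) :
    ∃ C : ℝ, ∀ᶠ m : ℕ in atTop, P.eval ((m : ℝ) + 1) - P.eval (m : ℝ) ≤ C * (m : ℝ) ^ d := by
  set Q := Polynomial.taylor 1 P - P
  have hQ : Q.degree ≤ d := by
    rcases eq_or_ne P 0 with rfl | hP
    · simp [Q]
    have h1 : Q.degree < (d + 1 : ℕ) := (Polynomial.degree_sub_lt_left (Polynomial.degree_taylor P 1)
      (by rwa [ne_eq, ← Polynomial.degree_eq_bot, Polynomial.degree_taylor,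
        Polynomial.degree_eq_bot]) (Polynomial.leadingCoeff_taylor 1 P)).trans_le
      ((Polynomial.degree_taylor P 1).le.trans h)
    refine (Polynomial.degree_le_iff_coeff_zero _ _).mpr fun m hm => ?_
    exact (Polynomial.degree_lt_iff_coeff_zero _ _).mp h1 m (by exact_mod_cast hm)
  have h2 := (Polynomial.isBigO_atTop_of_degree_le Q (Polynomial.X ^ d)
    (by rwa [Polynomial.degree_X_pow])).comp_tendsto (tendsto_natCast_atTop_atTop (R := ℝ))
  obtain ⟨C, hC⟩ := h2.bound
  refine ⟨C, ?_⟩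
  filter_upwards [hC] with m hm
  simp only [Function.comp_apply, Q, Polynomial.eval_sub, Polynomial.taylor_eval,
    Polynomial.eval_X, Polynomial.eval_pow, Real.norm_eq_abs] at hm
  rw [abs_of_nonneg (by positivity : (0 : ℝ) ≤ (m : ℝ) ^ d)] at hm
  exact (le_abs_self _).trans hm

variable {R : Type*} [CommRing R]

/-- A sequence of ideals `W` with `a W_m ⊆ W_{m+1}`; if moreover `W_m ⊆ a ^ m` this is a
homogeneous ideal of the Rees algebra of `a`. -/
def IsStable (a : Ideal R) (W : ℕ → Ideal R) : Prop := ∀ m, a * W m ≤ W (m + 1)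

theorem IsStable.pow_mul_le {a : Ideal R} {W : ℕ → Ideal R} (h : IsStable a W) (i m : ℕ) :
    a ^ i * W m ≤ W (i + m) := by
  induction i with
  | zero => simp
  | succ i ih =>
    rw [pow_succ', mul_assoc, add_right_comm]
    exact (Ideal.mul_mono_right ih).trans (h _)

/-- The ideal of the Rees algebra attached to a stable sequence. -/
def IsStable.toIdeal {a : Ideal R} {W : ℕ → Ideal R} (h : IsStable a W) :
    Ideal (reesAlgebra a) where
  carrier := {f | ∀ m, (f : Polynomial R).coeff m ∈ W m}
  add_mem' hf hg m := by
    simpa using (W m).add_mem (hf m) (hg m)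
  zero_mem' m := by simp
  smul_mem' g f hf m := by
    rw [smul_eq_mul, Subalgebra.coe_mul, Polynomial.coeff_mul]
    refine Ideal.sum_mem _ fun ij hij => ?_
    rw [← Finset.HasAntidiagonal.mem_antidiagonal.mp hij]
    exact h.pow_mul_le _ _ (Ideal.mul_mem_mul (g.2 ij.1) (hf ij.2))

/-- If `a` annihilates `V / U` then `V / U` vanishes in high degrees: the ideals which agree with `V`
up to degree `N` and with `U` beyond form an ascending chain in the Noetherian Rees algebra. -/
theorem eventually_eq_of_mul_le [IsNoetherianRing R] {a : Ideal R} {U V : ℕ → Ideal R}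
    (hU : IsStable a U) (hUV : U ≤ V) (hVa : ∀ m, V m ≤ a ^ m)
    (h : ∀ m, a * V m ≤ U (m + 1)) : ∀ᶠ m in atTop, U m = V m := by
  let W : ℕ → ℕ → Ideal R := fun N m => if m ≤ N then V m else U m
  have hW : ∀ N, IsStable a (W N) := by
    intro N m
    have h1 : U (m + 1) ≤ W N (m + 1) := by
      simp only [W]
      split_ifs
      · exact hUV _
      · exact le_rfl
    refine le_trans ?_ h1
    simp only [W]
    split_ifs
    · exact h m
    · exact hU m
  have hmono : Monotone W := by
    intro N N' hN m
    simp only [W]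
    split_ifs with h1 h2 h2
    · exact le_rfl
    · omega
    · exact hUV m
    · exact le_rfl
  obtain ⟨n, hn⟩ := monotone_stabilizes_iff_noetherian.mpr
    (inferInstance : IsNoetherian (reesAlgebra a) (reesAlgebra a))
    ⟨fun N => (hW N).toIdeal, fun N N' hN f hf m => hmono hN m (hf m)⟩
  refine eventually_atTop.mpr ⟨n + 1, fun m hm => le_antisymm (hUV m) fun v hv => ?_⟩
  have h1 : (⟨Polynomial.monomial m v, reesAlgebra.monomial_mem.mpr (hVa m hv)⟩ : reesAlgebra a) ∈
      (hW m).toIdeal := by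
    intro k
    rw [Polynomial.coeff_monomial]
    split_ifs with hk
    · subst hk; simpa [W] using hv
    · exact zero_mem _
  have h2 : (hW n).toIdeal = (hW m).toIdeal := hn m (by omega)
  rw [← h2] at h1
  have h3 := h1 m
  rw [Polynomial.coeff_monomial, if_pos rfl] at h3
  simpa [W, show ¬ m ≤ n by omega] using h3

/-- The Hilbert–Serre theorem for homogeneous subquotients `V / U` of the Rees algebra, by
induction on the number of generators of `a` which do not annihilate `V / U`. -/
theorem isEventuallyPoly_of_isStable [IsNoetherianRing R] {a : Ideal R} {r : ℕ} (x : Fin r → R)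
    (hx : Ideal.span (Set.range x) = a) (j : ℕ) (U V : ℕ → Ideal R) (hU : IsStable a U)
    (hV : IsStable a V) (hUV : U ≤ V) (hVa : ∀ m, V m ≤ a ^ m)
    (hfin : ∀ m, quotLength (U m) ≠ ⊤)
    (hxj : ∀ i : Fin r, j ≤ i → ∀ m, ∀ v ∈ V m, x i * v ∈ U (m + 1)) :
    IsEventuallyPoly j fun m => (colength (U m) : ℝ) - colength (V m) := by
  induction j generalizing U V with
  | zero =>
    have := eventually_eq_of_mul_le hU hUV hVa fun m => by
      rw [← hx, Ideal.mul_le]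
      intro y hy v hv
      induction hy using Submodule.span_induction with
      | mem y hy => obtain ⟨i, rfl⟩ := hy; exact hxj i (Nat.zero_le _) m v hv
      | zero => simp
      | add y z _ _ h1 h2 => rw [add_mul]; exact add_mem h1 h2
      | smul c y _ h1 => rw [smul_eq_mul, mul_assoc]; exact Ideal.mul_mem_left _ _ h1
    filter_upwards [this] with m hm
    rw [hm, sub_self]
  | succ j ih =>
    obtain ⟨y, hya, hy⟩ : ∃ y ∈ a, ∀ i : Fin r, j = i → x i = y := by
      by_cases hjr : j < r
      · refine ⟨x ⟨j, hjr⟩, hx ▸ Ideal.subset_span ⟨_, rfl⟩, fun i hi => ?_⟩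
        exact congrArg x (Fin.ext hi.symm)
      · exact ⟨0, a.zero_mem, fun i hi => absurd i.2 (by omega)⟩
    -- `K / U` is the kernel and `V / C` the cokernel of multiplication by `y` on `V / U`.
    let K : ℕ → Ideal R := fun m => V m ⊓ colonElem (U (m + 1)) y
    let C : ℕ → Ideal R := fun m => Nat.casesOn m (U 0) fun m =>
      U (m + 1) ⊔ Submodule.map (LinearMap.lsmul R R y) (V m)
    have hUK : U ≤ K := fun m u hu =>
      ⟨hUV m hu, mem_colonElem.mpr (hU m (Ideal.mul_mem_mul hya hu))⟩
    have hUC : U ≤ C := fun m => by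
      cases m with
      | zero => exact le_rfl
      | succ m => exact le_sup_left
    have hCV : C ≤ V := fun m => by
      cases m with
      | zero => exact hUV 0
      | succ m =>
        refine sup_le (hUV _) ?_
        rintro _ ⟨v, hv, rfl⟩
        exact hV m (Ideal.mul_mem_mul hya hv)
    have hK : IsStable a K := fun m => Ideal.mul_le.mpr fun z hz v hv =>
      ⟨hV m (Ideal.mul_mem_mul hz hv.1), by
        change y * (z * v) ∈ U (m + 1 + 1)
        rw [mul_left_comm]
        exact hU _ (Ideal.mul_mem_mul hz hv.2)⟩
    have hC : IsStable a C := fun m => by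
      cases m with
      | zero => exact (hU 0).trans (hUC 1)
      | succ m =>
        refine Ideal.mul_le.mpr fun z hz v hv => ?_
        obtain ⟨u, hu, _, ⟨w, hw, rfl⟩, rfl⟩ := Submodule.mem_sup.mp hv
        rw [mul_add]
        refine add_mem (Ideal.mem_sup_left (hU _ (Ideal.mul_mem_mul hz hu)))
          (Ideal.mem_sup_right ⟨z * w, hV _ (Ideal.mul_mem_mul hz hw), ?_⟩)
        simp only [LinearMap.lsmul_apply, smul_eq_mul]
        ring
    have hfinC : ∀ m, quotLength (C m) ≠ ⊤ := fun m =>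
      ne_top_of_le_ne_top (hfin m) (quotLength_anti (hUC m))
    have hfinK : ∀ m, quotLength (K m) ≠ ⊤ := fun m =>
      ne_top_of_le_ne_top (hfin m) (quotLength_anti (hUK m))
    have hfinV : ∀ m, quotLength (V m) ≠ ⊤ := fun m =>
      ne_top_of_le_ne_top (hfin m) (quotLength_anti (hUV m))
    have e1 := ih U K hU hK hUK (fun m => inf_le_left.trans (hVa m)) hfin fun i hi m v hv => by
      rcases eq_or_lt_of_le hi with h | h
      · rw [hy i h]
        exact hv.2
      · exact hxj i h m v hv.1
    have e2 := ih C V hC hV hCV hVa hfinC fun i hi m v hv => by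
      rcases eq_or_lt_of_le hi with h | h
      · rw [hy i h]
        exact Ideal.mem_sup_right ⟨v, hv, rfl⟩
      · exact hUC _ (hxj i h m v hv)
    have e3 := e2.shift.sub e1
    unfold IsEventuallyPoly
    convert e3 using 2 with m
    have h1 : quotLength (K m) + quotLength (C (m + 1)) =
        quotLength (V m) + quotLength (U (m + 1)) := quotLength_inf_colonElem_add _ _ _
    have h2 := congrArg ENat.toNat h1
    rw [ENat.toNat_add (hfinK m) (hfinC (m + 1)), ENat.toNat_add (hfinV m) (hfin (m + 1))] at h2
    have h3 : (colength (K m) : ℝ) + colength (C (m + 1)) =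
      colength (V m) + colength (U (m + 1)) := by exact_mod_cast h2
    linarith

variable [IsNoetherianRing R] [IsLocalRing R]

open IsLocalRing

theorem coe_colength_pow {a : Ideal R} (ha : maximalIdeal R ≤ a.radical) (m : ℕ) :
    (colength (a ^ m) : ℕ∞) = quotLength (a ^ m) :=
  ENat.natCast_toNat (quotLength_ne_top_of_maximalIdeal_le_radical (le_radical_pow ha m))

theorem exists_polynomial_colength_pow {a : Ideal R} (ha : maximalIdeal R ≤ a.radical) {d : ℕ}
    (hd : ringKrullDim R ≤ d) :
    ∃ P : Polynomial ℝ, P.degree ≤ d ∧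
      ∀ᶠ m : ℕ in atTop, (colength (a ^ m) : ℝ) = P.eval (m : ℝ) := by
  obtain ⟨r, x, hx⟩ := Submodule.fg_iff_exists_fin_generating_family.mp
    (IsNoetherian.noetherian a)
  have h1 : IsEventuallyPoly (r + 1) fun m => (colength (a ^ m) : ℝ) :=
    isEventuallyPoly_of_isStable x hx r (fun m => a ^ (m + 1)) (fun m => a ^ m)
      (fun m => (pow_succ' _ _).ge) (fun m => (pow_succ' _ _).ge)
      (fun m => Ideal.pow_le_pow_right m.le_succ) (fun m => le_rfl)
      (fun m => quotLength_ne_top_of_maximalIdeal_le_radical (le_radical_pow ha _))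
      fun i hi => absurd i.2 (by omega)
  obtain ⟨P, hP⟩ := h1.exists_polynomial
  obtain ⟨C, hC⟩ := exists_quotLength_pow_le ha hd
  refine ⟨P, degree_le_of_eval_le (C := C) ?_, hP⟩
  filter_upwards [hP] with m hm
  rw [← hm, Nat.abs_cast]
  have := hC m
  rw [← coe_colength_pow ha] at this
  exact_mod_cast this

theorem exists_tendsto_colength_pow_div {a : Ideal R} (ha : maximalIdeal R ≤ a.radical) {d : ℕ}
    (hd : ringKrullDim R ≤ d) :
    ∃ L, Tendsto (fun m : ℕ => (colength (a ^ m) : ℝ) / (m : ℝ) ^ d) atTop (𝓝 L) := by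
  obtain ⟨P, hPd, hP⟩ := exists_polynomial_colength_pow ha hd
  obtain ⟨L, hL⟩ := exists_tendsto_div_pow_of_degree_le hPd
  refine ⟨L, hL.congr' ?_⟩
  filter_upwards [hP] with m hm
  rw [hm]

theorem exists_quotLength_pow_succ_le {a : Ideal R} (ha : maximalIdeal R ≤ a.radical) {d : ℕ}
    (hd : ringKrullDim R ≤ (d + 1 : ℕ)) :
    ∃ C : ℕ, ∀ m : ℕ, 0 < m → quotLength (a ^ (m + 1)) ≤ quotLength (a ^ m) + C * m ^ d := by
  obtain ⟨P, hPd, hP⟩ := exists_polynomial_colength_pow ha hd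
  obtain ⟨C, hC⟩ := exists_eval_add_one_sub_le hPd
  obtain ⟨m₀, hm₀⟩ := eventually_atTop.mp (hP.and hC)
  refine ⟨⌈C⌉₊ + ∑ m ∈ Finset.range m₀, colength (a ^ (m + 1)), fun m hm => ?_⟩
  rw [← coe_colength_pow ha, ← coe_colength_pow ha]
  norm_cast
  rcases lt_or_ge m m₀ with h | h
  · have h1 : colength (a ^ (m + 1)) ≤ ∑ m ∈ Finset.range m₀, colength (a ^ (m + 1)) :=
      Finset.single_le_sum (f := fun m => colength (a ^ (m + 1))) (fun _ _ => Nat.zero_le _)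
        (Finset.mem_range.mpr h)
    have h2 : 1 ≤ m ^ d := Nat.one_le_pow _ _ hm
    nlinarith [Nat.zero_le ⌈C⌉₊]
  · have h1 := (hm₀ m h).2
    have h2 := (hm₀ m h).1
    have h3 := (hm₀ (m + 1) (by omega)).1
    push_cast at h3
    rw [← h3, ← h2] at h1
    have h4 : C * (m : ℝ) ^ d ≤ (⌈C⌉₊ : ℝ) * (m : ℝ) ^ d := by
      gcongr
      exact Nat.le_ceil C
    have h5 : colength (a ^ (m + 1)) ≤ colength (a ^ m) + ⌈C⌉₊ * m ^ d := by
      have : (colength (a ^ (m + 1)) : ℝ) ≤ colength (a ^ m) + ⌈C⌉₊ * (m : ℝ) ^ d := by linarith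
      exact_mod_cast this
    refine h5.trans ?_
    gcongr
    omega

/-- `a ^ m / a ^ (m + c)` has length `O(m ^ (d - 1))` for fixed `c`. -/
theorem exists_quotLength_pow_add_le {a : Ideal R} (ha : maximalIdeal R ≤ a.radical) {d : ℕ}
    (hd : ringKrullDim R ≤ (d + 1 : ℕ)) (c : ℕ) :
    ∃ C : ℕ, ∀ m : ℕ, 0 < m → quotLength (a ^ (m + c)) ≤ quotLength (a ^ m) + C * m ^ d := by
  obtain ⟨C, hC⟩ := exists_quotLength_pow_succ_le ha hd
  refine ⟨c * (C * (1 + c) ^ d), fun m hm => ?_⟩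
  suffices h : ∀ k ≤ c, quotLength (a ^ (m + k)) ≤
      quotLength (a ^ m) + ((k * (C * (1 + c) ^ d) * m ^ d : ℕ) : ℕ∞) by
    simpa using h c le_rfl
  intro k hk
  induction k with
  | zero => simp
  | succ k ih =>
    have h1 : C * (m + k) ^ d ≤ C * (1 + c) ^ d * m ^ d := by
      rw [mul_assoc, ← mul_pow]
      gcongr
      nlinarith
    calc quotLength (a ^ (m + k + 1)) ≤ quotLength (a ^ (m + k)) + C * ((m + k : ℕ) : ℕ∞) ^ d :=
          hC _ (by omega)
      _ ≤ (quotLength (a ^ m) + ((k * (C * (1 + c) ^ d) * m ^ d : ℕ) : ℕ∞)) +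
          ((C * (1 + c) ^ d * m ^ d : ℕ) : ℕ∞) := by
        gcongr
        · exact ih (by omega)
        · exact_mod_cast h1
      _ = _ := by push_cast; ring

end HilbertSamuel

/-! ### Comparing lengths of modules up to lower dimensional error -/

section Dominated

variable {R : Type*} [CommRing R]

/-- The length of `M ⧸ J M` in `ℕ∞`. -/
noncomputable def modLength (J : Ideal R) (M : Type*) [AddCommGroup M] [Module R M] : ℕ∞ :=
  Module.length R (M ⧸ (J • ⊤ : Submodule R M))

/-- `M` is dominated by `N`: the length of `M ⧸ J M` is at most that of `N ⧸ J N` up to an error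
`O(m ^ D)` which is uniform over all ideals `J ⊇ a ^ m`. -/
def Dominated (a : Ideal R) (D : ℕ) (M N : Type*) [AddCommGroup M] [Module R M]
    [AddCommGroup N] [Module R N] : Prop :=
  ∃ C : ℕ, ∀ m : ℕ, 0 < m → ∀ J : Ideal R, a ^ m ≤ J →
    modLength J M ≤ modLength J N + C * m ^ D

/-- The length of `T ⧸ J T` is `O(m ^ D)`, uniformly over all ideals `J ⊇ a ^ m`. -/
def IsNegligible (a : Ideal R) (D : ℕ) (T : Type*) [AddCommGroup T] [Module R T] : Prop :=
  ∃ C : ℕ, ∀ m : ℕ, 0 < m → ∀ J : Ideal R, a ^ m ≤ J → modLength J T ≤ C * m ^ D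

variable {a : Ideal R} {D : ℕ} {M N Q : Type*} [AddCommGroup M] [Module R M]
  [AddCommGroup N] [Module R N] [AddCommGroup Q] [Module R Q]

theorem Dominated.trans (h₁ : Dominated a D M N) (h₂ : Dominated a D N Q) :
    Dominated a D M Q := by
  obtain ⟨C₁, h₁⟩ := h₁
  obtain ⟨C₂, h₂⟩ := h₂
  refine ⟨C₁ + C₂, fun m hm J hJ => ?_⟩
  calc modLength J M ≤ modLength J N + C₁ * m ^ D := h₁ m hm J hJ
    _ ≤ modLength J Q + C₂ * m ^ D + C₁ * m ^ D := by gcongr; exact h₂ m hm J hJ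
    _ = _ := by push_cast; ring

theorem length_le_of_ker_le (g : M →ₗ[R] N) (h : M →ₗ[R] Q) (hg : Function.Surjective g)
    (hk : LinearMap.ker h ≤ LinearMap.ker g) : Module.length R N ≤ Module.length R Q := by
  calc Module.length R N = Module.length R (M ⧸ LinearMap.ker g) :=
        (g.quotKerEquivOfSurjective hg).length_eq.symm
    _ ≤ Module.length R (M ⧸ LinearMap.ker h) := by
        rw [length_quotient_eq_add hk]; exact le_add_self
    _ = Module.length R (LinearMap.range h) := h.quotKerEquivRange.length_eq
    _ ≤ Module.length R Q :=
        Module.length_le_of_injective (Submodule.subtype _) (Submodule.subtype_injective _)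

/-- Right exactness of `- ⧸ J -`. -/
theorem modLength_le_add (J : Ideal R) (f : M →ₗ[R] N) :
    modLength J N ≤ modLength J M + modLength J (N ⧸ LinearMap.range f) := by
  unfold modLength
  rw [length_quotient_eq_add (le_sup_left : (J • ⊤ : Submodule R N) ≤ J • ⊤ ⊔ LinearMap.range f)]
  refine add_le_add ?_ ?_
  · rw [Submodule.map_sup, Submodule.mkQ_map_self, bot_sup_eq, ← LinearMap.range_comp]
    refine length_le_of_ker_le ((J • ⊤ : Submodule R N).mkQ ∘ₗ f).rangeRestrict
      (J • ⊤ : Submodule R M).mkQ (LinearMap.surjective_rangeRestrict _) ?_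
    rw [Submodule.ker_mkQ, LinearMap.ker_rangeRestrict, LinearMap.ker_comp, Submodule.ker_mkQ,
      ← Submodule.map_le_iff_le_comap, Submodule.map_smul'']
    exact Submodule.smul_mono le_rfl le_top
  · refine length_le_of_ker_le (J • ⊤ ⊔ LinearMap.range f).mkQ
      ((J • ⊤ : Submodule R (N ⧸ LinearMap.range f)).mkQ ∘ₗ (LinearMap.range f).mkQ)
      (Submodule.mkQ_surjective _) ?_
    have h0 : (⊤ : Submodule R (N ⧸ LinearMap.range f)) =
        Submodule.map (LinearMap.range f).mkQ ⊤ := by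
      rw [Submodule.map_top, Submodule.range_mkQ]
    rw [Submodule.ker_mkQ, LinearMap.ker_comp, Submodule.ker_mkQ, h0, ← Submodule.map_smul'',
      Submodule.comap_map_mkQ, sup_comm]

theorem Dominated.of_linearMap (f : M →ₗ[R] N)
    (hf : IsNegligible a D (N ⧸ LinearMap.range f)) : Dominated a D N M := by
  obtain ⟨C, hC⟩ := hf
  exact ⟨C, fun m hm J hJ => (modLength_le_add J f).trans (by gcongr; exact hC m hm J hJ)⟩

/-- A module with `n` generators killed by `b` is a quotient of `(R ⧸ b) ^ n`. -/
theorem isNegligible_of_smul_eq_zero [Module.Finite R M] {b : Ideal R}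
    (hb : ∀ x ∈ b, ∀ y : M, x • y = 0)
    (hC : ∃ C : ℕ, ∀ m : ℕ, 0 < m → quotLength (b ⊔ a ^ m) ≤ C * m ^ D) :
    IsNegligible a D M := by
  obtain ⟨C, hC⟩ := hC
  obtain ⟨n, s, hs⟩ := Module.Finite.exists_fin (R := R) (M := M)
  refine ⟨n * C, fun m hm J hJ => ?_⟩
  let g : (Fin n → R) →ₗ[R] M ⧸ (J • ⊤ : Submodule R M) :=
    (J • ⊤ : Submodule R M).mkQ ∘ₗ Fintype.linearCombination R s
  have hg : Function.Surjective g := by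
    refine (Submodule.mkQ_surjective _).comp ?_
    rw [← LinearMap.range_eq_top, Fintype.range_linearCombination, hs]
  let h : (Fin n → R) →ₗ[R] (Fin n → R ⧸ (b ⊔ J)) :=
    LinearMap.pi fun i => (b ⊔ J).mkQ ∘ₗ LinearMap.proj i
  have hk : LinearMap.ker h ≤ LinearMap.ker g := by
    intro u hu
    rw [LinearMap.mem_ker, LinearMap.comp_apply, Submodule.mkQ_apply,
      Submodule.Quotient.mk_eq_zero, Fintype.linearCombination_apply]
    refine Submodule.sum_mem _ fun i _ => ?_
    have h1 : (b ⊔ J).mkQ (u i) = 0 := congrFun (LinearMap.mem_ker.mp hu) i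
    rw [Submodule.mkQ_apply, Submodule.Quotient.mk_eq_zero] at h1
    obtain ⟨x, hx, y, hy, hxy⟩ := Submodule.mem_sup.mp h1
    rw [← hxy, add_smul, hb x hx, zero_add]
    exact Submodule.smul_mem_smul hy trivial
  calc modLength J M ≤ Module.length R (Fin n → R ⧸ (b ⊔ J)) := length_le_of_ker_le g h hg hk
    _ = n * quotLength (b ⊔ J) := by rw [Module.length_pi]; simp [quotLength]
    _ ≤ n * (C * m ^ D) := by
        gcongr
        exact (quotLength_anti (sup_le_sup_left hJ b)).trans (hC m hm)
    _ = _ := by push_cast; ring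

theorem modLength_pi {ι : Type*} [Fintype ι] (J : Ideal R) (M : ι → Type*)
    [∀ i, AddCommGroup (M i)] [∀ i, Module R (M i)] :
    modLength J (Π i, M i) = ∑ i, modLength J (M i) := by
  classical
  unfold modLength
  rw [← Module.length_pi_of_fintype]
  let h : (Π i, M i) →ₗ[R] (Π i, M i ⧸ (J • ⊤ : Submodule R (M i))) :=
    LinearMap.pi fun i => (J • ⊤ : Submodule R (M i)).mkQ ∘ₗ LinearMap.proj i
  have hs : Function.Surjective h := by
    intro v
    choose w hw using fun i => Submodule.mkQ_surjective _ (v i)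
    exact ⟨w, funext hw⟩
  have hk : LinearMap.ker h = J • ⊤ := by
    ext u
    have : u ∈ LinearMap.ker h ↔ ∀ i, u i ∈ (J • ⊤ : Submodule R (M i)) := by
      simp only [LinearMap.mem_ker, funext_iff]
      exact forall_congr' fun i => Submodule.Quotient.mk_eq_zero _
    rw [this]
    constructor
    · intro hu
      rw [← Finset.univ_sum_single u]
      refine Submodule.sum_mem _ fun i _ => ?_
      have : LinearMap.single R M i (u i) ∈ Submodule.map (LinearMap.single R M i) (J • ⊤) :=
        Submodule.mem_map_of_mem (hu i)
      rw [Submodule.map_smul''] at this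
      exact Submodule.smul_mono le_rfl le_top this
    · intro hu i
      have : LinearMap.proj (R := R) (φ := M) i u ∈
        Submodule.map (LinearMap.proj (R := R) (φ := M) i) (J • ⊤) := Submodule.mem_map_of_mem hu
      rw [Submodule.map_smul''] at this
      exact Submodule.smul_mono le_rfl le_top this
  rw [← hk]
  exact (h.quotKerEquivOfSurjective hs).length_eq

theorem modLength_quotient (J P : Ideal R) : modLength J (R ⧸ P) = quotLength (P ⊔ J) := by
  unfold modLength quotLength
  have h0 : (⊤ : Submodule R (R ⧸ P)) = Submodule.map P.mkQ ⊤ := by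
    rw [Submodule.map_top, Submodule.range_mkQ]
  let h : R →ₗ[R] (R ⧸ P) ⧸ (J • ⊤ : Submodule R (R ⧸ P)) := Submodule.mkQ _ ∘ₗ Submodule.mkQ _
  have hs : Function.Surjective h :=
    (Submodule.mkQ_surjective _).comp (Submodule.mkQ_surjective _)
  have hk : LinearMap.ker h = P ⊔ J := by
    rw [LinearMap.ker_comp, Submodule.ker_mkQ, h0, ← Submodule.map_smul'',
      Submodule.comap_map_mkQ]
    simp
  rw [← hk]
  exact (h.quotKerEquivOfSurjective hs).length_eq.symm

theorem Dominated.pi {ι : Type*} [Fintype ι] {M N : ι → Type*}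
    [∀ i, AddCommGroup (M i)] [∀ i, Module R (M i)] [∀ i, AddCommGroup (N i)]
    [∀ i, Module R (N i)] (h : ∀ i, Dominated a D (M i) (N i)) :
    Dominated a D (Π i, M i) (Π i, N i) := by
  choose C hC using h
  refine ⟨∑ i, C i, fun m hm J hJ => ?_⟩
  rw [modLength_pi, modLength_pi]
  push_cast
  rw [Finset.sum_mul, ← Finset.sum_add_distrib]
  exact Finset.sum_le_sum fun i _ => hC i m hm J hJ

end Dominated

section Structure

/-- A finite module over a domain agrees with a free module up to torsion, in both directions. -/
theorem exists_free_linearMaps (A N : Type*) [CommRing A] [IsDomain A] [AddCommGroup N]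
    [Module A N] [Module.Finite A N] :
    ∃ (r : ℕ) (s : A) (f : (Fin r → A) →ₗ[A] N) (g : N →ₗ[A] (Fin r → A)), s ≠ 0 ∧
      (∀ n, s • n ∈ LinearMap.range f) ∧ ∀ v : Fin r → A, s • v ∈ LinearMap.range g := by
  classical
  obtain ⟨n, v, hv⟩ := Module.Finite.exists_fin (R := A) (M := N)
  obtain ⟨t, ht, hmax⟩ := exists_maximal_linearIndepOn A v
  have hmax' : ∀ i, ∃ c : A, c ≠ 0 ∧ c • v i ∈ Submodule.span A (v '' t) := by
    intro i
    by_cases hi : i ∈ t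
    · exact ⟨1, one_ne_zero, by rw [one_smul]; exact Submodule.subset_span ⟨i, hi, rfl⟩⟩
    · exact hmax i hi
  choose c hc0 hc using hmax'
  let s := ∏ i, c i
  have hs0 : s ≠ 0 := Finset.prod_ne_zero_iff.mpr fun i _ => hc0 i
  have hs : ∀ x : N, s • x ∈ Submodule.span A (v '' t) := by
    intro x
    have hx : x ∈ Submodule.span A (Set.range v) := hv ▸ Submodule.mem_top
    induction hx using Submodule.span_induction with
    | mem y hy =>
      obtain ⟨i, rfl⟩ := hy
      obtain ⟨k, hk⟩ := Finset.dvd_prod_of_mem c (Finset.mem_univ i)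
      change (∏ i, c i) • v i ∈ _
      rw [hk, mul_comm, mul_smul]
      exact Submodule.smul_mem _ _ (hc i)
    | zero => simp
    | add y z _ _ h1 h2 => rw [smul_add]; exact add_mem h1 h2
    | smul k y _ h1 => rw [smul_comm]; exact Submodule.smul_mem _ _ h1
  have ht' : LinearIndependent A (fun i : t => v i) := ht
  let e : Fin (Fintype.card t) ≃ t := (Fintype.equivFin t).symm
  let w : Fin (Fintype.card t) → N := fun i => v (e i)
  have hw : LinearIndependent A w := ht'.comp e e.injective
  have hspan : Submodule.span A (Set.range w) = Submodule.span A (v '' t) := by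
    congr 1
    ext y
    constructor
    · rintro ⟨i, rfl⟩
      exact ⟨e i, (e i).2, rfl⟩
    · rintro ⟨i, hi, rfl⟩
      exact ⟨e.symm ⟨i, hi⟩, by simp [w]⟩
  let f : (Fin (Fintype.card t) → A) →ₗ[A] N := Fintype.linearCombination A w
  have hrange : LinearMap.range f = Submodule.span A (v '' t) := by
    rw [Fintype.range_linearCombination, hspan]
  have hinj : Function.Injective f := hw.fintypeLinearCombination_injective
  let E := LinearEquiv.ofInjective f hinj
  let g : N →ₗ[A] (Fin (Fintype.card t) → A) :=
    E.symm.toLinearMap ∘ₗ ((LinearMap.lsmul A N s).codRestrict (LinearMap.range f)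
      fun x => by rw [hrange]; exact hs x)
  refine ⟨_, s, f, g, hs0, fun x => hrange ▸ hs x, fun u => ⟨f u, ?_⟩⟩
  apply E.injective
  apply Subtype.ext
  simp [g, E]

variable {R : Type*} [CommRing R] {a : Ideal R} {D : ℕ}

theorem smul_eq_zero_of_mem_sup_span {P : Ideal R} {x : R} {M : Type*} [AddCommGroup M]
    [Module R M] (hP : ∀ p ∈ P, ∀ y : M, p • y = 0) (hx : ∀ y : M, x • y = 0) :
    ∀ z ∈ P ⊔ Ideal.span {x}, ∀ y : M, z • y = 0 := by
  have : P ⊔ Ideal.span {x} ≤ Module.annihilator R M := by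
    refine sup_le (fun p hp => Module.mem_annihilator.mpr (hP p hp)) ?_
    rw [Ideal.span_singleton_le_iff_mem, Module.mem_annihilator]
    exact hx
  exact fun z hz => Module.mem_annihilator.mp (this hz)

/-- A finite `R ⧸ P`-module agrees with a free one up to modules killed by an element outside
`P`. -/
theorem exists_dominated_of_prime {P : Ideal R} [P.IsPrime]
    (hsmall : ∀ x ∉ P, ∃ C : ℕ, ∀ m : ℕ, 0 < m →
      quotLength ((P ⊔ Ideal.span {x}) ⊔ a ^ m) ≤ C * m ^ D)
    (N : Type*) [AddCommGroup N] [Module R N] [Module.Finite R N]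
    (hN : ∀ x ∈ P, ∀ y : N, x • y = 0) :
    ∃ r : ℕ, Dominated a D N (Fin r → R ⧸ P) ∧ Dominated a D (Fin r → R ⧸ P) N := by
  have htors : Module.IsTorsionBySet R N P := fun y x => hN x x.2 y
  let := htors.module
  have : IsScalarTower R (R ⧸ P) N := htors.isScalarTower
  have : Module.Finite (R ⧸ P) N := Module.Finite.of_restrictScalars_finite R _ _
  obtain ⟨r, s, f, g, hs0, hf, hg⟩ := exists_free_linearMaps (R ⧸ P) N
  obtain ⟨x, rfl⟩ := Ideal.Quotient.mk_surjective s
  have hx : x ∉ P := fun h => hs0 (Ideal.Quotient.eq_zero_iff_mem.mpr h)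
  refine ⟨r, Dominated.of_linearMap (f.restrictScalars R) ?_,
    Dominated.of_linearMap (g.restrictScalars R) ?_⟩
  · refine isNegligible_of_smul_eq_zero (b := P ⊔ Ideal.span {x}) ?_ (hsmall x hx)
    refine smul_eq_zero_of_mem_sup_span (fun p hp y => ?_) fun y => ?_
    · obtain ⟨n, rfl⟩ := Submodule.mkQ_surjective _ y
      rw [← map_smul, hN p hp, map_zero]
    · obtain ⟨n, rfl⟩ := Submodule.mkQ_surjective _ y
      rw [← map_smul]
      refine (Submodule.Quotient.mk_eq_zero _).mpr ?_
      obtain ⟨w, hw⟩ := hf n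
      exact ⟨w, hw.trans (algebraMap_smul (R ⧸ P) x n)⟩
  · refine isNegligible_of_smul_eq_zero (b := P ⊔ Ideal.span {x}) ?_ (hsmall x hx)
    refine smul_eq_zero_of_mem_sup_span (fun p hp y => ?_) fun y => ?_
    · obtain ⟨n, rfl⟩ := Submodule.mkQ_surjective _ y
      rw [← map_smul]
      have : p • n = 0 := by
        ext i
        rw [Pi.smul_apply, Algebra.smul_def, Ideal.Quotient.algebraMap_eq,
          Ideal.Quotient.eq_zero_iff_mem.mpr hp, zero_mul, Pi.zero_apply]
      rw [this, map_zero]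
    · obtain ⟨n, rfl⟩ := Submodule.mkQ_surjective _ y
      rw [← map_smul]
      exact (Submodule.Quotient.mk_eq_zero _).mpr (hg n)

theorem smul_eq_zero_of_mem_span_range {ι : Type*} {s : ι → R} {M : Type*} [AddCommGroup M]
    [Module R M] (h : ∀ i, ∀ y : M, s i • y = 0) :
    ∀ x ∈ Ideal.span (Set.range s), ∀ y : M, x • y = 0 := by
  have : Ideal.span (Set.range s) ≤ Module.annihilator R M := by
    rw [Ideal.span_le]
    rintro _ ⟨i, rfl⟩
    exact Module.mem_annihilator.mpr (h i)
  exact fun x hx => Module.mem_annihilator.mp (this hx)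

/-- A finite module killed by the nilradical agrees, up to modules supported in lower dimension,
with a direct sum of copies of the domains `R ⧸ P` for the minimal primes `P`. -/
theorem exists_dominated_pi_minimalPrimes [IsNoetherianRing R] [Fintype (minimalPrimes R)]
    (hsmall : ∀ b : Ideal R, (∀ P ∈ minimalPrimes R, ¬ b ≤ P) →
      ∃ C : ℕ, ∀ m : ℕ, 0 < m → quotLength (b ⊔ a ^ m) ≤ C * m ^ D)
    (N : Type*) [AddCommGroup N] [Module R N] [Module.Finite R N]
    (hN : ∀ x ∈ nilradical R, ∀ y : N, x • y = 0) :
    ∃ r : minimalPrimes R → ℕ,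
      Dominated a D N (Π P : minimalPrimes R, Fin (r P) → R ⧸ (P : Ideal R)) ∧
      Dominated a D (Π P : minimalPrimes R, Fin (r P) → R ⧸ (P : Ideal R)) N := by
  classical
  have hprime : ∀ P : minimalPrimes R, (P : Ideal R).IsPrime := fun P => P.2.1.1
  have hle : ∀ P Q : minimalPrimes R, (Q : Ideal R) ≤ P → Q = P := fun P Q h =>
    Subtype.ext (le_antisymm h (P.2.2 Q.2.1 h))
  -- For each `P` an element `s P` lying in all minimal primes except `P`. The module `N` is compared
  -- with the direct sum of the submodules `s P • N`, which are modules over `R ⧸ P`.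
  have hs : ∀ P : minimalPrimes R, ∃ s : R, s ∉ (P : Ideal R) ∧
      ∀ Q : minimalPrimes R, Q ≠ P → s ∈ (Q : Ideal R) := by
    intro P
    have h1 : ¬ ((Finset.univ.erase P).inf fun Q : minimalPrimes R => (Q : Ideal R)) ≤ P := by
      rw [(hprime P).inf_le']
      rintro ⟨Q, hQ, hQP⟩
      exact (Finset.mem_erase.mp hQ).1 (hle P Q hQP)
    obtain ⟨s, hs, hsP⟩ := SetLike.not_le_iff_exists.mp h1
    exact ⟨s, hsP, fun Q hQ => (Finset.inf_le (Finset.mem_erase.mpr ⟨hQ, Finset.mem_univ Q⟩)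
      : _ ≤ (Q : Ideal R)) hs⟩
  choose s hsP hsQ using hs
  have hnil : ∀ x : R, (∀ P : minimalPrimes R, x ∈ (P : Ideal R)) → ∀ y : N, x • y = 0 := by
    refine fun x hx => hN x ?_
    rw [nilradical, ← Ideal.sInf_minimalPrimes, Ideal.mem_sInf]
    exact fun {I} hI => hx ⟨I, hI⟩
  have hsmallP : ∀ (P : minimalPrimes R), ∀ x ∉ (P : Ideal R), ∃ C : ℕ, ∀ m : ℕ, 0 < m →
      quotLength (((P : Ideal R) ⊔ Ideal.span {x}) ⊔ a ^ m) ≤ C * m ^ D := by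
    refine fun P x hx => hsmall _ fun Q hQ hle' => hx ?_
    have : P = ⟨Q, hQ⟩ := hle ⟨Q, hQ⟩ P (le_sup_left.trans hle')
    rw [this]
    exact hle' (Ideal.mem_sup_right (Ideal.mem_span_singleton_self x))
  have hb := hsmall (Ideal.span (Set.range s)) fun P hP h =>
    hsP ⟨P, hP⟩ (h (Ideal.subset_span ⟨_, rfl⟩))
  let NP : minimalPrimes R → Submodule R N := fun P => LinearMap.range (LinearMap.lsmul R N (s P))
  have hNP : ∀ P : minimalPrimes R, ∀ x ∈ (P : Ideal R), ∀ y : NP P, x • y = 0 := by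
    rintro P x hx ⟨_, n, rfl⟩
    apply Subtype.ext
    change x • (s P • n) = 0
    rw [← mul_smul]
    refine hnil _ (fun Q => ?_) n
    by_cases hQ : Q = P
    · subst hQ; exact Ideal.mul_mem_right _ _ hx
    · exact Ideal.mul_mem_left _ _ (hsQ P Q hQ)
  choose r hr1 hr2 using fun P : minimalPrimes R =>
    have := hprime P
    exists_dominated_of_prime (hsmallP P) (NP P) (hNP P)
  refine ⟨r, Dominated.trans ?_ (Dominated.pi hr1), Dominated.trans (Dominated.pi hr2) ?_⟩
  · let f : (Π P, NP P) →ₗ[R] N := ∑ P, (NP P).subtype ∘ₗ LinearMap.proj P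
    refine Dominated.of_linearMap f (isNegligible_of_smul_eq_zero
      (smul_eq_zero_of_mem_span_range (M := N ⧸ LinearMap.range f) fun P y => ?_) hb)
    obtain ⟨n, rfl⟩ := Submodule.mkQ_surjective _ y
    rw [← map_smul]
    refine (Submodule.Quotient.mk_eq_zero _).mpr ⟨Pi.single P ⟨s P • n, n, rfl⟩, ?_⟩
    simp only [f, LinearMap.sum_apply, LinearMap.comp_apply, LinearMap.proj_apply,
      Submodule.subtype_apply]
    rw [Finset.sum_eq_single P]
    · simp
    · intro Q _ hQ
      rw [Pi.single_eq_of_ne hQ]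
      rfl
    · simp
  · let g : N →ₗ[R] (Π P, NP P) := LinearMap.pi fun P => (LinearMap.lsmul R N (s P)).rangeRestrict
    refine Dominated.of_linearMap g (isNegligible_of_smul_eq_zero
      (smul_eq_zero_of_mem_span_range (M := (Π P, NP P) ⧸ LinearMap.range g) fun P y => ?_) hb)
    obtain ⟨v, rfl⟩ := Submodule.mkQ_surjective _ y
    rw [← map_smul]
    refine (Submodule.Quotient.mk_eq_zero _).mpr ⟨v P, ?_⟩
    funext Q
    apply Subtype.ext
    change s Q • (v P : N) = s P • (v Q : N)
    by_cases hQ : Q = P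
    · rw [hQ]
    · have h1 : s Q • v P = 0 := hNP P _ (hsQ Q P (Ne.symm hQ)) _
      have h2 : s P • v Q = 0 := hNP Q _ (hsQ P Q hQ) _
      rw [← Submodule.coe_smul, ← Submodule.coe_smul, h1, h2]
      rfl

end Structure

/-! ### Restriction of scalars along Frobenius -/

section Restrict

open IsLocalRing

/-- If `A → B` induces a surjection onto the residue field of `B`, then `B`-modules of finite length
have the same length over `A` and over `B`. -/
theorem length_restrictScalars_eq {A B : Type*} [CommRing A] [CommRing B] [IsLocalRing B]
    [Algebra A B] (hres : ∀ b : B, ∃ x : A, b - algebraMap A B x ∈ maximalIdeal B)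
    {M : Type*} [AddCommGroup M] [Module B M] (hM : IsFiniteLength B M) [Module A M]
    [IsScalarTower A B M] : Module.length A M = Module.length B M := by
  rename_i i₁ i₂
  revert i₁ i₂
  induction hM with
  | of_subsingleton => intros; rw [Module.length_eq_zero, Module.length_eq_zero]
  | @of_simple_quotient M _ _ N hs _ ih =>
    intro _ _
    have hB := Module.length_eq_add_of_exact N.subtype N.mkQ (Submodule.subtype_injective _)
      (Submodule.mkQ_surjective _) (LinearMap.exact_subtype_mkQ _)
    have hex : Function.Exact (N.subtype.restrictScalars A) (N.mkQ.restrictScalars A) :=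
      fun y => LinearMap.exact_subtype_mkQ N y
    have hA := Module.length_eq_add_of_exact (N.subtype.restrictScalars A)
      (N.mkQ.restrictScalars A) (Submodule.subtype_injective N) (Submodule.mkQ_surjective N) hex
    rw [hA, hB, ih]
    congr 1
    have hs' : IsSimpleModule A (M ⧸ N) := by
      have hann : ∀ c ∈ maximalIdeal B, ∀ y : M ⧸ N, c • y = 0 := by
        have hmax := IsSimpleModule.annihilator_isMaximal (R := B) (M := M ⧸ N)
        intro c hc
        rw [← eq_maximalIdeal hmax] at hc
        exact Module.mem_annihilator.mp hc
      have hnt : Nontrivial (M ⧸ N) := IsSimpleModule.nontrivial B _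
      refine { exists_pair_ne := ⟨⊥, ⊤, bot_ne_top⟩, eq_bot_or_eq_top := fun W => ?_ }
      refine or_iff_not_imp_left.mpr fun hW => eq_top_iff.mpr fun y _ => ?_
      obtain ⟨w, hwW, hw⟩ := Submodule.exists_mem_ne_zero_of_ne_bot hW
      obtain ⟨b, rfl⟩ := IsSimpleModule.toSpanSingleton_surjective B hw y
      obtain ⟨x, hx⟩ := hres b
      have h2 := hann _ hx w
      rw [sub_smul, sub_eq_zero, algebraMap_smul] at h2
      rw [LinearMap.toSpanSingleton_apply, h2]
      exact W.smul_mem x hwW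
    rw [Module.length_eq_one, Module.length_eq_one]

/-- The ring `B` regarded as an algebra over `A` along the ring homomorphism `φ`. -/
def Along {A B : Type*} [CommRing A] [CommRing B] (_ : A →+* B) : Type _ := B

variable {A B : Type*} [CommRing A] [CommRing B] (φ : A →+* B)

instance : CommRing (Along φ) := inferInstanceAs (CommRing B)

instance : Algebra A (Along φ) := φ.toAlgebra

theorem Along.smul_def (x : A) (y : Along φ) : x • y = (φ x * (show B from y) : B) := rfl

theorem modLength_algebra [IsLocalRing B] [Algebra A B]
    (hres : ∀ b : B, ∃ x : A, b - algebraMap A B x ∈ maximalIdeal B)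
    {J : Ideal A} (hJ : quotLength (J.map (algebraMap A B)) ≠ ⊤) :
    modLength J B = quotLength (J.map (algebraMap A B)) := by
  have h1 : (J • ⊤ : Submodule A B) = (J.map (algebraMap A B)).restrictScalars A :=
    Ideal.smul_top_eq_map J
  unfold modLength
  rw [h1, (Submodule.Quotient.restrictScalarsEquiv A (J.map (algebraMap A B))).length_eq]
  exact length_restrictScalars_eq (A := A) (B := B) hres (Module.length_ne_top_iff.mp hJ)

theorem modLength_along [IsLocalRing B] (hres : ∀ b : B, ∃ x : A, b - φ x ∈ maximalIdeal B)
    {J : Ideal A} (hJ : quotLength (J.map φ) ≠ ⊤) :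
    modLength J (Along φ) = quotLength (J.map φ) := by
  have : IsLocalRing (Along φ) := inferInstanceAs (IsLocalRing B)
  exact modLength_algebra (A := A) (B := Along φ) hres hJ

theorem finite_along (hφ : φ.Finite) : Module.Finite A (Along φ) := hφ

end Restrict

section FrobeniusPower

variable {R : Type*} [CommRing R]

/-- Pigeonhole: a monomial of degree `Q g + Q` in `g` variables is divisible by the `Q`-th power of
one of them. -/
theorem span_pow_add_le {g : ℕ} (x : Fin g → R) {Q : ℕ} (hQ : 0 < Q) :
    Ideal.span (Set.range x) ^ (Q * g + Q) ≤
      Ideal.span (Set.range fun i => x i ^ Q) * Ideal.span (Set.range x) ^ (Q * g) := by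
  classical
  set a := Ideal.span (Set.range x)
  rw [show a ^ (Q * g + Q) = _ from Submodule.span_pow (R := R) _ _, Submodule.span_le]
  intro y hy
  obtain ⟨f, rfl⟩ := Set.mem_pow.mp hy
  choose k hk using fun i => (f i).2
  rw [List.prod_ofFn]
  simp_rw [← hk]
  have hne : (Finset.univ : Finset (Fin g)).Nonempty := ⟨k ⟨0, by omega⟩, Finset.mem_univ _⟩
  obtain ⟨j, -, hj⟩ := Finset.exists_le_card_fiber_of_mul_le_card_of_maps_to
    (s := Finset.univ) (t := Finset.univ) (f := k) (n := Q) (fun _ _ => Finset.mem_univ _) hne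
    (by simp only [Finset.card_univ, Fintype.card_fin]; nlinarith)
  obtain ⟨T, hT, hTc⟩ := Finset.exists_subset_card_eq hj
  rw [← Finset.prod_mul_prod_compl T]
  refine Ideal.mul_mem_mul ?_ ?_
  · rw [Finset.prod_congr rfl (g := fun _ => x j) fun i hi => by
      rw [(Finset.mem_filter.mp (hT hi)).2], Finset.prod_const, hTc]
    exact Ideal.subset_span ⟨j, rfl⟩
  · have hc : Tᶜ.card = Q * g := by
      rw [Finset.card_compl, hTc, Fintype.card_fin]; omega
    have h1 : ∏ i ∈ Tᶜ, x (k i) ∈ ∏ i ∈ Tᶜ, a :=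
      Ideal.prod_mem_prod fun i _ => Ideal.subset_span ⟨k i, rfl⟩
    rwa [Finset.prod_const, hc] at h1

theorem pow_add_mul_le_map_pow {a : Ideal R} {g : ℕ} {x : Fin g → R}
    (hx : Ideal.span (Set.range x) = a) {φ : R →+* R} {Q : ℕ} (hQ : 0 < Q)
    (hφ : ∀ y, φ y = y ^ Q) (N : ℕ) :
    a ^ (Q * N + Q * g) ≤ (a ^ N).map φ := by
  have h1 : Ideal.span (Set.range fun i => x i ^ Q) ≤ a.map φ := by
    rw [Ideal.span_le]
    rintro _ ⟨i, rfl⟩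
    simp only [← hφ]
    exact Ideal.mem_map_of_mem φ (hx ▸ Ideal.subset_span ⟨i, rfl⟩)
  have h2 : ∀ N, a ^ (Q * N + Q * g) ≤ (a.map φ) ^ N * a ^ (Q * g) := by
    intro N
    induction N with
    | zero => simp
    | succ N ih =>
      calc a ^ (Q * (N + 1) + Q * g) = a ^ (Q * g + Q) * a ^ (Q * N) := by
            rw [← pow_add]; congr 1; ring
        _ ≤ (a.map φ * a ^ (Q * g)) * a ^ (Q * N) := by
            refine Ideal.mul_mono_left ?_
            have := span_pow_add_le x hQ
            rw [hx] at this
            exact this.trans (Ideal.mul_mono_left h1)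
        _ = a.map φ * a ^ (Q * N + Q * g) := by rw [mul_assoc, ← pow_add, add_comm]
        _ ≤ a.map φ * ((a.map φ) ^ N * a ^ (Q * g)) := Ideal.mul_mono_right ih
        _ = _ := by rw [← mul_assoc, ← pow_succ']
  rw [Ideal.map_pow]
  exact (h2 N).trans Ideal.mul_le_left

theorem map_pow_le_pow_mul {a : Ideal R} {φ : R →+* R} {Q : ℕ} (hφ : ∀ y, φ y = y ^ Q) (N : ℕ) :
    (a ^ N).map φ ≤ a ^ (Q * N) := by
  rw [Ideal.map_le_iff_le_comap]
  intro y hy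
  rw [Ideal.mem_comap, hφ, mul_comm, pow_mul]
  exact Ideal.pow_mem_pow hy Q

theorem frobeniusPower_eq_map (p : ℕ) [ExpChar R p] (J : Ideal R) (e : ℕ) :
    frobeniusPower J (p ^ e) = J.map (iterateFrobenius R p e) := rfl

end FrobeniusPower

/-! ### Frobenius and colengths over F-finite local rings -/

section Dimension

variable {R : Type*} [CommRing R]

theorem ringKrullDim_quotient_le_of_forall_not_le {b : Ideal R} {D : ℕ}
    (hd : ringKrullDim R ≤ (D + 1 : ℕ)) (hb : ∀ P ∈ minimalPrimes R, ¬ b ≤ P) :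
    ringKrullDim (R ⧸ b) ≤ D := by
  rw [ringKrullDim_quotient]
  refine iSup_le fun l => ?_
  obtain ⟨P, hP, hP'⟩ := Ideal.exists_minimalPrimes_le (J := l.head.1.asIdeal) bot_le
  let P' : PrimeSpectrum R := ⟨P, hP.1.1⟩
  have hlt : P' < l.head.1 := by
    refine lt_of_le_of_ne hP' fun h => hb P hP ?_
    have h1 : b ≤ l.head.1.asIdeal := l.head.2
    rwa [← h] at h1
  let l' : LTSeries (PrimeSpectrum R) := l.map Subtype.val (fun _ _ h => h)
  have h2 := (Order.LTSeries.length_le_krullDim (l'.cons P' hlt)).trans hd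
  have h3 : (l'.cons P' hlt).length = l.length + 1 := RelSeries.cons_length l' P' hlt
  rw [h3] at h2
  have h4 : l.length + 1 ≤ D + 1 := by exact_mod_cast h2
  exact_mod_cast Nat.le_of_succ_le_succ h4

theorem ringKrullDim_quotient_le_of_coheight_le {P : PrimeSpectrum R} {D : ℕ}
    (hP : Order.coheight P ≤ D) : ringKrullDim (R ⧸ P.asIdeal) ≤ D := by
  rw [ringKrullDim_quotient]
  refine iSup_le fun l => ?_
  have h1 := Order.coheight_le_iff.mp hP (p := l.map Subtype.val (fun _ _ h => h)) l.head.2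
  change ((l.length : ℕ) : ℕ∞) ≤ D at h1
  exact_mod_cast h1

theorem exists_pow_mul_le_map_frobenius [IsNoetherianRing R] (p : ℕ) [hp : Fact p.Prime]
    [CharP R p] (a : Ideal R) :
    ∃ g : ℕ, ∀ (J : Ideal R) (m : ℕ), a ^ m ≤ J →
      a ^ (p * m + p * g) ≤ J.map (frobenius R p) := by
  obtain ⟨g, x, hx⟩ := Submodule.fg_iff_exists_fin_generating_family.mp
    (IsNoetherian.noetherian a)
  exact ⟨g, fun J m h => (pow_add_mul_le_map_pow hx hp.out.pos (fun _ => rfl) m).trans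
    (Ideal.map_mono h)⟩

end Dimension

/-- A sequence with growth of exact order `m ^ (D + 1)` which is multiplied by `r`, up to lower order
terms, under `m ↦ p m` determines `r`. -/
theorem eq_pow_of_tendsto_div_pow {h : ℕ → ℕ} {L : ℝ} {r p D C : ℕ} (hp : 0 < p) (hL0 : L ≠ 0)
    (hL : Tendsto (fun m : ℕ => (h m : ℝ) / (m : ℝ) ^ (D + 1)) atTop (𝓝 L))
    (h1 : ∀ m, 0 < m → h (p * m) ≤ r * h m + C * m ^ D)
    (h2 : ∀ m, 0 < m → r * h m ≤ h (p * m) + C * m ^ D) : r = p ^ (D + 1) := by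
  have e1 : Tendsto (fun m : ℕ => (h (p * m) : ℝ) / (m : ℝ) ^ (D + 1)) atTop
      (𝓝 ((p : ℝ) ^ (D + 1) * L)) := by
    have := (hL.comp (tendsto_id.const_mul_atTop' hp)).const_mul ((p : ℝ) ^ (D + 1))
    refine this.congr fun m => ?_
    have : (p : ℝ) ≠ 0 := by positivity
    simp only [Function.comp_apply, id, Nat.cast_mul, mul_pow]
    rw [mul_div_assoc', mul_div_mul_left _ _ (pow_ne_zero _ this)]
  have e2 : Tendsto (fun m : ℕ => (h (p * m) : ℝ) / (m : ℝ) ^ (D + 1) -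
      r * ((h m : ℝ) / (m : ℝ) ^ (D + 1))) atTop (𝓝 0) := by
    refine squeeze_zero_norm' (a := fun m : ℕ => (C : ℝ) / m) ?_
      (tendsto_const_div_atTop_nhds_zero_nat _)
    filter_upwards [eventually_gt_atTop 0] with m hm
    have a1 : (h (p * m) : ℝ) ≤ r * h m + C * (m : ℝ) ^ D := by exact_mod_cast h1 m hm
    have a2 : (r : ℝ) * h m ≤ h (p * m) + C * (m : ℝ) ^ D := by exact_mod_cast h2 m hm
    have hm' : (0 : ℝ) < m := by exact_mod_cast hm
    rw [Real.norm_eq_abs, mul_div_assoc', ← sub_div, abs_div, abs_of_pos (by positivity : (0 : ℝ) <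
      (m : ℝ) ^ (D + 1)), div_le_div_iff₀ (by positivity) hm', pow_succ, ← mul_assoc]
    gcongr
    rw [abs_le]
    constructor <;> linarith
  have e3 := tendsto_nhds_unique e2 (e1.sub (hL.const_mul (r : ℝ)))
  have e4 : ((r : ℝ) - (p : ℝ) ^ (D + 1)) * L = 0 := by linarith
  have e5 := (mul_eq_zero.mp e4).resolve_right hL0
  have e6 : (r : ℝ) = (p : ℝ) ^ (D + 1) := by linarith
  exact_mod_cast e6

section FFinite

open IsLocalRing

variable {R : Type*} [CommRing R] [IsNoetherianRing R] [IsLocalRing R] {a : Ideal R} {D : ℕ}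

theorem exists_quotLength_sup_pow_le_of_forall_not_le (ha : maximalIdeal R ≤ a.radical)
    (hd : ringKrullDim R ≤ (D + 1 : ℕ)) (b : Ideal R) (hb : ∀ P ∈ minimalPrimes R, ¬ b ≤ P) :
    ∃ C : ℕ, ∀ m : ℕ, 0 < m → quotLength (b ⊔ a ^ m) ≤ C * m ^ D := by
  obtain ⟨C, hC⟩ := exists_quotLength_sup_pow_le ha b
    (ringKrullDim_quotient_le_of_forall_not_le hd hb)
  exact ⟨C, fun m _ => hC m⟩

theorem quotLength_ne_top_of_pow_le (ha : maximalIdeal R ≤ a.radical) {J : Ideal R} {m : ℕ}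
    (hJ : a ^ m ≤ J) : quotLength J ≠ ⊤ :=
  quotLength_ne_top_of_maximalIdeal_le_radical ((le_radical_pow ha m).trans (Ideal.radical_mono hJ))

/-- The Hilbert–Samuel function of a domain `R ⧸ P` of full dimension has a positive normalized
limit. -/
theorem exists_tendsto_colength_sup_pow_div (ha : maximalIdeal R ≤ a.radical) (ha' : a ≠ ⊤)
    (hd : ringKrullDim R ≤ (D + 1 : ℕ)) (P : PrimeSpectrum R)
    (hP : ((D + 1 : ℕ) : ℕ∞) ≤ Order.coheight P) :
    (∃ L : ℝ, L ≠ 0 ∧ Tendsto (fun m : ℕ => (colength (P.asIdeal ⊔ a ^ m) : ℝ) /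
      (m : ℝ) ^ (D + 1)) atTop (𝓝 L)) ∧
    ∀ c : ℕ, ∃ C : ℕ, ∀ m : ℕ, 0 < m →
      colength (P.asIdeal ⊔ a ^ (m + c)) ≤ colength (P.asIdeal ⊔ a ^ m) + C * m ^ D := by
  have : Nontrivial (R ⧸ P.asIdeal) := Ideal.Quotient.nontrivial_iff.mpr P.2.ne_top
  have : IsLocalRing (R ⧸ P.asIdeal) :=
    IsLocalRing.of_surjective' _ Ideal.Quotient.mk_surjective
  set b := a.map (Ideal.Quotient.mk P.asIdeal)
  have hb : maximalIdeal (R ⧸ P.asIdeal) ≤ b.radical := by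
    intro x hx
    obtain ⟨y, rfl⟩ := Ideal.Quotient.mk_surjective x
    have hy : y ∈ maximalIdeal R := fun h => hx (h.map (Ideal.Quotient.mk P.asIdeal))
    exact Ideal.map_radical_le _ (Ideal.mem_map_of_mem _ (ha hy))
  have hdim : ringKrullDim (R ⧸ P.asIdeal) ≤ (D + 1 : ℕ) := (ringKrullDim_quotient_le _).trans hd
  have hq : ∀ m, quotLength (b ^ m) = quotLength (P.asIdeal ⊔ a ^ m) := fun m => by
    rw [← quotLength_map_mk, Ideal.map_pow]
  have hc : ∀ m, colength (b ^ m) = colength (P.asIdeal ⊔ a ^ m) := fun m => by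
    rw [colength_eq_toNat, colength_eq_toNat, hq]
  obtain ⟨L, hL⟩ := exists_tendsto_colength_pow_div hb hdim
  simp_rw [hc] at hL
  refine ⟨⟨L, ?_, hL⟩, fun c => ?_⟩
  · obtain ⟨ε, hε, h⟩ := exists_le_colength_sup_pow ha ha' (D + 1) P hP
    have : ε ≤ L := by
      refine ge_of_tendsto hL ?_
      filter_upwards [eventually_gt_atTop 0] with m hm
      have hm' : (0 : ℝ) < m := by exact_mod_cast hm
      rw [le_div_iff₀ (by positivity)]
      exact h m hm
    exact (hε.trans_le this).ne'
  · obtain ⟨C, hC⟩ := exists_quotLength_pow_add_le hb hdim c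
    refine ⟨C, fun m hm => ?_⟩
    have := hC m hm
    rw [← coe_colength_pow hb, ← coe_colength_pow hb, hc, hc] at this
    exact_mod_cast this

variable (p : ℕ) [hp : Fact p.Prime] [CharP R p]

theorem exists_quotLength_sup_map_frobenius_of_dim_le (ha : maximalIdeal R ≤ a.radical)
    {P : Ideal R} (hdim : ringKrullDim (R ⧸ P) ≤ D) :
    ∃ C : ℕ, ∀ m : ℕ, 0 < m → ∀ J : Ideal R, a ^ m ≤ J →
      quotLength (P ⊔ J.map (frobenius R p)) ≤ p ^ (D + 1) * quotLength (P ⊔ J) + C * m ^ D ∧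
      p ^ (D + 1) * quotLength (P ⊔ J) ≤ quotLength (P ⊔ J.map (frobenius R p)) + C * m ^ D := by
  obtain ⟨g, hmap⟩ := exists_pow_mul_le_map_frobenius p a
  obtain ⟨C, hC⟩ := exists_quotLength_sup_pow_le ha P hdim
  refine ⟨C * (p + p * g) ^ D + p ^ (D + 1) * C, fun m hm J hJ => ?_⟩
  have h1 : quotLength (P ⊔ J.map (frobenius R p)) ≤ ((C * (p + p * g) ^ D : ℕ) : ℕ∞) * m ^ D := by
    have h0 : C * (p * m + p * g) ^ D ≤ C * (p + p * g) ^ D * m ^ D := by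
      rw [mul_assoc, ← mul_pow]
      gcongr
      nlinarith [Nat.zero_le (p * g)]
    calc _ ≤ quotLength (P ⊔ a ^ (p * m + p * g)) :=
          quotLength_anti (sup_le_sup_left (hmap J m hJ) P)
      _ ≤ C * ((p * m + p * g : ℕ) : ℕ∞) ^ D := hC _
      _ ≤ _ := by exact_mod_cast h0
  have h2 : (p : ℕ∞) ^ (D + 1) * quotLength (P ⊔ J) ≤ ((p ^ (D + 1) * C : ℕ) : ℕ∞) * m ^ D := by
    calc _ ≤ (p : ℕ∞) ^ (D + 1) * (C * m ^ D) := by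
          gcongr
          exact (quotLength_anti (sup_le_sup_left hJ P)).trans (hC m)
      _ = _ := by push_cast; ring
  refine ⟨(h1.trans ?_).trans le_add_self, (h2.trans ?_).trans le_add_self⟩
  · gcongr
    exact Nat.le_add_right _ _
  · gcongr
    exact Nat.le_add_left _ _

/-- The Frobenius pushforward of `R ⧸ P`, for `P` a minimal prime, has a rank `r`. -/
theorem exists_rank_frobenius (hF : (frobenius R p).Finite)
    (hres : ∀ x : R, ∃ y : R, x - y ^ p ∈ maximalIdeal R)
    (ha : maximalIdeal R ≤ a.radical) (hd : ringKrullDim R ≤ (D + 1 : ℕ))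
    {P : Ideal R} (hP : P ∈ minimalPrimes R) :
    ∃ r C : ℕ, ∀ m : ℕ, 0 < m → ∀ J : Ideal R, a ^ m ≤ J →
      quotLength (P ⊔ J.map (frobenius R p)) ≤ r * quotLength (P ⊔ J) + C * m ^ D ∧
      r * quotLength (P ⊔ J) ≤ quotLength (P ⊔ J.map (frobenius R p)) + C * m ^ D := by
  have hPp : P.IsPrime := hP.1.1
  obtain ⟨g, hmap⟩ := exists_pow_mul_le_map_frobenius p a
  have : Nontrivial (R ⧸ P) := Ideal.Quotient.nontrivial_iff.mpr hPp.ne_top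
  have : IsLocalRing (R ⧸ P) := IsLocalRing.of_surjective' _ Ideal.Quotient.mk_surjective
  let φ : R →+* R ⧸ P := (Ideal.Quotient.mk P).comp (frobenius R p)
  have hφ : φ.Finite := (RingHom.Finite.of_surjective _ Ideal.Quotient.mk_surjective).comp hF
  have hφres : ∀ b : R ⧸ P, ∃ x : R, b - φ x ∈ maximalIdeal (R ⧸ P) := by
    intro b
    obtain ⟨y, rfl⟩ := Ideal.Quotient.mk_surjective b
    obtain ⟨z, hz⟩ := hres y
    refine ⟨z, fun hu => hz ?_⟩
    have : IsLocalHom (Ideal.Quotient.mk P) :=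
      IsLocalHom.of_surjective _ Ideal.Quotient.mk_surjective
    refine isUnit_of_map_unit (Ideal.Quotient.mk P) _ ?_
    simpa [φ, frobenius_def] using hu
  have hN : Module.Finite R (Along φ) := finite_along φ hφ
  have hkill : ∀ y ∈ P, ∀ z : Along φ, y • z = 0 := by
    intro y hy z
    have : φ y = 0 := Ideal.Quotient.eq_zero_iff_mem.mpr (Ideal.pow_mem_of_mem P hy p hp.out.pos)
    rw [Along.smul_def, this, zero_mul]
    rfl
  have hlen : ∀ (J : Ideal R) (m : ℕ), a ^ m ≤ J →
      modLength J (Along φ) = quotLength (P ⊔ J.map (frobenius R p)) := by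
    intro J m hJ
    have h1 : quotLength (J.map φ) = quotLength (P ⊔ J.map (frobenius R p)) := by
      rw [← quotLength_map_mk, Ideal.map_map]
    rw [modLength_along φ hφres, h1]
    rw [h1]
    exact quotLength_ne_top_of_pow_le ha ((hmap J m hJ).trans le_sup_right)
  have hsmall : ∀ y ∉ P, ∃ C : ℕ, ∀ m : ℕ, 0 < m →
      quotLength ((P ⊔ Ideal.span {y}) ⊔ a ^ m) ≤ C * m ^ D := fun y hy =>
    exists_quotLength_sup_pow_le_of_forall_not_le ha hd _ fun Q hQ hle => by
      have hPQ : Q = P := le_antisymm (hQ.2 hP.1 (le_sup_left.trans hle)) (le_sup_left.trans hle)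
      exact hy (hPQ ▸ hle (Ideal.mem_sup_right (Ideal.mem_span_singleton_self y)))
  obtain ⟨r, ⟨C₁, h₁⟩, ⟨C₂, h₂⟩⟩ := exists_dominated_of_prime hsmall (Along φ) hkill
  have hfree : ∀ J : Ideal R, modLength J (Fin r → R ⧸ P) = r * quotLength (P ⊔ J) := by
    intro J
    rw [modLength_pi]
    simp [modLength_quotient]
  refine ⟨r, C₁ + C₂, fun m hm J hJ => ⟨?_, ?_⟩⟩
  · have := h₁ m hm J hJ
    rw [hlen J m hJ, hfree] at this
    push_cast
    exact this.trans (by gcongr; exact le_self_add)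
  · have := h₂ m hm J hJ
    rw [hlen J m hJ, hfree] at this
    push_cast
    exact this.trans (by gcongr; exact le_add_self)

/-- On a domain `R ⧸ P` with `P` a minimal prime, replacing `J` by `J ^ [p]` multiplies the
colength by `p ^ (D + 1)` up to an error `O(m ^ D)`. If `dim R ⧸ P = D + 1`, the rank of the Frobenius
pushforward of `R ⧸ P` is read off from the Hilbert–Samuel function; otherwise both sides are
`O(m ^ D)`. -/
theorem exists_quotLength_sup_map_frobenius (hF : (frobenius R p).Finite)
    (hres : ∀ x : R, ∃ y : R, x - y ^ p ∈ maximalIdeal R)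
    (ha : maximalIdeal R ≤ a.radical) (ha' : a ≠ ⊤) (hd : ringKrullDim R ≤ (D + 1 : ℕ))
    (P : PrimeSpectrum R) (hP : P.asIdeal ∈ minimalPrimes R) :
    ∃ C : ℕ, ∀ m : ℕ, 0 < m → ∀ J : Ideal R, a ^ m ≤ J →
      quotLength (P.asIdeal ⊔ J.map (frobenius R p)) ≤
        p ^ (D + 1) * quotLength (P.asIdeal ⊔ J) + C * m ^ D ∧
      p ^ (D + 1) * quotLength (P.asIdeal ⊔ J) ≤
        quotLength (P.asIdeal ⊔ J.map (frobenius R p)) + C * m ^ D := by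
  by_cases hco : Order.coheight P ≤ D
  · exact exists_quotLength_sup_map_frobenius_of_dim_le p ha
      (ringKrullDim_quotient_le_of_coheight_le hco)
  have hco' : ((D + 1 : ℕ) : ℕ∞) ≤ Order.coheight P := by
    have := Order.add_one_le_of_lt (not_le.mp hco)
    exact_mod_cast this
  obtain ⟨r, C, hC⟩ := exists_rank_frobenius p hF hres ha hd hP
  suffices hr : r = p ^ (D + 1) by
    rw [hr] at hC
    push_cast at hC
    exact ⟨C, hC⟩
  obtain ⟨g, hmap⟩ := exists_pow_mul_le_map_frobenius p a
  obtain ⟨⟨L, hL0, hL⟩, hshift⟩ := exists_tendsto_colength_sup_pow_div ha ha' hd P hco'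
  obtain ⟨C', hC'⟩ := hshift (p * g)
  have hcoe : ∀ m, (colength (P.asIdeal ⊔ a ^ m) : ℕ∞) = quotLength (P.asIdeal ⊔ a ^ m) :=
    fun m => ENat.natCast_toNat (quotLength_ne_top_of_pow_le ha le_sup_right)
  refine eq_pow_of_tendsto_div_pow (C := C + C' * p ^ D) hp.out.pos hL0 hL (fun m hm => ?_)
    fun m hm => ?_
  · have h5 : quotLength (P.asIdeal ⊔ a ^ (p * m)) ≤
        quotLength (P.asIdeal ⊔ (a ^ m).map (frobenius R p)) :=
      quotLength_anti (sup_le_sup_left (map_pow_le_pow_mul (fun _ => rfl) m) _)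
    have h6 := h5.trans (hC m hm (a ^ m) le_rfl).1
    rw [← hcoe, ← hcoe] at h6
    have h7 : colength (P.asIdeal ⊔ a ^ (p * m)) ≤
        r * colength (P.asIdeal ⊔ a ^ m) + C * m ^ D := by exact_mod_cast h6
    refine h7.trans ?_
    gcongr
    omega
  · have h5 : quotLength (P.asIdeal ⊔ (a ^ m).map (frobenius R p)) ≤
        quotLength (P.asIdeal ⊔ a ^ (p * m + p * g)) :=
      quotLength_anti (sup_le_sup_left (hmap _ m le_rfl) _)
    have h6 := (hC m hm (a ^ m) le_rfl).2.trans (by gcongr : _ ≤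
      quotLength (P.asIdeal ⊔ a ^ (p * m + p * g)) + C * m ^ D)
    rw [← hcoe, ← hcoe] at h6
    have h7 : r * colength (P.asIdeal ⊔ a ^ m) ≤
        colength (P.asIdeal ⊔ a ^ (p * m + p * g)) + C * m ^ D := by exact_mod_cast h6
    have h8 := hC' (p * m) (Nat.mul_pos hp.out.pos hm)
    rw [mul_pow] at h8
    linarith

end FFinite

/-! ### Iterated Frobenius powers over F-finite local rings -/

section Joint

open IsLocalRing

theorem finite_iterateFrobenius {R : Type*} [CommRing R] (p : ℕ) [Fact p.Prime] [CharP R p]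
    (hF : (frobenius R p).Finite) (e : ℕ) : (iterateFrobenius R p e).Finite := by
  induction e with
  | zero =>
    refine RingHom.Finite.of_surjective _ fun x => ⟨x, ?_⟩
    simp
  | succ e ih =>
    have : iterateFrobenius R p (e + 1) = (iterateFrobenius R p e).comp (frobenius R p) := by
      ext x
      simp [iterateFrobenius_def, frobenius_def, pow_succ', pow_mul]
    rw [this]
    exact ih.comp hF

theorem map_frobenius_map_iterateFrobenius {R : Type*} [CommRing R] (p : ℕ) [Fact p.Prime]
    [CharP R p] (J : Ideal R) (e : ℕ) :
    (J.map (frobenius R p)).map (iterateFrobenius R p e) = J.map (iterateFrobenius R p (e + 1)) := by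
  rw [Ideal.map_map]
  congr 1
  ext x
  simp [iterateFrobenius_def, frobenius_def, pow_succ', pow_mul]

theorem map_iterateFrobenius_map_iterateFrobenius {R : Type*} [CommRing R] (p : ℕ) [Fact p.Prime]
    [CharP R p] (J : Ideal R) (e e' : ℕ) :
    (J.map (iterateFrobenius R p e)).map (iterateFrobenius R p e') =
      J.map (iterateFrobenius R p (e + e')) := by
  rw [Ideal.map_map]
  congr 1
  ext x
  simp [iterateFrobenius_def, pow_add, pow_mul]

theorem exists_sub_pow_mem {R : Type*} [CommRing R] [IsLocalRing R] (p : ℕ) [hp : Fact p.Prime]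
    [CharP R p] (hres : ∀ x : R, ∃ y : R, x - y ^ p ∈ maximalIdeal R) (e : ℕ) (x : R) :
    ∃ y : R, x - y ^ p ^ e ∈ maximalIdeal R := by
  induction e generalizing x with
  | zero => exact ⟨x, by simp⟩
  | succ e ih =>
    obtain ⟨y, hy⟩ := hres x
    obtain ⟨z, hz⟩ := ih y
    refine ⟨z, ?_⟩
    have h1 : y ^ p - z ^ p ^ (e + 1) = (y - z ^ p ^ e) ^ p := by
      rw [sub_pow_char, ← pow_mul, ← pow_succ]
    have h2 : y ^ p - z ^ p ^ (e + 1) ∈ maximalIdeal R := by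
      rw [h1]
      exact Ideal.pow_mem_of_mem _ hz p hp.out.pos
    simpa using add_mem hy h2

variable {R : Type*} [CommRing R] [IsNoetherianRing R] [IsLocalRing R] {a : Ideal R} {D : ℕ}
  (p : ℕ) [hp : Fact p.Prime] [CharP R p]

/-- Once a power of Frobenius annihilates the nilradical, a further Frobenius power multiplies
colengths by `p ^ (D + 1)` up to `O(m ^ D)`, uniformly over the ideals `J ⊇ a ^ m`. -/
theorem exists_quotLength_map_iterateFrobenius_succ (hF : (frobenius R p).Finite)
    (hres : ∀ x : R, ∃ y : R, x - y ^ p ∈ maximalIdeal R)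
    (ha : maximalIdeal R ≤ a.radical) (ha' : a ≠ ⊤) (hd : ringKrullDim R ≤ (D + 1 : ℕ)) :
    ∃ e C : ℕ, ∀ m : ℕ, 0 < m → ∀ J : Ideal R, a ^ m ≤ J →
      quotLength (J.map (iterateFrobenius R p (e + 1))) ≤
        p ^ (D + 1) * quotLength (J.map (iterateFrobenius R p e)) + C * m ^ D ∧
      p ^ (D + 1) * quotLength (J.map (iterateFrobenius R p e)) ≤
        quotLength (J.map (iterateFrobenius R p (e + 1))) + C * m ^ D := by
  obtain ⟨e, he⟩ := IsNoetherianRing.isNilpotent_nilradical R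
  let φ := iterateFrobenius R p e
  have hkill : ∀ x ∈ nilradical R, ∀ y : Along φ, x • y = 0 := by
    intro x hx y
    have h1 : x ^ e = 0 := by
      have := Ideal.pow_mem_pow hx e
      rwa [he] at this
    have h2 : φ x = 0 := pow_eq_zero_of_le (Nat.lt_pow_self hp.out.one_lt).le h1
    rw [Along.smul_def, h2, zero_mul]
    rfl
  have hfin : Module.Finite R (Along φ) := finite_along φ (finite_iterateFrobenius p hF e)
  have := (minimalPrimes.finite_of_isNoetherianRing R).fintype
  obtain ⟨r, ⟨C₁, h₁⟩, ⟨C₂, h₂⟩⟩ := exists_dominated_pi_minimalPrimes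
    (exists_quotLength_sup_pow_le_of_forall_not_le ha hd) (Along φ) hkill
  obtain ⟨g, hmap⟩ := exists_pow_mul_le_map_frobenius p a
  obtain ⟨g', x, hx⟩ := Submodule.fg_iff_exists_fin_generating_family.mp
    (IsNoetherian.noetherian a)
  have hlen : ∀ (J : Ideal R) (m : ℕ), a ^ m ≤ J → modLength J (Along φ) =
      quotLength (J.map φ) := fun J m hJ => modLength_along φ (exists_sub_pow_mem p hres e)
    (quotLength_ne_top_of_pow_le ha ((pow_add_mul_le_map_pow hx (pow_pos hp.out.pos e)
      (fun _ => rfl) m).trans (Ideal.map_mono hJ)))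
  have hfree : ∀ J : Ideal R,
      modLength J (Π P : minimalPrimes R, Fin (r P) → R ⧸ (P : Ideal R)) =
        ∑ P : minimalPrimes R, r P * quotLength (P ⊔ J) := by
    intro J
    rw [modLength_pi]
    refine Finset.sum_congr rfl fun P _ => ?_
    rw [modLength_pi]
    simp [modLength_quotient]
  choose C₃ h₃ using fun P : minimalPrimes R =>
    exists_quotLength_sup_map_frobenius p hF hres ha ha' hd ⟨P, P.2.1.1⟩ P.2
  let S := ∑ P : minimalPrimes R, r P * C₃ P
  let K := (p + p * g) ^ D
  have hm' : ∀ m : ℕ, 0 < m → (p * m + p * g) ^ D ≤ K * m ^ D := by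
    intro m hm
    rw [← mul_pow]
    gcongr
    nlinarith [Nat.zero_le (p * g)]
  have hsum : ∀ (m : ℕ), 0 < m → ∀ J : Ideal R, a ^ m ≤ J →
      ∑ P : minimalPrimes R, (r P : ℕ∞) * quotLength (P ⊔ J.map (frobenius R p)) ≤
        p ^ (D + 1) * ∑ P : minimalPrimes R, r P * quotLength (P ⊔ J) + S * m ^ D ∧
      p ^ (D + 1) * ∑ P : minimalPrimes R, (r P : ℕ∞) * quotLength (P ⊔ J) ≤
        ∑ P : minimalPrimes R, r P * quotLength (P ⊔ J.map (frobenius R p)) + S * m ^ D := by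
    intro m hm J hJ
    simp only [S]
    push_cast
    rw [Finset.sum_mul, Finset.mul_sum, ← Finset.sum_add_distrib, ← Finset.sum_add_distrib]
    refine ⟨Finset.sum_le_sum fun P _ => ?_, Finset.sum_le_sum fun P _ => ?_⟩
    · calc _ ≤ (r P : ℕ∞) * _ := mul_le_mul_right (h₃ P m hm J hJ).1 _
        _ = _ := by ring
    · calc _ = (r P : ℕ∞) * (p ^ (D + 1) * quotLength (P ⊔ J)) := by ring
        _ ≤ (r P : ℕ∞) * _ := mul_le_mul_right (h₃ P m hm J hJ).2 _
        _ = _ := by ring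
  refine ⟨e, p ^ (D + 1) * C₂ + p ^ (D + 1) * C₁ + S + C₁ * K + C₂ * K, fun m hm J hJ => ?_⟩
  have hJ' := hmap J m hJ
  have hm0 : 0 < p * m + p * g := Nat.add_pos_left (Nat.mul_pos hp.out.pos hm) _
  have a1 := h₁ m hm J hJ
  have a2 := h₂ m hm J hJ
  have b1 := h₁ _ hm0 _ hJ'
  have b2 := h₂ _ hm0 _ hJ'
  rw [hlen J m hJ, hfree] at a1 a2
  rw [hlen _ _ hJ', hfree, map_frobenius_map_iterateFrobenius] at b1 b2
  obtain ⟨c1, c2⟩ := hsum m hm J hJ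
  have hm'' : (((p * m + p * g : ℕ) : ℕ∞)) ^ D ≤ K * (m : ℕ∞) ^ D := by exact_mod_cast hm' m hm
  set X := quotLength (J.map φ)
  set Y := quotLength (J.map (iterateFrobenius R p (e + 1)))
  set U := ∑ P : minimalPrimes R, (r P : ℕ∞) * quotLength (P ⊔ J)
  set V := ∑ P : minimalPrimes R, (r P : ℕ∞) * quotLength (P ⊔ J.map (frobenius R p))
  have key : ∀ k : ℕ, k ≤ p ^ (D + 1) * C₂ + p ^ (D + 1) * C₁ + S + C₁ * K + C₂ * K →
      ∀ W : ℕ∞, W + (k : ℕ∞) * (m : ℕ∞) ^ D ≤ W +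
        ((p ^ (D + 1) * C₂ + p ^ (D + 1) * C₁ + S + C₁ * K + C₂ * K : ℕ) : ℕ∞) * (m : ℕ∞) ^ D := by
    intro k hk W
    gcongr
  constructor
  · refine le_trans ?_ (key (p ^ (D + 1) * C₂ + S + C₁ * K) (by omega) _)
    calc Y ≤ V + C₁ * ((p * m + p * g : ℕ) : ℕ∞) ^ D := b1
      _ ≤ (p ^ (D + 1) * (X + C₂ * m ^ D) + S * m ^ D) + C₁ * (K * (m : ℕ∞) ^ D) := by
          gcongr
          exact c1.trans (by gcongr)
      _ = _ := by push_cast; ring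
  · refine le_trans ?_ (key (p ^ (D + 1) * C₁ + S + C₂ * K) (by omega) _)
    calc (p : ℕ∞) ^ (D + 1) * X ≤ p ^ (D + 1) * (U + C₁ * m ^ D) := by gcongr
      _ = p ^ (D + 1) * U + p ^ (D + 1) * C₁ * m ^ D := by ring
      _ ≤ (Y + C₂ * (K * (m : ℕ∞) ^ D)) + S * m ^ D + p ^ (D + 1) * C₁ * m ^ D := by
          gcongr
          refine c2.trans ?_
          gcongr
          exact b2.trans (by gcongr)
      _ = _ := by push_cast; ring

end Joint

/-! ### Sequences satisfying a linear recursion up to an error -/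

section Sequence

/-- A sequence which is multiplied by `p ^ (D + 1)` at each step, up to an error `O(p ^ (D e))`, is
`c p ^ ((D + 1) e) + O(p ^ (D e))` for some `c`. -/
theorem exists_isBigO_of_recursion {p : ℕ} (hp : 1 < p) {D e₀ : ℕ} {C : ℝ} {u : ℕ → ℝ}
    (h : ∀ e, e₀ ≤ e → |u (e + 1) - (p : ℝ) ^ (D + 1) * u e| ≤ C * ((p : ℝ) ^ e) ^ D) :
    ∃ c : ℝ, (fun e : ℕ => u e - c * ((p : ℝ) ^ e) ^ (D + 1)) =O[atTop]
      (fun e : ℕ => ((p : ℝ) ^ e) ^ D) := by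
  have hp1 : (1 : ℝ) < p := by exact_mod_cast hp
  have hp0 : (0 : ℝ) < p := by linarith
  let v : ℕ → ℝ := fun n => u (n + e₀) / ((p : ℝ) ^ (n + e₀)) ^ (D + 1)
  have hr : ((p : ℝ)⁻¹) < 1 := inv_lt_one_of_one_lt₀ hp1
  have hC : 0 ≤ C := by
    have := (abs_nonneg _).trans (h e₀ le_rfl)
    exact nonneg_of_mul_nonneg_left this (by positivity)
  have hv : ∀ n, dist (v n) (v (n + 1)) ≤ C * ((p : ℝ)⁻¹) ^ n := by
    intro n
    set e := n + e₀
    have e1 : v (n + 1) = u (e + 1) / ((p : ℝ) ^ (e + 1)) ^ (D + 1) := by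
      simp only [v, e]
      rw [show n + 1 + e₀ = n + e₀ + 1 by omega]
    have e2 : v n - v (n + 1) = -(u (e + 1) - (p : ℝ) ^ (D + 1) * u e) /
        ((p : ℝ) ^ (e + 1)) ^ (D + 1) := by
      rw [e1]
      simp only [v]
      rw [pow_succ _ e, mul_pow]
      field_simp
      ring
    rw [Real.dist_eq, e2, abs_div, abs_neg, abs_of_pos (by positivity : (0 : ℝ) <
      ((p : ℝ) ^ (e + 1)) ^ (D + 1)), div_le_iff₀ (by positivity)]
    refine (h e (Nat.le_add_left _ _)).trans ?_
    rw [mul_assoc]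
    refine mul_le_mul_of_nonneg_left ?_ hC
    have e3 : (p : ℝ) ^ n ≤ (p : ℝ) ^ (e + 1) := pow_le_pow_right₀ hp1.le (by omega)
    rw [inv_pow, inv_mul_eq_div, le_div_iff₀ (by positivity), pow_succ _ D]
    gcongr
    · exact hp1.le
    · exact Nat.le_succ e
  have hcauchy := cauchySeq_of_le_geometric _ _ hr hv
  obtain ⟨c, hc⟩ := cauchySeq_tendsto_of_complete hcauchy
  refine ⟨c, IsBigO.of_bound (C * (p : ℝ) ^ e₀ / (1 - (p : ℝ)⁻¹)) ?_⟩
  filter_upwards [eventually_ge_atTop e₀] with e he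
  obtain ⟨n, rfl⟩ := Nat.exists_eq_add_of_le' he
  have h1 := dist_le_of_le_geometric_of_tendsto _ _ hr hv hc n
  have hq : (0 : ℝ) < ((p : ℝ) ^ (n + e₀)) ^ (D + 1) := by positivity
  have h2 : u (n + e₀) - c * ((p : ℝ) ^ (n + e₀)) ^ (D + 1) =
      (v n - c) * ((p : ℝ) ^ (n + e₀)) ^ (D + 1) := by
    simp only [v]
    field_simp
  rw [Real.norm_eq_abs, Real.norm_eq_abs, h2, abs_mul, abs_of_pos hq,
    abs_of_pos (by positivity : (0 : ℝ) < ((p : ℝ) ^ (n + e₀)) ^ D), ← Real.dist_eq]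
  refine (mul_le_mul_of_nonneg_right h1 hq.le).trans (le_of_eq ?_)
  rw [pow_succ _ D, pow_add, inv_pow]
  field_simp

end Sequence

/-! ### Joint Hilbert–Kunz functions of F-finite rings -/

section JointLength

open IsLocalRing

theorem ceil_mul_natCast_le (t : ℝ) (Q : ℕ) : ⌈t * (Q : ℝ)⌉₊ ≤ ⌈t⌉₊ * Q := by
  rw [Nat.ceil_le]
  push_cast
  exact mul_le_mul_of_nonneg_right (Nat.le_ceil t) (Nat.cast_nonneg Q)

theorem map_iterateFrobenius_span {R : Type*} [CommRing R] (p : ℕ) [Fact p.Prime] [CharP R p]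
    {n : ℕ} (f : Fin n → R) (e : ℕ) :
    (Ideal.span (Set.range f)).map (iterateFrobenius R p e) =
      Ideal.span (Set.range fun i => f i ^ p ^ e) := by
  rw [Ideal.map_span, ← Set.range_comp]
  rfl

/-- The ideals `𝔞^⌈tq⌉ I^[q]` contain powers of `𝔞` with exponent linear in `q`. -/
theorem exists_pow_mul_le_mul_frobeniusPower {R : Type*} [CommRing R] [IsNoetherianRing R]
    (p : ℕ) [hp : Fact p.Prime] [CharP R p] {a I : Ideal R} (t : ℝ) (hI : ∃ s, a ^ s ≤ I) :
    ∃ c : ℕ, 0 < c ∧ ∀ e : ℕ,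
      a ^ (c * p ^ e) ≤ a ^ ⌈t * ((p ^ e : ℕ) : ℝ)⌉₊ * frobeniusPower I (p ^ e) := by
  obtain ⟨s, hs⟩ := hI
  obtain ⟨g, x, hx⟩ := Submodule.fg_iff_exists_fin_generating_family.mp
    (IsNoetherian.noetherian a)
  refine ⟨⌈t⌉₊ + s + g + 1, by omega, fun e => ?_⟩
  have h1 : a ^ (p ^ e * s + p ^ e * g) ≤ frobeniusPower I (p ^ e) :=
    (pow_add_mul_le_map_pow hx (pow_pos hp.out.pos e) (iterateFrobenius_def p e) s).trans
      (Ideal.map_mono hs)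
  refine (Ideal.pow_le_pow_right ?_).trans
    ((pow_add a ⌈t * ((p ^ e : ℕ) : ℝ)⌉₊ (p ^ e * s + p ^ e * g)).le.trans (mul_le_mul_right h1 _))
  have h2 := ceil_mul_natCast_le t (p ^ e)
  nlinarith [Nat.zero_le (p ^ e)]

variable {R : Type*} [CommRing R] [IsNoetherianRing R] [IsLocalRing R]
  {a I : Ideal R} {D : ℕ}

/-- A bounded shift of the exponent changes the colength of `a ^ M * K` by `O(M ^ D)`, uniformly over
the ideals `K` generated by `n` elements. -/
theorem exists_quotLength_pow_add_mul_le (ha : maximalIdeal R ≤ a.radical)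
    (hd : ringKrullDim R ≤ (D + 1 : ℕ)) (c n : ℕ) :
    ∃ C : ℕ, ∀ (M : ℕ) (f : Fin n → R),
      quotLength (a ^ (M + c) * Ideal.span (Set.range f)) ≤
        quotLength (a ^ M * Ideal.span (Set.range f)) + C * ((M + 1) ^ D : ℕ) := by
  obtain ⟨C, hC⟩ := exists_quotLength_pow_add_le ha hd c
  have key : ∀ M : ℕ, quotLength (a ^ (M + c)) ≤
      quotLength (a ^ M) + ((C + colength (a ^ c)) * (M + 1) ^ D : ℕ) := by
    intro M
    rcases Nat.eq_zero_or_pos M with rfl | hM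
    · simp only [zero_add, one_pow, mul_one]
      rw [← coe_colength_pow ha c]
      refine le_add_left ?_
      exact_mod_cast Nat.le_add_left _ _
    · refine (hC M hM).trans ?_
      gcongr
      exact_mod_cast Nat.mul_le_mul (Nat.le_add_right _ _) (Nat.pow_le_pow_left (Nat.le_succ _) _)
  refine ⟨n * (C + colength (a ^ c)), fun M f => ?_⟩
  have h := quotLength_mul_add_le (Ideal.pow_le_pow_right (Nat.le_add_right M c)) f (a := a ^ M)
  have hfin : (n : ℕ∞) * quotLength (a ^ M) ≠ ⊤ := by
    rw [← coe_colength_pow ha]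
    exact_mod_cast ENat.natCast_ne_top (n * colength (a ^ M))
  have h2 := h.trans (add_le_add_right (mul_le_mul_right (key M) (n : ℕ∞)) _)
  rw [mul_add, ← add_assoc, add_right_comm] at h2
  have h3 := (ENat.add_le_add_iff_right hfin).mp h2
  refine h3.trans (le_of_eq ?_)
  push_cast
  ring

variable (p : ℕ) [hp : Fact p.Prime] [CharP R p]

/-- Applying a fixed power of Frobenius to `𝔞^⌈tq⌉ I^[q]` gives `𝔞^⌈tqQ⌉ I^[qQ]`, up to an error
of lower order in the colength. -/
theorem exists_quotLength_map_iterateFrobenius_jointIdeal (ha : maximalIdeal R ≤ a.radical)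
    (hd : ringKrullDim R ≤ (D + 1 : ℕ)) {t : ℝ} (ht : 0 < t) (e' : ℕ) :
    ∃ C : ℕ, ∀ e : ℕ,
      quotLength (a ^ ⌈t * ((p ^ (e + e') : ℕ) : ℝ)⌉₊ * frobeniusPower I (p ^ (e + e'))) ≤
        quotLength ((a ^ ⌈t * ((p ^ e : ℕ) : ℝ)⌉₊ * frobeniusPower I (p ^ e)).map
          (iterateFrobenius R p e')) ∧
      quotLength ((a ^ ⌈t * ((p ^ e : ℕ) : ℝ)⌉₊ * frobeniusPower I (p ^ e)).map
          (iterateFrobenius R p e')) ≤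
        quotLength (a ^ ⌈t * ((p ^ (e + e') : ℕ) : ℝ)⌉₊ * frobeniusPower I (p ^ (e + e'))) +
          (C * (p ^ e) ^ D : ℕ) := by
  obtain ⟨g, x, hx⟩ := Submodule.fg_iff_exists_fin_generating_family.mp
    (IsNoetherian.noetherian a)
  obtain ⟨n, f, hf⟩ := Submodule.fg_iff_exists_fin_generating_family.mp
    (IsNoetherian.noetherian I)
  obtain ⟨C, hC⟩ := exists_quotLength_pow_add_mul_le ha hd (p ^ e' + p ^ e' * g) n
  refine ⟨C * ((⌈t⌉₊ + 1) * p ^ e') ^ D, fun e => ?_⟩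
  have hQ : 0 < p ^ e' := pow_pos hp.out.pos e'
  set N := ⌈t * ((p ^ e : ℕ) : ℝ)⌉₊
  set L := ⌈t * ((p ^ (e + e') : ℕ) : ℝ)⌉₊
  have hLN : L ≤ p ^ e' * N := by
    rw [Nat.ceil_le]
    push_cast
    rw [pow_add, ← mul_assoc, mul_comm]
    refine mul_le_mul_of_nonneg_left ?_ (by positivity)
    exact_mod_cast (Nat.le_ceil _ : t * ((p ^ e : ℕ) : ℝ) ≤ N)
  have hNL : p ^ e' * N ≤ L + p ^ e' := by
    have h1 : (N : ℝ) < t * ((p ^ e : ℕ) : ℝ) + 1 := Nat.ceil_lt_add_one (by positivity)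
    have h2 : t * ((p ^ (e + e') : ℕ) : ℝ) ≤ L := Nat.le_ceil _
    have h3 : (0 : ℝ) < (p : ℝ) ^ e' := by exact_mod_cast hQ
    have h4 : ((p ^ e' * N : ℕ) : ℝ) ≤ (L + p ^ e' : ℕ) := by
      push_cast at *
      rw [pow_add] at h2
      nlinarith [mul_lt_mul_of_pos_left h1 h3]
    exact_mod_cast h4
  have hK : frobeniusPower I (p ^ (e + e')) = Ideal.span (Set.range fun i => f i ^ p ^ (e + e')) := by
    rw [frobeniusPower_eq_map, ← map_iterateFrobenius_span, show I = _ from hf.symm]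
  have hX : (a ^ N * frobeniusPower I (p ^ e)).map (iterateFrobenius R p e') =
      (a ^ N).map (iterateFrobenius R p e') * frobeniusPower I (p ^ (e + e')) := by
    rw [Ideal.map_mul, frobeniusPower_eq_map, frobeniusPower_eq_map,
      map_iterateFrobenius_map_iterateFrobenius]
  rw [hX]
  refine ⟨quotLength_anti (mul_le_mul_left ?_ _), ?_⟩
  · exact (map_pow_le_pow_mul (iterateFrobenius_def p e') N).trans (Ideal.pow_le_pow_right hLN)
  · have h1 : a ^ (L + (p ^ e' + p ^ e' * g)) ≤ (a ^ N).map (iterateFrobenius R p e') :=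
      (Ideal.pow_le_pow_right (by omega)).trans
        (pow_add_mul_le_map_pow hx hQ (iterateFrobenius_def p e') N)
    have h2 := hC L (fun i => f i ^ p ^ (e + e'))
    rw [← hK] at h2
    refine (quotLength_anti (mul_le_mul_left h1 _)).trans (h2.trans ?_)
    gcongr
    have h3 : L + 1 ≤ (⌈t⌉₊ + 1) * p ^ e' * p ^ e := by
      have := ceil_mul_natCast_le t (p ^ (e + e'))
      have h4 : 0 < p ^ e' * p ^ e := mul_pos hQ (pow_pos hp.out.pos e)
      rw [show p ^ (e + e') = p ^ e' * p ^ e by rw [pow_add, mul_comm]] at this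
      change L + 1 ≤ _
      have h5 : L ≤ ⌈t⌉₊ * (p ^ e' * p ^ e) := by
        simpa only [L, show p ^ (e + e') = p ^ e' * p ^ e by rw [pow_add, mul_comm]] using this
      nlinarith
    have h6 := Nat.pow_le_pow_left h3 D
    rw [mul_pow _ (p ^ e)] at h6
    have h7 := Nat.mul_le_mul_left C h6
    rw [← mul_assoc] at h7
    exact_mod_cast h7

/-- The joint Hilbert–Kunz function of an F-finite local ring whose residue field is perfect. -/
theorem exists_isBigO_jointLength (hF : (frobenius R p).Finite)
    (hres : ∀ x : R, ∃ y : R, x - y ^ p ∈ maximalIdeal R)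
    (ha : maximalIdeal R ≤ a.radical) (ha' : a ≠ ⊤) (hI : maximalIdeal R ≤ I.radical)
    (hd : ringKrullDim R ≤ (D + 1 : ℕ)) {t : ℝ} (ht : 0 < t) :
    ∃ c : ℝ, (fun e : ℕ => (jointLength a I t (p ^ e) : ℝ) - c * ((p : ℝ) ^ e) ^ (D + 1))
      =O[atTop] (fun e : ℕ => ((p : ℝ) ^ e) ^ D) := by
  have haI : ∃ s, a ^ s ≤ I := by
    obtain ⟨k, -, hk⟩ := exists_pow_le_of_le_radical hI
    exact ⟨k, (Ideal.pow_right_mono (le_maximalIdeal ha') k).trans hk⟩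
  obtain ⟨c, hc, hJ⟩ := exists_pow_mul_le_mul_frobeniusPower (a := a) (I := I) p t haI
  obtain ⟨e₀, C, hC⟩ := exists_quotLength_map_iterateFrobenius_succ p hF hres ha ha' hd
  obtain ⟨C₁, hC₁⟩ :=
    exists_quotLength_map_iterateFrobenius_jointIdeal (I := I) p ha hd ht e₀
  obtain ⟨C₂, hC₂⟩ :=
    exists_quotLength_map_iterateFrobenius_jointIdeal (I := I) p ha hd ht (e₀ + 1)
  have hfin : ∀ e, (jointLength a I t (p ^ e) : ℕ∞) =
      quotLength (a ^ ⌈t * ((p ^ e : ℕ) : ℝ)⌉₊ * frobeniusPower I (p ^ e)) := fun e =>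
    ENat.natCast_toNat (quotLength_ne_top_of_pow_le ha (hJ e))
  refine exists_isBigO_of_recursion hp.out.one_lt (e₀ := e₀)
    (C := ((p ^ (D + 1) * C₁ + C₂ + C * c ^ D : ℕ) : ℝ)) fun e he => ?_
  obtain ⟨e, rfl⟩ := Nat.exists_eq_add_of_le' he
  obtain ⟨h1, h2⟩ := hC (c * p ^ e) (Nat.mul_pos hc (pow_pos hp.out.pos e)) _ (hJ e)
  obtain ⟨h3, h4⟩ := hC₁ e
  obtain ⟨h5, h6⟩ := hC₂ e
  rw [← hfin] at h3 h4 h5 h6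
  have h7 : (jointLength a I t (p ^ (e + (e₀ + 1))) : ℕ∞) ≤
      (p ^ (D + 1) * (jointLength a I t (p ^ (e + e₀)) + C₁ * (p ^ e) ^ D) +
        C * (c * p ^ e) ^ D : ℕ) := by
    refine h5.trans (h1.trans ?_)
    push_cast at *
    gcongr
  have h8 : ((p ^ (D + 1) * jointLength a I t (p ^ (e + e₀)) : ℕ) : ℕ∞) ≤
      (jointLength a I t (p ^ (e + (e₀ + 1))) + C₂ * (p ^ e) ^ D + C * (c * p ^ e) ^ D : ℕ) := by
    push_cast at *
    refine (mul_le_mul_right h3 _).trans (h2.trans ?_)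
    gcongr
  have h9 : jointLength a I t (p ^ (e + (e₀ + 1))) ≤
      p ^ (D + 1) * (jointLength a I t (p ^ (e + e₀)) + C₁ * (p ^ e) ^ D) +
        C * (c * p ^ e) ^ D := by exact_mod_cast h7
  have h10 : p ^ (D + 1) * jointLength a I t (p ^ (e + e₀)) ≤
      jointLength a I t (p ^ (e + (e₀ + 1))) + C₂ * (p ^ e) ^ D + C * (c * p ^ e) ^ D := by
    exact_mod_cast h8
  have h11 : (jointLength a I t (p ^ (e + (e₀ + 1))) : ℝ) ≤
      p ^ (D + 1) * (jointLength a I t (p ^ (e + e₀)) + C₁ * ((p : ℝ) ^ e) ^ D) +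
        C * (c * (p : ℝ) ^ e) ^ D := by exact_mod_cast h9
  have h12 : (p : ℝ) ^ (D + 1) * jointLength a I t (p ^ (e + e₀)) ≤
      jointLength a I t (p ^ (e + (e₀ + 1))) + C₂ * ((p : ℝ) ^ e) ^ D + C * (c * (p : ℝ) ^ e) ^ D := by
    exact_mod_cast h10
  have hp1 : (1 : ℝ) ≤ p := by exact_mod_cast hp.out.one_lt.le
  have h13 : ((p : ℝ) ^ e) ^ D ≤ ((p : ℝ) ^ (e + e₀)) ^ D := by
    gcongr
    exact Nat.le_add_right e e₀
  have h14 : (0 : ℝ) ≤ ((p : ℝ) ^ e) ^ D := by positivity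
  refine le_trans ?_ (mul_le_mul_of_nonneg_left h13 (Nat.cast_nonneg _))
  rw [add_assoc, abs_le]
  rw [mul_pow] at h11 h12
  push_cast
  have hz1 : 0 ≤ (p : ℝ) ^ (D + 1) * C₁ * ((p : ℝ) ^ e) ^ D := by positivity
  have hz2 : 0 ≤ (C₂ : ℝ) * ((p : ℝ) ^ e) ^ D := by positivity
  constructor <;> nlinarith

end JointLength

/-! ### Coefficient fields in characteristic `p` -/

section CoefficientField

open Polynomial

/-- If `l ^ p ∈ F` but `l ∉ F`, then `1, l, …, l ^ (p - 1)` are linearly independent over `F`. -/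
theorem eq_zero_of_aeval_eq_zero_of_degree_lt {p : ℕ} [hp : Fact p.Prime] {k : Type*} [Field k]
    [CharP k p] {F : Subfield k} {l : k} (hl : l ∉ F) (hlp : l ^ p ∈ F) {r : F[X]}
    (hr : r.degree < p) (h0 : aeval l r = 0) : r = 0 := by
  have hirr : Irreducible (X ^ p - C (⟨l ^ p, hlp⟩ : F)) := by
    refine X_pow_sub_C_irreducible_of_prime hp.out fun b hb => hl ?_
    have h1 : (b : k) ^ p = l ^ p := congrArg Subtype.val hb
    rw [← frobenius_inj k p h1]
    exact b.2
  have hmin := minpoly.eq_of_irreducible_of_monic (x := l) hirr (by simp; exact sub_self _)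
    (monic_X_pow_sub_C _ hp.out.ne_zero)
  refine eq_zero_of_dvd_of_degree_lt (minpoly.dvd F l h0) ?_
  rw [← hmin, degree_X_pow_sub_C hp.out.pos]
  exact hr

theorem natDegree_lt_of_degree_lt {S : Type*} [Semiring S] {q : S[X]} {n : ℕ} (hn : 0 < n)
    (h : q.degree < n) : q.natDegree < n := by
  rcases eq_or_ne q 0 with rfl | hq
  · simpa using hn
  · exact (natDegree_lt_iff_degree_lt hq).mpr h

/-- Fields of characteristic `p` are formally smooth over the prime field: the lift exists
canonically on `p`-th powers, and a lift on a subfield containing the `p`-th powers extends along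
the adjunction of one more element, whose minimal polynomial is of the form `X ^ p - c`. -/
theorem exists_mk_comp_eq_of_sq_eq_bot {p : ℕ} [hp : Fact p.Prime] {k B : Type*} [Field k]
    [CharP k p] [CommRing B] [CharP B p] {I : Ideal B} (hI : I ^ 2 = ⊥) (f : k →+* B ⧸ I) :
    ∃ g : k →+* B, (Ideal.Quotient.mk I).comp g = f := by
  let T : Subring (k × B) :=
    RingHom.eqLocus (f.comp (RingHom.fst k B)) ((Ideal.Quotient.mk I).comp (RingHom.snd k B))
  have hT : ∀ x : k × B, x ∈ T ↔ f x.1 = Ideal.Quotient.mk I x.2 := fun x => Iff.rfl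
  -- Partial lifts defined at least on all `p`-th powers, encoded by their graphs.
  let 𝒢 : Set (Subring (k × B)) :=
    {G | G ≤ T ∧ (∀ x ∈ T, x ^ p ∈ G) ∧ ∀ x ∈ G, x.1 = 0 → x = 0}
  have hsq : ∀ x ∈ I, x ^ p = 0 := by
    intro x hx
    have h2 : x ^ 2 = 0 := by
      have := Ideal.pow_mem_pow hx 2
      rwa [hI] at this
    exact pow_eq_zero_of_le hp.out.two_le h2
  have hne : T.map (frobenius (k × B) p) ∈ 𝒢 := by
    refine ⟨?_, fun x hx => ⟨x, hx, rfl⟩, ?_⟩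
    · rintro _ ⟨x, hx, rfl⟩
      exact T.pow_mem hx p
    · rintro _ ⟨x, hx, rfl⟩ h0
      have h1 : x.1 = 0 := pow_eq_zero_iff hp.out.ne_zero |>.mp h0
      have h2 : x.2 ∈ I := by
        rw [← Ideal.Quotient.eq_zero_iff_mem, ← (hT x).mp hx, h1, map_zero]
      exact Prod.ext h0 (hsq _ h2)
  obtain ⟨G, -, hG⟩ := zorn_le_nonempty₀ 𝒢 (by
    intro c hc hchain y hy
    refine ⟨sSup c, ⟨sSup_le fun G hG => (hc hG).1,
      fun x hx => (le_sSup hy : y ≤ sSup c) ((hc hy).2.1 x hx), fun x hx => ?_⟩,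
      fun G hG => le_sSup hG⟩
    obtain ⟨G, hG, hx⟩ := (Subring.mem_sSup_of_directedOn ⟨y, hy⟩ hchain.directedOn).mp hx
    exact (hc hG).2.2 x hx) _ hne
  obtain ⟨hGT, hGp, hG0⟩ := hG.prop
  have hTsurj : ∀ x : k, ∃ b : B, (x, b) ∈ T := fun x => by
    obtain ⟨b, hb⟩ := Ideal.Quotient.mk_surjective (f x)
    exact ⟨b, hb.symm⟩
  let F : Subfield k :=
    { G.map (RingHom.fst k B) with
      inv_mem' := by
        rintro _ ⟨y, hy, rfl⟩
        obtain ⟨b, hb⟩ := hTsurj (y.1)⁻¹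
        refine ⟨y ^ (p - 1) * (y.1⁻¹, b) ^ p, G.mul_mem (G.pow_mem hy _) (hGp _ hb), ?_⟩
        change y.1 ^ (p - 1) * (y.1⁻¹) ^ p = y.1⁻¹
        rcases eq_or_ne y.1 0 with h0 | h0
        · simp [h0, hp.out.ne_zero]
        · obtain ⟨m, hm⟩ := Nat.exists_eq_succ_of_ne_zero hp.out.ne_zero
          rw [hm, Nat.succ_sub_one, pow_succ, ← mul_assoc, ← mul_pow, mul_inv_cancel₀ h0, one_pow,
            one_mul] }
  have hGinj : Function.Injective fun x : G => x.1.1 := by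
    intro x y hxy
    refine Subtype.ext (sub_eq_zero.mp (hG0 _ (G.sub_mem x.2 y.2) ?_))
    exact sub_eq_zero.mpr hxy
  have hFtop : ∀ l : k, l ∈ F := by
    intro l
    by_contra hl
    -- Adjoin a lift `z` of `l` to `G`; a relation satisfied by `l` is divisible by `X ^ p - l ^ p`,
    -- which `z` satisfies as well since `z ^ p ∈ G`.
    obtain ⟨b, hb⟩ := hTsurj l
    set z : k × B := (l, b)
    have hlp : l ^ p ∈ F := ⟨z ^ p, hGp z hb, rfl⟩
    let φ : G →+* F :=
      ((RingHom.fst k B).comp G.subtype).codRestrict F fun x => ⟨x, x.2, rfl⟩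
    have hφ : Function.Injective φ := fun x y h => hGinj (congrArg Subtype.val h)
    let G' : Subring (k × B) := (aeval (R := G) z).range.toSubring
    have hGG' : G ≤ G' := fun x hx => ⟨C ⟨x, hx⟩, by simp; rfl⟩
    have hzG' : z ∈ G' := ⟨X, by simp⟩
    have hG' : G' ∈ 𝒢 := by
      refine ⟨?_, fun x hx => hGG' (hGp x hx), ?_⟩
      · rintro _ ⟨q, rfl⟩
        change aeval z q ∈ T
        rw [aeval_eq_sum_range]
        exact T.sum_mem fun i _ => T.mul_mem (hGT (q.coeff i).2) (T.pow_mem hb i)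
      · rintro _ ⟨q, rfl⟩ h0
        change aeval z q = 0
        change (aeval z q).1 = 0 at h0
        let w : G := ⟨z ^ p, hGp z hb⟩
        have hmonic : (X ^ p - C w).Monic := monic_X_pow_sub_C w hp.out.ne_zero
        have hw : aeval z (X ^ p - C w) = 0 := by
          simp only [map_sub, map_pow, aeval_X, aeval_C]
          exact sub_self _
        have hq : aeval z q = aeval z (q %ₘ (X ^ p - C w)) := by
          conv_lhs => rw [← modByMonic_add_div q (X ^ p - C w)]
          rw [map_add, map_mul, hw, zero_mul, add_zero]
        rw [hq] at h0 ⊢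
        set r := q %ₘ (X ^ p - C w)
        have hr : r.degree < p := by
          have : Nontrivial G := ⟨0, 1, fun h => zero_ne_one (congrArg (fun x : G => x.1.1) h)⟩
          rw [← degree_X_pow_sub_C hp.out.pos w]
          exact degree_modByMonic_lt _ hmonic
        have hr0 : r.map φ = 0 := by
          refine eq_zero_of_aeval_eq_zero_of_degree_lt hl hlp (degree_map_le.trans_lt hr) ?_
          rw [← h0, aeval_eq_sum_range' (n := p), aeval_eq_sum_range' (n := p)]
          · rw [Prod.fst_sum]
            refine Finset.sum_congr rfl fun i _ => ?_
            rw [coeff_map]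
            rfl
          · exact natDegree_lt_of_degree_lt hp.out.pos hr
          · exact natDegree_lt_of_degree_lt hp.out.pos (degree_map_le.trans_lt hr)
        rw [(Polynomial.map_eq_zero_iff hφ).mp hr0, map_zero]
    exact hl ⟨z, hG.le_of_ge hG' hGG' hzG', rfl⟩
  let E : G ≃+* k := RingEquiv.ofBijective ((RingHom.fst k B).comp G.subtype)
    ⟨hGinj, fun l => by
      obtain ⟨y, hy, rfl⟩ := hFtop l
      exact ⟨⟨y, hy⟩, rfl⟩⟩
  refine ⟨((RingHom.snd k B).comp G.subtype).comp E.symm.toRingHom, RingHom.ext fun x => ?_⟩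
  obtain ⟨y, rfl⟩ := E.surjective x
  have := (hT y).mp (hGT y.2)
  simp only [RingHom.comp_apply, RingEquiv.toRingHom_eq_coe, RingHom.coe_coe,
    RingEquiv.symm_apply_apply]
  exact this.symm

theorem formallySmooth_zmod {p : ℕ} [hp : Fact p.Prime] {k : Type*} [Field k]
    [CharP k p] [Algebra (ZMod p) k] : Algebra.FormallySmooth (ZMod p) k := by
  refine Algebra.FormallySmooth.of_comp_surjective fun B _ _ I hI f => ?_
  rcases subsingleton_or_nontrivial B with hB | hB
  · exact ⟨⟨⟨⟨⟨fun _ => 0, Subsingleton.elim _ _⟩, fun _ _ => Subsingleton.elim _ _⟩,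
      Subsingleton.elim _ _, fun _ _ => Subsingleton.elim _ _⟩, fun _ => Subsingleton.elim _ _⟩,
      AlgHom.ext fun x => by
        have : Subsingleton (B ⧸ I) := Ideal.Quotient.mk_surjective.subsingleton
        exact Subsingleton.elim _ _⟩
  have : CharP B p := charP_of_injective_algebraMap (algebraMap (ZMod p) B).injective p
  obtain ⟨g, hg⟩ := exists_mk_comp_eq_of_sq_eq_bot hI (f : k →+* B ⧸ I)
  refine ⟨⟨g, fun x => ?_⟩, AlgHom.ext fun x => congrArg (fun h : k →+* B ⧸ I => h x) hg⟩
  exact congrArg (fun h : ZMod p →+* B => h x)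
    (Subsingleton.elim (g.comp (algebraMap (ZMod p) k)) (algebraMap (ZMod p) B))

/-- A complete local ring of characteristic `p` contains a coefficient field. -/
theorem exists_coefficientField {p : ℕ} [hp : Fact p.Prime] {A : Type*} [CommRing A]
    [IsLocalRing A] [CharP A p] [IsAdicComplete (IsLocalRing.maximalIdeal A) A] :
    ∃ σ : IsLocalRing.ResidueField A →+* A,
      (IsLocalRing.residue A).comp σ = RingHom.id _ := by
  let _ : Algebra (ZMod p) A := ZMod.algebra A p
  have : CharP (IsLocalRing.ResidueField A) p :=
    charP_of_injective_algebraMap (algebraMap (ZMod p) (IsLocalRing.ResidueField A)).injective p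
  have : Algebra.FormallySmooth (ZMod p) (IsLocalRing.ResidueField A) := formallySmooth_zmod
  obtain ⟨g, hg⟩ := Algebra.FormallySmooth.exists_mkₐ_comp_eq_of_isAdicComplete (R := ZMod p)
    (I := IsLocalRing.maximalIdeal A) (AlgHom.id (ZMod p) (IsLocalRing.ResidueField A))
  exact ⟨g, RingHom.ext fun x => congrArg (fun h => h x) hg⟩

end CoefficientField

/-! ### Residue field extensions and lengths -/

section ResidueExtension

open IsLocalRing

theorem quotLength_eq_one {S : Type*} [CommRing S] [IsLocalRing S] {b : Ideal S}
    (hb : maximalIdeal S ≤ b) (hb' : b ≠ ⊤) : quotLength b = 1 := by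
  rw [← (maximalIdeal.isMaximal S).eq_of_le hb' hb]
  exact Module.length_eq_one_iff.mpr
    (isSimpleModule_iff_isCoatom.mpr (maximalIdeal.isMaximal S).out)

/-- Lengths do not change along a homomorphism of local rings under which the maximal ideal
extends to the maximal ideal and primary ideals are contracted from their extensions. -/
theorem quotLength_map_eq {A B : Type*} [CommRing A] [IsNoetherianRing A] [IsLocalRing A]
    [CommRing B] [IsLocalRing B] (ψ : A →+* B) (hm : (maximalIdeal A).map ψ = maximalIdeal B)
    (hcomap : ∀ (J : Ideal A) (N : ℕ), maximalIdeal A ^ N ≤ J → (J.map ψ).comap ψ = J)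
    {J : Ideal A} {N : ℕ} (hJ : maximalIdeal A ^ N ≤ J) :
    quotLength (J.map ψ) = quotLength J := by
  have hfin : quotLength J ≠ ⊤ := by
    refine quotLength_ne_top_of_maximalIdeal_le_radical fun x hx => ⟨N, hJ ?_⟩
    exact Ideal.pow_mem_pow hx N
  obtain ⟨l, hl⟩ := ENat.ne_top_iff_exists.mp hfin
  induction l using Nat.strong_induction_on generalizing J with
  | _ l ih =>
  by_cases hJtop : J = ⊤
  · rw [hJtop, Ideal.map_top, quotLength_top, quotLength_top]
  -- An element `x ∉ J` of the socle of `A ⧸ J`, found in the last power of the maximal ideal which is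
  -- not contained in `J`.
  classical
  have hex : ∃ N, maximalIdeal A ^ N ≤ J := ⟨N, hJ⟩
  obtain ⟨n, hn⟩ : ∃ n, Nat.find hex = n + 1 := by
    refine Nat.exists_eq_succ_of_ne_zero fun h0 => hJtop ?_
    have := Nat.find_spec hex
    rwa [h0, pow_zero, Ideal.one_eq_top, top_le_iff] at this
  obtain ⟨x, hx, hxJ⟩ := SetLike.not_le_iff_exists.mp (Nat.find_min hex (by omega : n < Nat.find hex))
  have hmx : ∀ y ∈ maximalIdeal A, x * y ∈ J := fun y hy => by
    have := Nat.find_spec hex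
    rw [hn, pow_succ] at this
    exact this (Ideal.mul_mem_mul hx hy)
  have h1 : quotLength (colonElem J x) = 1 :=
    quotLength_eq_one (fun y hy => mem_colonElem.mpr (hmx y hy)) fun h => hxJ (by
      have : (1 : A) ∈ colonElem J x := h ▸ Submodule.mem_top
      simpa [mem_colonElem] using this)
  have h2 : quotLength (colonElem (J.map ψ) (ψ x)) = 1 := by
    refine quotLength_eq_one ?_ fun h => hxJ ?_
    · rw [← hm, Ideal.map_le_iff_le_comap]
      intro y hy
      rw [Ideal.mem_comap, mem_colonElem, ← map_mul]
      exact Ideal.mem_map_of_mem ψ (hmx y hy)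
    · have : (1 : B) ∈ colonElem (J.map ψ) (ψ x) := h ▸ Submodule.mem_top
      rw [mem_colonElem, mul_one] at this
      rw [← hcomap J N hJ]
      exact this
  have h3 := quotLength_eq_colonElem_add J x
  rw [h1, ← hl] at h3
  have h4 : quotLength (J ⊔ Ideal.span {x}) ≠ ⊤ := fun h => by
    rw [h] at h3
    exact ENat.natCast_ne_top l (h3.trans (by simp))
  obtain ⟨l', hl'⟩ := ENat.ne_top_iff_exists.mp h4
  rw [← hl'] at h3
  have h5 : l = 1 + l' := by exact_mod_cast h3
  have h6 := ih l' (by omega) (hJ.trans le_sup_left) h4 hl'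
  rw [quotLength_eq_colonElem_add _ (ψ x), h2, quotLength_eq_colonElem_add J x, h1, ← h6,
    Ideal.map_sup, Ideal.map_span, Set.image_singleton]

end ResidueExtension

section MvPowerSeries

variable {σ : Type*}

/-- Extending the coefficients of power series along a field extension is pure: a linear
retraction of the extension, applied to coefficients, is linear over the smaller power series
ring. -/
theorem comap_map_mvPowerSeries_map {k K : Type*} [Field k] [Field K] [Algebra k K]
    (J : Ideal (MvPowerSeries σ k)) :
    (J.map (MvPowerSeries.map (algebraMap k K))).comap (MvPowerSeries.map (algebraMap k K)) = J := by
  classical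
  refine le_antisymm ?_ Ideal.le_comap_map
  obtain ⟨ρ, hρ⟩ := (Algebra.linearMap k K).exists_leftInverse_of_injective
    (LinearMap.ker_eq_bot.mpr (algebraMap k K).injective)
  have hρ1 : ∀ c : k, ρ (algebraMap k K c) = c := fun c => congrArg (fun f => f c) hρ
  let Φ : MvPowerSeries σ K → MvPowerSeries σ k := fun f d => ρ (MvPowerSeries.coeff d f)
  have hΦ : ∀ f d, MvPowerSeries.coeff d (Φ f) = ρ (MvPowerSeries.coeff d f) := fun _ _ => rfl
  have hadd : ∀ f g, Φ (f + g) = Φ f + Φ g := fun f g => by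
    ext d
    simp [hΦ]
  have hmul : ∀ f s, Φ (f * MvPowerSeries.map (algebraMap k K) s) = Φ f * s := fun f s => by
    ext d
    rw [hΦ, MvPowerSeries.coeff_mul, MvPowerSeries.coeff_mul, map_sum]
    refine Finset.sum_congr rfl fun x _ => ?_
    rw [MvPowerSeries.coeff_map, hΦ, mul_comm, ← Algebra.smul_def, map_smul, smul_eq_mul, mul_comm]
  have key : ∀ f ∈ J.map (MvPowerSeries.map (algebraMap k K)), ∀ c, Φ (c * f) ∈ J := by
    intro f hf
    induction hf using Submodule.span_induction with
    | mem f hf =>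
      obtain ⟨s, hs, rfl⟩ := hf
      intro c
      rw [hmul]
      exact J.mul_mem_left _ hs
    | zero =>
      intro c
      have : Φ (c * 0) = 0 := by
        ext d
        simp [hΦ]
      rw [this]
      exact J.zero_mem
    | add f g _ _ hf hg =>
      intro c
      rw [mul_add, hadd]
      exact J.add_mem (hf c) (hg c)
    | smul a f _ hf =>
      intro c
      rw [smul_eq_mul, ← mul_assoc]
      exact hf _
  intro s hs
  have h1 := key _ hs 1
  have h2 : Φ (1 * MvPowerSeries.map (algebraMap k K) s) = s := by
    ext d
    rw [one_mul, hΦ, MvPowerSeries.coeff_map, hρ1]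
  rwa [h2] at h1

theorem charP_mvPowerSeries (p : ℕ) {K : Type*} [Field K] [CharP K p] :
    CharP (MvPowerSeries σ K) p :=
  charP_of_injective_algebraMap (algebraMap K (MvPowerSeries σ K)).injective p

theorem mem_span_X_of_constantCoeff_eq_zero [Finite σ] {K : Type*} [CommRing K]
    {f : MvPowerSeries σ K} (hf : MvPowerSeries.constantCoeff f = 0) :
    f ∈ Ideal.span (Set.range (MvPowerSeries.X : σ → MvPowerSeries σ K)) := by
  let e := (MvPowerSeries.toAdicCompletionAlgEquiv σ K).toRingEquiv
  have hmap : (Ideal.span (Set.range MvPowerSeries.X)).map (e : MvPowerSeries σ K →+* _) =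
      (MvPolynomial.idealOfVars σ K).map (algebraMap _
        (AdicCompletion (MvPolynomial.idealOfVars σ K) (MvPolynomial σ K))) := by
    simp_rw [Ideal.map_span, ← Set.range_comp]
    congr 2
    ext1 i
    simp [e, AdicCompletion.algebraMap_apply, ← MvPolynomial.coe_X,
      MvPowerSeries.toAdicCompletion_coe]
  have h1 : e f ∈ (Ideal.span (Set.range MvPowerSeries.X)).map (e : MvPowerSeries σ K →+* _) := by
    rw [hmap, ← AdicCompletion.ker_evalOneₐ_eq_map _ (MvPolynomial.idealOfVars_fg σ K)]
    change AdicCompletion.evalOneₐ _ (MvPowerSeries.toAdicCompletion σ K f) = 0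
    have h0 : MvPowerSeries.truncTotal 1 f = 0 := by
      ext d
      by_cases hd : Finsupp.degree d < 1
      · rw [MvPowerSeries.coeff_truncTotal _ hd,
          (Finsupp.degree_eq_zero_iff d).mp (Nat.lt_one_iff.mp hd)]
        simpa using hf
      · rw [MvPowerSeries.coeff_truncTotal_eq_zero _ (by omega), MvPolynomial.coeff_zero]
    refine (AdicCompletion.evalOneₐ_liftAlgHom _ (MvPowerSeries.truncTotalAlgHom σ K)
      (fun h => AlgHom.ext fun _ => ?_) f).trans ?_
    · simpa [Ideal.Quotient.mk_eq_mk_iff_sub_mem] using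
        MvPowerSeries.truncTotal_sub_truncTotal_mem_pow_idealOfVars h (le_refl _) _
    · rw [MvPowerSeries.truncTotalAlgHom_apply, h0, map_zero, map_zero]
  obtain ⟨g, hg, hge⟩ := (Ideal.mem_map_of_equiv e _).mp h1
  rwa [← e.injective hge]

/-- Over a perfect field, the monomials with exponents less than `p` generate the ring of power
series over its subring of `p`-th powers. -/
theorem frobenius_mvPowerSeries_finite (p : ℕ) [hp : Fact p.Prime] [Finite σ] {K : Type*} [Field K]
    [CharP K p] [CharP (MvPowerSeries σ K) p] (hK : ∀ x : K, ∃ y, y ^ p = x) :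
    (frobenius (MvPowerSeries σ K) p).Finite := by
  classical
  have := Fintype.ofFinite σ
  choose r hr using hK
  let N : (σ → Fin p) → (σ →₀ ℕ) := fun α => Finsupp.equivFunOnFinite.symm fun i => (α i : ℕ)
  have key : ∀ f : MvPowerSeries σ K, f =
      ∑ α, MvPowerSeries.monomial (N α) 1 *
        (show MvPowerSeries σ K from fun γ => r (MvPowerSeries.coeff (N α + p • γ) f)) ^ p := by
    intro f
    ext d
    let α₀ : σ → Fin p := fun i => ⟨d i % p, Nat.mod_lt _ hp.out.pos⟩
    let γ₀ : σ →₀ ℕ := Finsupp.equivFunOnFinite.symm fun i => d i / p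
    have hd : d = N α₀ + p • γ₀ := by
      ext i
      simp [N, α₀, γ₀, Nat.mod_add_div]
    rw [map_sum, Finset.sum_eq_single α₀]
    · rw [← MvPowerSeries.map_frobenius_expand p hp.out.ne_zero]
      nth_rw 2 [hd]
      rw [MvPowerSeries.coeff_add_monomial_mul, one_mul, MvPowerSeries.coeff_map,
        MvPowerSeries.coeff_expand_smul, frobenius_def]
      change _ = r (MvPowerSeries.coeff (N α₀ + p • γ₀) f) ^ p
      rw [hr, ← hd]
    · intro α _ hα
      rw [← MvPowerSeries.map_frobenius_expand p hp.out.ne_zero, MvPowerSeries.coeff_monomial_mul]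
      split_ifs with hle
      · rw [one_mul, MvPowerSeries.coeff_map]
        obtain ⟨i, hi⟩ := Function.ne_iff.mp hα
        rw [MvPowerSeries.coeff_expand_of_not_dvd p hp.out.ne_zero (i := i), map_zero]
        intro hdvd
        apply hi
        ext
        have h1 : (α i : ℕ) ≤ d i := hle i
        have h2 : p ∣ d i - α i := hdvd
        change (α i : ℕ) = d i % p
        have h3 := (Nat.modEq_iff_dvd' h1).mpr h2
        rw [← h3, Nat.mod_eq_of_lt (α i).2]
      · rfl
    · intro h
      exact absurd (Finset.mem_univ _) h
  have hfin : Module.Finite (MvPowerSeries σ K) (Along (frobenius (MvPowerSeries σ K) p)) := by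
    refine ⟨⟨Finset.univ.image fun α => (MvPowerSeries.monomial (N α) (1 : K) : MvPowerSeries σ K),
      ?_⟩⟩
    rw [eq_top_iff]
    intro f _
    rw [show f = _ from key f]
    refine Submodule.sum_mem _ fun α _ => ?_
    rw [mul_comm]
    refine Submodule.smul_mem (Submodule.span (MvPowerSeries σ K)
      (_ : Set (Along (frobenius (MvPowerSeries σ K) p)))) (_ : MvPowerSeries σ K)
      (Submodule.subset_span ?_)
    exact Finset.mem_coe.mpr (Finset.mem_image_of_mem _ (Finset.mem_univ α))
  exact hfin

end MvPowerSeries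

/-! ### Faithful extension to an F-finite ring -/

section FFinite

open IsLocalRing

/-- Cohen's structure theorem for a complete local ring with a coefficient field. -/
theorem exists_surjective_mvPowerSeries {A k : Type*} [CommRing A] [IsLocalRing A]
    [IsAdicComplete (maximalIdeal A) A] (hfg : (maximalIdeal A).FG) [Field k] (σ : k →+* A)
    (hσ : ∀ x : A, ∃ c, x - σ c ∈ maximalIdeal A) :
    ∃ (n : ℕ) (π : MvPowerSeries (Fin n) k →+* A), Function.Surjective π ∧
      (Ideal.span (Set.range MvPowerSeries.X)).map π = maximalIdeal A := by
  obtain ⟨n, x, hx⟩ := Submodule.fg_iff_exists_fin_generating_family.mp hfg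
  let θ : MvPolynomial (Fin n) k →+* A := MvPolynomial.eval₂Hom σ x
  have hθ : (MvPolynomial.idealOfVars (Fin n) k).map θ = maximalIdeal A := by
    rw [MvPolynomial.idealOfVars, Ideal.map_span, ← Set.range_comp, ← hx]
    congr 2
    ext i
    simp [θ]
  have hθ' : ∀ j, MvPolynomial.idealOfVars (Fin n) k ^ j ≤ (maximalIdeal A ^ j).comap θ := fun j => by
    rw [← Ideal.map_le_iff_le_comap, Ideal.map_pow, hθ]
  let f : ∀ j, MvPowerSeries (Fin n) k →+* A ⧸ maximalIdeal A ^ j := fun j =>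
    (Ideal.quotientMap (maximalIdeal A ^ j) θ (hθ' j)).comp
      (MvPowerSeries.truncTotalAlgHom (Fin n) k j : MvPowerSeries (Fin n) k →+* _)
  have hf : ∀ j s, f j s = Ideal.Quotient.mk _ (θ (MvPowerSeries.truncTotal j s)) := fun j s => rfl
  have hcompat : ∀ {i j : ℕ} (hle : i ≤ j),
      (Ideal.Quotient.factorPow (maximalIdeal A) hle).comp (f j) = f i := by
    intro i j hle
    ext s
    rw [RingHom.comp_apply, hf, hf]
    change Ideal.Quotient.mk _ (θ (MvPowerSeries.truncTotal j s)) = _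
    rw [Ideal.Quotient.mk_eq_mk_iff_sub_mem, ← map_sub]
    exact hθ' i (MvPowerSeries.truncTotal_sub_truncTotal_mem_pow_idealOfVars hle le_rfl s)
  let π := IsAdicComplete.liftRingHom (maximalIdeal A) f hcompat
  have hπ : ∀ q : MvPolynomial (Fin n) k, π (q : MvPowerSeries (Fin n) k) = θ q := by
    intro q
    refine (IsHausdorff.eq_iff_smodEq (I := maximalIdeal A)).mpr fun j => ?_
    rw [smul_eq_mul, Ideal.mul_top, SModEq]
    change Ideal.Quotient.mk (maximalIdeal A ^ j) (π q) = Ideal.Quotient.mk _ (θ q)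
    rw [IsAdicComplete.mk_liftRingHom]
    exact congrArg (Ideal.quotientMap (maximalIdeal A ^ j) θ (hθ' j))
      ((MvPowerSeries.truncTotalAlgHom (Fin n) k j).commutes q)
  have hmap : (Ideal.span (Set.range MvPowerSeries.X)).map π = maximalIdeal A := by
    rw [← hθ, MvPolynomial.idealOfVars, Ideal.map_span, Ideal.map_span, ← Set.range_comp,
      ← Set.range_comp]
    congr 2
    ext i
    simp only [Function.comp_apply]
    rw [← hπ, MvPolynomial.coe_X]
  refine ⟨n, π, ?_, hmap⟩
  have : IsHausdorff ((Ideal.span (Set.range MvPowerSeries.X)).map π) A := by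
    rw [hmap]
    infer_instance
  refine surjective_of_mk_map_comp_surjective
    (I := Ideal.span (Set.range (MvPowerSeries.X : Fin n → MvPowerSeries (Fin n) k))) π fun y => ?_
  obtain ⟨y, rfl⟩ := Ideal.Quotient.mk_surjective y
  obtain ⟨c, hc⟩ := hσ y
  refine ⟨((MvPolynomial.C c : MvPolynomial (Fin n) k) : MvPowerSeries (Fin n) k), ?_⟩
  rw [RingHom.comp_apply, hπ, Ideal.Quotient.mk_eq_mk_iff_sub_mem, hmap, ← neg_mem_iff, neg_sub]
  simpa [θ] using hc

/-- Open ideals are contracted from the completion. -/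
theorem comap_map_adicCompletion {R : Type*} [CommRing R] {m J : Ideal R} {N : ℕ} (hJ : m ^ N ≤ J) :
    (J.map (algebraMap R (AdicCompletion m R))).comap (algebraMap R (AdicCompletion m R)) = J := by
  refine le_antisymm (fun r hr => ?_) Ideal.le_comap_map
  have h1 := Ideal.mem_map_of_mem (AdicCompletion.evalₐ m N : AdicCompletion m R →+* R ⧸ m ^ N)
    (Ideal.mem_comap.mp hr)
  rw [Ideal.map_map, AlgHom.comp_algebraMap, RingHom.coe_coe, AlgHom.commutes] at h1
  exact (Ideal.mem_quotient_iff_mem hJ).mp h1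

/-- A Noetherian local ring of characteristic `p` maps to an F-finite one with algebraically closed
residue field, without changing lengths. The extension is `K⟦X⟧ / 𝔠 K⟦X⟧`, where `k⟦X⟧ / 𝔠` is a
presentation of the completion and `K` is an algebraic closure of the residue field `k`. -/
theorem exists_fFinite_extension.{u} {R : Type u} [CommRing R] [IsNoetherianRing R] [IsLocalRing R]
    (p : ℕ) [hp : Fact p.Prime] [CharP R p] :
    ∃ (R' : Type u) (_ : CommRing R') (_ : IsNoetherianRing R') (_ : IsLocalRing R')
      (_ : CharP R' p) (ψ : R →+* R'), (frobenius R' p).Finite ∧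
      (∀ x : R', ∃ y, x - y ^ p ∈ maximalIdeal R') ∧
      (maximalIdeal R).map ψ = maximalIdeal R' ∧
      ∀ (J : Ideal R) (N : ℕ), maximalIdeal R ^ N ≤ J → (J.map ψ).comap ψ = J := by
  let A := AdicCompletion (maximalIdeal R) R
  let k := ResidueField A
  let K := AlgebraicClosure k
  let _ : Algebra (ZMod p) R := ZMod.algebra R p
  let _ : Algebra (ZMod p) A := ((algebraMap R A).comp (algebraMap (ZMod p) R)).toAlgebra
  have : CharP A p := charP_of_injective_algebraMap (algebraMap (ZMod p) A).injective p
  have : CharP k p := charP_of_injective_algebraMap (algebraMap (ZMod p) k).injective p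
  have : CharP K p := charP_of_injective_algebraMap (algebraMap k K).injective p
  obtain ⟨σ, hσ⟩ := exists_coefficientField (p := p) (A := A)
  obtain ⟨n, π, hπ, hmapπ⟩ := exists_surjective_mvPowerSeries (A := A)
    (by
      rw [AdicCompletion.maximalIdeal_eq_map]
      exact (maximalIdeal R).fg_of_isNoetherianRing.map _) σ
    (fun x => ⟨residue A x, by
      rw [← residue_eq_zero_iff, map_sub, sub_eq_zero]
      exact (congrArg (fun h => h (residue A x)) hσ).symm⟩)
  let S' := MvPowerSeries (Fin n) K
  have : CharP S' p := charP_mvPowerSeries p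
  let ι : MvPowerSeries (Fin n) k →+* S' := MvPowerSeries.map (algebraMap k K)
  let c : Ideal S' := (RingHom.ker π).map ι
  have hcK : ∀ J : Ideal (MvPowerSeries (Fin n) k), (J.map ι).comap ι = J :=
    comap_map_mvPowerSeries_map
  have hc : c ≠ ⊤ := fun h => by
    have h1 := hcK (RingHom.ker π)
    rw [show (RingHom.ker π).map ι = ⊤ from h, Ideal.comap_top] at h1
    exact (RingHom.ker_ne_top π) h1.symm
  let R' := S' ⧸ c
  have : Nontrivial R' := Ideal.Quotient.nontrivial_iff.mpr hc
  have hloc : IsLocalRing R' :=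
    IsLocalRing.of_surjective' (Ideal.Quotient.mk c) Ideal.Quotient.mk_surjective
  have : CharP R' p := charP_of_injective_algebraMap (algebraMap K R').injective p
  let mkι : MvPowerSeries (Fin n) k →+* R' := (Ideal.Quotient.mk c).comp ι
  have hker : ∀ s ∈ RingHom.ker π, mkι s = 0 := fun s hs =>
    Ideal.Quotient.eq_zero_iff_mem.mpr (Ideal.mem_map_of_mem ι hs)
  let ψ₂ : A →+* R' := (Ideal.Quotient.lift (RingHom.ker π) mkι hker).comp
    (RingHom.quotientKerEquivOfSurjective hπ).symm.toRingHom
  have hψ₂ : ψ₂.comp π = mkι := by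
    ext s
    have : (RingHom.quotientKerEquivOfSurjective hπ).symm (π s) =
        Ideal.Quotient.mk (RingHom.ker π) s := by
      rw [RingEquiv.symm_apply_eq]
      rfl
    exact (congrArg (Ideal.Quotient.lift (RingHom.ker π) mkι hker) this).trans
      (Ideal.Quotient.lift_mk _ _ _)
  have hmax : ∀ x : S', MvPowerSeries.constantCoeff x = 0 →
      Ideal.Quotient.mk c x ∈ (Ideal.span (Set.range MvPowerSeries.X)).map mkι := by
    intro x hx
    have h1 := Ideal.mem_map_of_mem (Ideal.Quotient.mk c) (mem_span_X_of_constantCoeff_eq_zero hx)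
    rw [← Ideal.map_map]
    convert h1
    rw [Ideal.map_span, ← Set.range_comp]
    congr 2
    ext1 i
    exact MvPowerSeries.map_X (algebraMap k K) i
  have hcontr : ∀ b : Ideal A, (b.map ψ₂).comap ψ₂ = b := by
    refine fun b => le_antisymm (fun y hy => ?_) Ideal.le_comap_map
    obtain ⟨s, rfl⟩ := hπ y
    have h1 : b = (b.comap π).map π := (Ideal.map_comap_of_surjective π hπ b).symm
    rw [Ideal.mem_comap, h1, Ideal.map_map, ← RingHom.comp_apply, hψ₂, ← Ideal.map_map] at hy
    change Ideal.Quotient.mk c (ι s) ∈ _ at hy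
    rw [Ideal.mem_quotient_iff_mem (Ideal.map_mono (Ideal.ker_le_comap π))] at hy
    have h2 : s ∈ ((b.comap π).map ι).comap ι := hy
    rw [hcK] at h2
    exact h2
  have hmψ₂ : (maximalIdeal A).map ψ₂ = maximalIdeal R' := by
    refine le_antisymm (le_maximalIdeal fun h => ?_) fun y hy => ?_
    · have h1 := hcontr (maximalIdeal A)
      rw [h, Ideal.comap_top] at h1
      exact (maximalIdeal.isMaximal A).ne_top h1.symm
    · rw [← hmapπ, Ideal.map_map, hψ₂]
      obtain ⟨x, rfl⟩ := Ideal.Quotient.mk_surjective y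
      refine hmax x ?_
      by_contra hx
      have hu : IsUnit x := MvPowerSeries.isUnit_iff_constantCoeff.mpr (isUnit_iff_ne_zero.mpr hx)
      exact (mem_maximalIdeal _).mp hy (hu.map _)
  refine ⟨R', inferInstance, inferInstance, hloc, inferInstance, ψ₂.comp (algebraMap R A),
    ?_, ?_, ?_, ?_⟩
  · have h1 : (frobenius S' p).Finite :=
      frobenius_mvPowerSeries_finite p fun x => IsAlgClosed.exists_pow_nat_eq x hp.out.pos
    refine RingHom.Finite.of_comp_finite (f := Ideal.Quotient.mk c) ?_
    have h2 : (frobenius R' p).comp (Ideal.Quotient.mk c) =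
        (Ideal.Quotient.mk c).comp (frobenius S' p) := by
      ext x
      simp [frobenius_def]
    rw [h2]
    exact (RingHom.Finite.of_surjective _ Ideal.Quotient.mk_surjective).comp h1
  · intro x
    obtain ⟨x, rfl⟩ := Ideal.Quotient.mk_surjective x
    obtain ⟨b, hb⟩ := IsAlgClosed.exists_pow_nat_eq (MvPowerSeries.constantCoeff x) hp.out.pos
    refine ⟨Ideal.Quotient.mk c (MvPowerSeries.C b), ?_⟩
    rw [← hmψ₂, ← hmapπ, Ideal.map_map, hψ₂, ← map_pow, ← map_sub]
    refine hmax _ ?_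
    simp [hb]
  · rw [← Ideal.map_map, ← AdicCompletion.maximalIdeal_eq_map, hmψ₂]
  · intro J N hJ
    rw [← Ideal.map_map, ← Ideal.comap_comap]
    rw [hcontr, comap_map_adicCompletion hJ]

end FFinite

/-! ### Existence and continuity of the joint Hilbert–Kunz multiplicity -/

section Main

open IsLocalRing

/-- The growth of `λ(R/𝔞^m)` bounds the dimension. -/
theorem ringKrullDim_le_of_quotLength_pow_le {R : Type*} [CommRing R] [IsNoetherianRing R]
    [IsLocalRing R] {a : Ideal R} (ha : maximalIdeal R ≤ a.radical) (ha' : a ≠ ⊤) {C d : ℕ}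
    (h : ∀ m : ℕ, quotLength (a ^ m) ≤ C * m ^ d) : ringKrullDim R ≤ d := by
  refine iSup_le fun l => ?_
  by_contra! hlt
  have hlen : d + 1 ≤ l.length := by exact_mod_cast hlt
  have hco : ((d + 1 : ℕ) : ℕ∞) ≤ Order.coheight l.head :=
    (by exact_mod_cast hlen : ((d + 1 : ℕ) : ℕ∞) ≤ (l.length : ℕ∞)).trans
      Order.length_le_coheight_head
  obtain ⟨ε, hε, hlow⟩ := exists_le_colength_sup_pow ha ha' (d + 1) l.head hco
  obtain ⟨m, hm⟩ := exists_nat_gt ((C : ℝ) / ε)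
  have hm0 : (0 : ℝ) < m := lt_of_le_of_lt (by positivity) hm
  have h1 : colength (l.head.asIdeal ⊔ a ^ m) ≤ C * m ^ d := by
    have h2 : (quotLength (l.head.asIdeal ⊔ a ^ m)) ≤ ((C * m ^ d : ℕ) : ℕ∞) := by
      refine (quotLength_anti le_sup_right).trans ((h m).trans ?_)
      push_cast
      rfl
    exact ENat.toNat_le_of_le_natCast h2
  have h3 := hlow m (by exact_mod_cast hm0)
  have h4 : (colength (l.head.asIdeal ⊔ a ^ m) : ℝ) ≤ C * (m : ℝ) ^ d := by exact_mod_cast h1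
  rw [div_lt_iff₀ hε] at hm
  have h5 : (0 : ℝ) < (m : ℝ) ^ d := by positivity
  have h6 : ε * (m : ℝ) ^ (d + 1) = (m * ε) * (m : ℝ) ^ d := by ring
  nlinarith [mul_lt_mul_of_pos_right hm h5]

theorem map_frobeniusPower {R S : Type*} [CommRing R] [CommRing S] (p : ℕ) [Fact p.Prime]
    [CharP R p] [CharP S p] {I : Ideal R} (ψ : R →+* S) (e : ℕ) :
    (frobeniusPower I (p ^ e)).map ψ = frobeniusPower (I.map ψ) (p ^ e) := by
  rw [frobeniusPower_eq_map, frobeniusPower_eq_map, Ideal.map_map, Ideal.map_map]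
  congr 1
  ext x
  simp [iterateFrobenius_def]

theorem tendsto_colength_pow_ceil {R : Type*} [CommRing R] {a : Ideal R} {d : ℕ} {L : ℝ}
    (hL : Tendsto (fun m : ℕ => (colength (a ^ m) : ℝ) / (m : ℝ) ^ d) atTop (𝓝 L))
    {p : ℕ} (hp : 1 < p) {t : ℝ} (ht : 0 < t) :
    Tendsto (fun e : ℕ => (colength (a ^ ⌈t * ((p ^ e : ℕ) : ℝ)⌉₊) : ℝ) / ((p : ℝ) ^ e) ^ d) atTop
      (𝓝 (L * t ^ d)) := by
  have hp1 : (1 : ℝ) < p := by exact_mod_cast hp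
  have hq : Tendsto (fun e : ℕ => (p : ℝ) ^ e) atTop atTop := tendsto_pow_atTop_atTop_of_one_lt hp1
  have hN : Tendsto (fun e : ℕ => ⌈t * (p : ℝ) ^ e⌉₊) atTop atTop :=
    tendsto_nat_ceil_atTop.comp (hq.const_mul_atTop ht)
  have h2 := (hL.comp hN).mul (((tendsto_nat_ceil_mul_div_atTop ht.le).comp hq).pow d)
  refine h2.congr fun e => ?_
  have h3 : (⌈t * (p : ℝ) ^ e⌉₊ : ℝ) ≠ 0 := by
    have : 0 < ⌈t * (p : ℝ) ^ e⌉₊ := Nat.ceil_pos.mpr (by positivity)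
    exact_mod_cast this.ne'
  have h4 : (p : ℝ) ^ e ≠ 0 := by positivity
  simp only [Function.comp_apply, Nat.cast_pow, div_pow]
  field_simp

variable {R : Type*} [CommRing R] [IsNoetherianRing R] [IsLocalRing R]
  (p : ℕ) [hp : Fact p.Prime] [CharP R p] {d : ℕ} {a I : Ideal R}

theorem exists_pow_maximalIdeal_le_jointIdeal (ha : maximalIdeal R ≤ a.radical) (ha' : a ≠ ⊤)
    (hI : maximalIdeal R ≤ I.radical) (t : ℝ) (e : ℕ) :
    ∃ N : ℕ, maximalIdeal R ^ N ≤ a ^ ⌈t * ((p ^ e : ℕ) : ℝ)⌉₊ * frobeniusPower I (p ^ e) := by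
  obtain ⟨s, -, hs⟩ := exists_pow_le_of_le_radical hI
  obtain ⟨k, -, hk⟩ := exists_pow_le_of_le_radical ha
  obtain ⟨c, -, hc⟩ := exists_pow_mul_le_mul_frobeniusPower p t
    ⟨s, (Ideal.pow_right_mono (le_maximalIdeal ha') s).trans hs⟩
  refine ⟨k * (c * p ^ e), le_trans ?_ (hc e)⟩
  rw [pow_mul]
  exact Ideal.pow_right_mono hk _

theorem coe_jointLength (ha : maximalIdeal R ≤ a.radical) (ha' : a ≠ ⊤)
    (hI : maximalIdeal R ≤ I.radical) (t : ℝ) (e : ℕ) :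
    (jointLength a I t (p ^ e) : ℕ∞) =
      quotLength (a ^ ⌈t * ((p ^ e : ℕ) : ℝ)⌉₊ * frobeniusPower I (p ^ e)) := by
  obtain ⟨N, hN⟩ := exists_pow_maximalIdeal_le_jointIdeal p ha ha' hI t e
  refine ENat.natCast_toNat (quotLength_ne_top_of_maximalIdeal_le_radical fun x hx => ⟨N, hN ?_⟩)
  exact Ideal.pow_mem_pow hx N

/-- The asymptotics of the joint Hilbert–Kunz function are read off from an F-finite extension
with the same lengths. -/
theorem exists_isJointHKMultiplicity (hd : ringKrullDim R = d) (hd0 : 0 < d)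
    (ha : maximalIdeal R ≤ a.radical) (ha' : a ≠ ⊤) (hI : maximalIdeal R ≤ I.radical)
    {t : ℝ} (ht : 0 < t) : ∃ c : ℝ, IsJointHKMultiplicity p a I t c := by
  obtain ⟨R', _, _, _, _, ψ, hF, hres, hm, hcomap⟩ := exists_fFinite_extension (R := R) p
  obtain ⟨D, rfl⟩ := Nat.exists_eq_succ_of_ne_zero hd0.ne'
  have hlen : ∀ {J : Ideal R} {N : ℕ}, maximalIdeal R ^ N ≤ J →
      quotLength (J.map ψ) = quotLength J := fun hJ => quotLength_map_eq ψ hm hcomap hJ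
  have hrad : ∀ {J : Ideal R}, maximalIdeal R ≤ J.radical →
      maximalIdeal R' ≤ (J.map ψ).radical := fun {J} hJ => by
    rw [← hm]
    exact (Ideal.map_mono hJ).trans (Ideal.map_radical_le ψ)
  have ha'' : a.map ψ ≠ ⊤ := fun h => by
    have := Ideal.map_mono (f := ψ) (le_maximalIdeal ha')
    rw [h, hm, top_le_iff] at this
    exact (maximalIdeal.isMaximal R').ne_top this
  have hdim : ringKrullDim R' ≤ (D + 1 : ℕ) := by
    obtain ⟨C, hC⟩ := exists_quotLength_pow_le ha hd.le
    obtain ⟨k, -, hk⟩ := exists_pow_le_of_le_radical ha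
    refine ringKrullDim_le_of_quotLength_pow_le (hrad ha) ha'' (C := C) fun m => ?_
    rw [← Ideal.map_pow, hlen (N := k * m) (by rw [pow_mul]; exact Ideal.pow_right_mono hk m)]
    exact hC m
  obtain ⟨c, hc⟩ := exists_isBigO_jointLength p hF hres (hrad ha) ha'' (hrad hI) hdim ht
  refine ⟨c, ?_⟩
  rw [IsJointHKMultiplicity, dim_eq hd]
  refine hc.congr_left fun e => ?_
  obtain ⟨N, hN⟩ := exists_pow_maximalIdeal_le_jointIdeal p ha ha' hI t e
  have h1 : jointLength (a.map ψ) (I.map ψ) t (p ^ e) = jointLength a I t (p ^ e) := by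
    rw [jointLength, jointLength, colength_eq_toNat, colength_eq_toNat, ← hlen hN, Ideal.map_mul,
      Ideal.map_pow, map_frobeniusPower]
  rw [h1]

theorem jointLength_mono (ha : maximalIdeal R ≤ a.radical) (ha' : a ≠ ⊤)
    (hI : maximalIdeal R ≤ I.radical) {t t' : ℝ} (htt : t ≤ t') (e : ℕ) :
    jointLength a I t (p ^ e) ≤ jointLength a I t' (p ^ e) := by
  have h : (jointLength a I t (p ^ e) : ℕ∞) ≤ jointLength a I t' (p ^ e) := by
    rw [coe_jointLength p ha ha' hI, coe_jointLength p ha ha' hI]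
    exact quotLength_anti (mul_le_mul_left (Ideal.pow_le_pow_right
      (Nat.ceil_le_ceil (by gcongr))) _)
  exact_mod_cast h

/-- `𝔞^N I^[q] / 𝔞^N' I^[q]` is a quotient of a direct sum of `n` copies of `𝔞^N / 𝔞^N'`. -/
theorem jointLength_add_le (ha : maximalIdeal R ≤ a.radical) (ha' : a ≠ ⊤)
    (hI : maximalIdeal R ≤ I.radical) {n : ℕ} {f : Fin n → R} (hf : Ideal.span (Set.range f) = I)
    {t t' : ℝ} (htt : t ≤ t') (e : ℕ) :
    jointLength a I t' (p ^ e) + n * colength (a ^ ⌈t * ((p ^ e : ℕ) : ℝ)⌉₊) ≤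
      jointLength a I t (p ^ e) + n * colength (a ^ ⌈t' * ((p ^ e : ℕ) : ℝ)⌉₊) := by
  have h := quotLength_mul_add_le (a := a ^ ⌈t * ((p ^ e : ℕ) : ℝ)⌉₊)
    (Ideal.pow_le_pow_right (Nat.ceil_le_ceil (by gcongr) :
      ⌈t * ((p ^ e : ℕ) : ℝ)⌉₊ ≤ ⌈t' * ((p ^ e : ℕ) : ℝ)⌉₊)) (fun i => f i ^ p ^ e)
  rw [← map_iterateFrobenius_span, hf, ← frobeniusPower_eq_map, ← coe_jointLength p ha ha' hI,
    ← coe_jointLength p ha ha' hI, ← coe_colength_pow ha, ← coe_colength_pow ha] at h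
  exact_mod_cast h

/-- Monotonicity of `t ↦ e_HK(𝔞^t, I)`, and the bound on its increments, as limits of the
corresponding inequalities between colengths. -/
theorem eHK_sub_mem (hd : ringKrullDim R = d) (hd0 : 0 < d)
    (ha : maximalIdeal R ≤ a.radical) (ha' : a ≠ ⊤) (hI : maximalIdeal R ≤ I.radical)
    {n : ℕ} {f : Fin n → R} (hf : Ideal.span (Set.range f) = I) {t t' : ℝ} (ht : 0 < t)
    (htt : t ≤ t') :
    0 ≤ eHK p a I t' - eHK p a I t ∧
      eHK p a I t' - eHK p a I t ≤
        n * hilbertSamuelMultiplicity a * (t' ^ d - t ^ d) / d.factorial := by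
  have hdim := dim_eq hd
  have hp1 : (1 : ℝ) < p := by exact_mod_cast hp.out.one_lt
  have hlim : ∀ {s : ℝ}, 0 < s → Tendsto
      (fun e : ℕ => (jointLength a I s (p ^ e) : ℝ) / ((p : ℝ) ^ e) ^ d) atTop
      (𝓝 (eHK p a I s)) := fun hs => by
    have := IsJointHKMultiplicity.tendsto hp.out.one_lt (hdim ▸ hd0)
      (Classical.epsilon_spec (exists_isJointHKMultiplicity p hd hd0 ha ha' hI hs))
    rwa [hdim] at this
  have ht' := ht.trans_le htt
  obtain ⟨L, hL⟩ := exists_tendsto_colength_pow_div ha hd.le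
  have hHS : hilbertSamuelMultiplicity a = d.factorial * L := by
    rw [hilbertSamuelMultiplicity, hdim]
    refine Tendsto.limUnder_eq ((hL.const_mul (d.factorial : ℝ)).congr fun k => ?_)
    rw [mul_div_assoc]
  have hpos : ∀ e : ℕ, (0 : ℝ) < ((p : ℝ) ^ e) ^ d := fun e => by positivity
  constructor
  · refine sub_nonneg.mpr (le_of_tendsto_of_tendsto' (hlim ht) (hlim ht') fun e => ?_)
    exact div_le_div_of_nonneg_right
      (by exact_mod_cast jointLength_mono p ha ha' hI htt e) (hpos e).le
  · have h1 := (hlim ht').add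
      ((tendsto_colength_pow_ceil hL hp.out.one_lt ht).const_mul (n : ℝ))
    have h2 := (hlim ht).add
      ((tendsto_colength_pow_ceil hL hp.out.one_lt ht').const_mul (n : ℝ))
    have h3 := le_of_tendsto_of_tendsto' h1 h2 fun e => by
      rw [← mul_div_assoc, ← mul_div_assoc, ← add_div, ← add_div]
      exact div_le_div_of_nonneg_right
        (by exact_mod_cast jointLength_add_le p ha ha' hI hf htt e) (hpos e).le
    have h4 : (n : ℝ) * hilbertSamuelMultiplicity a * (t' ^ d - t ^ d) / d.factorial =
        n * (L * t' ^ d) - n * (L * t ^ d) := by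
      have : (d.factorial : ℝ) ≠ 0 := by positivity
      rw [hHS]
      field_simp
    rw [h4]
    linarith

end Main

end JointHK


theorem theorem3p9 {R : Type*} [CommRing R] [IsNoetherianRing R] [IsLocalRing R]
    (p : ℕ) [Fact p.Prime] [CharP R p]
    (d : ℕ) (hd : ringKrullDim R = d) (hd0 : 0 < d)
    (𝔞 I : Ideal R) (h𝔞 : JointHK.IsMPrimary 𝔞) (hI : JointHK.IsMPrimary I) :
    (∀ t : ℝ, 0 < t → JointHK.IsJointHKMultiplicity p 𝔞 I t (JointHK.eHK p 𝔞 I t)) ∧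
    ContinuousOn (fun t : ℝ => JointHK.eHK p 𝔞 I t) (Set.Ioi 0) ∧
    ∀ (n : ℕ) (f : Fin n → R), Ideal.span (Set.range f) = I →
      ∀ t t' : ℝ, 0 < t → t ≤ t' →
        0 ≤ JointHK.eHK p 𝔞 I t' - JointHK.eHK p 𝔞 I t ∧
        JointHK.eHK p 𝔞 I t' - JointHK.eHK p 𝔞 I t ≤
          (n : ℝ) * JointHK.hilbertSamuelMultiplicity 𝔞 * (t' ^ d - t ^ d)
            / (d.factorial : ℝ) := by
  have ha := h𝔞.2.ge
  have ha' : 𝔞 ≠ ⊤ := h𝔞.1.ne_top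
  have hbound {n : ℕ} {f : Fin n → R} (hf : Ideal.span (Set.range f) = I) {t t' : ℝ} (ht : 0 < t)
      (htt : t ≤ t') := JointHK.eHK_sub_mem p hd hd0 ha ha' hI.2.ge hf ht htt
  refine ⟨fun t ht => Classical.epsilon_spec
    (JointHK.exists_isJointHKMultiplicity p hd hd0 ha ha' hI.2.ge ht), fun t ht => ?_,
    fun n f hf t t' ht htt => hbound hf ht htt⟩
  obtain ⟨n, f, hf⟩ := Submodule.fg_iff_exists_fin_generating_family.mp
    (IsNoetherian.noetherian I)
  set M : ℝ := n * JointHK.hilbertSamuelMultiplicity 𝔞 / d.factorial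
  rw [ContinuousWithinAt, tendsto_iff_norm_sub_tendsto_zero]
  have hM : Tendsto (fun s : ℝ => |M * (s ^ d - t ^ d)|) (𝓝[Set.Ioi 0] t) (𝓝 0) := by
    have : Continuous fun s : ℝ => |M * (s ^ d - t ^ d)| := by fun_prop
    have h0 := this.tendsto t
    simp only [sub_self, mul_zero, abs_zero] at h0
    exact h0.mono_left nhdsWithin_le_nhds
  refine squeeze_zero' (Eventually.of_forall fun s => norm_nonneg _) ?_ hM
  filter_upwards [self_mem_nhdsWithin] with s hs
  rw [Real.norm_eq_abs]
  rcases le_total s t with hst | hst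
  · obtain ⟨h1, h2⟩ := hbound hf hs hst
    rw [abs_sub_comm, abs_of_nonneg h1, abs_mul, abs_sub_comm, ← abs_mul]
    refine (h2.trans (le_of_eq ?_)).trans (le_abs_self _)
    ring
  · obtain ⟨h1, h2⟩ := hbound hf ht hst
    rw [abs_of_nonneg h1]
    refine (h2.trans (le_of_eq ?_)).trans (le_abs_self _)
    ring
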